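/- Let $p$ be a prime. Consider quantum circuits on $p$-dimensional qudits with computational basis $|x\rangle$, $x\in\{0,\dots,p-1\}=\mathbb F_p$. A circuit is a sequence of layers; each layer consists of gates acting on pairwise disjoint sets of qudits; its depth is the number of layers and its size is measured by the number of qudits (ancillas included) and the number of gates. A circuit on $w+a$ qudits implements an operator $U$ on $w$ qudits if it maps $|\psi\rangle|0\rangle^{\otimes a}$ to $(U|\psi\rangle)|0\rangle^{\otimes a}$ for every $|\psi\rangle$. The infinite base gate set consists of all one-qudit unitaries $V$ and all controlled gates $|j\rangle|m\rangle\mapsto|j\rangle V^j|m\rangle$ with $V$ a one-qudit unitary. For every $n\ge 0$ and $k\ge 0$ let $$\mathsf{qMOD}_p|x_0,x_1,\dots,x_n\rangle=|x_0+(x_1+\dots+x_n)\bmod p,\;x_1,\dots,x_n\rangle,$$ $$\mathsf{qTH}_k|x_0,x_1,\dots,x_n\rangle=|x_0+\mathsf{TH}_k(x_1,\dots,x_n)\bmod p,\;x_1,\dots,x_n\rangle,$$ where $\mathsf{TH}_k(x_1,\dots,x_n)=1$ if the integer sum $\sum_{i=1}^n x_i$ is at least $k$, and $0$ otherwise. Let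 $\mathsf{i}\text{-}\mathsf{QNC}_p^0[p]$ (respectively $\mathsf{i}\text{-}\mathsf{QTC}_p^0$) be the class of all families $(U_n)_{n\in\mathbb N}$ of unitary operators, $U_n$ acting on $w(n)$ qudits for some function $w$, that are implemented by (non-uniform) families of circuits of constant depth and of size polynomial in $n$ over the base gate set together with the gates $\mathsf{qMOD}_p$ (respectively $\mathsf{qTH}_k$, for all $k$) of unbounded fan-in. Then: 1. There are a constant $D$ and a polynomial $P$ (depending only on $p$) such that for all $n$ and $k$ the gate $\mathsf{qTH}_k$ on $n+1$ qudits is implemented by a circuit over the base gate set and $\mathsf{qMOD}_p$ gates with depth at most $D$, at most $P(n)$ qudits and at most $P(n)$ gates. 2. $\mathsf{i}\text{-}\mathsf{QNC}_p^0[p]=\mathsf{i}\text{-}\mathsf{QTC}_p^0$. -/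

import Mathlib

/-! Exact circuits of `d`-dimensional qudits.  The computational basis of `N` qudits is indexed by
`Fin N → ZMod d`, and operators are complex matrices over that index type: the entry `M x y` is the
amplitude `⟨x| M |y⟩`. -/

namespace Qudit

/-- Elementary gates on `N` wires carrying `d`-dimensional qudits. The control wires of the
unbounded fan-in gates form a finite set of any size not containing the target wire. -/
inductive Gate (d : ℕ) [NeZero d] (N : ℕ) : Type
  /-- an arbitrary one-qudit unitary on wire `t` -/
  | single (t : Fin N) (U : Matrix.unitaryGroup (ZMod d) ℂ) : Gate d N
  /-- the controlled gate `|j⟩|m⟩ ↦ |j⟩ U ^ j |m⟩` of an arbitrary one-qudit unitary `U`,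
  with control wire `c` and target wire `t` -/
  | controlled (c t : Fin N) (hct : c ≠ t) (U : Matrix.unitaryGroup (ZMod d) ℂ) : Gate d N
  /-- the quantum modular gate `|x₀, x₁, …, xₙ⟩ ↦ |x₀ + (x₁ + ⋯ + xₙ) mod d, x₁, …, xₙ⟩` -/
  | qMOD (t : Fin N) (S : Finset (Fin N)) (ht : t ∉ S) : Gate d N
  /-- the quantum threshold gate `|x₀, x₁, …, xₙ⟩ ↦ |x₀ + TH_k(x₁, …, xₙ) mod d, x₁, …, xₙ⟩` -/
  | qTH (k : ℕ) (t : Fin N) (S : Finset (Fin N)) (ht : t ∉ S) : Gate d N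

/-- The threshold function `TH_k` of the wires in `S`: it is `1` if the sum of the entries, taken as
integers in `{0, …, d - 1}`, is at least `k`, and `0` otherwise. -/
def threshold {d N : ℕ} (k : ℕ) (S : Finset (Fin N)) (x : Fin N → ZMod d) : ZMod d :=
  if k ≤ ∑ j ∈ S, (x j).val then 1 else 0

/-- The operator that applies the one-qudit matrix `W y` to wire `t` when the input is the basis
state `y`, and leaves all other wires alone. -/
def onTarget {d N : ℕ} (t : Fin N) (W : (Fin N → ZMod d) → Matrix (ZMod d) (ZMod d) ℂ) :
    Matrix (Fin N → ZMod d) (Fin N → ZMod d) ℂ :=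
  fun x y => if ∀ j, j ≠ t → x j = y j then W y (x t) (y t) else 0

/-- The operator `|m⟩ ↦ |m + s⟩` on one qudit. -/
def shift {d : ℕ} (s : ZMod d) : Matrix (ZMod d) (ZMod d) ℂ :=
  fun l m => if l = m + s then 1 else 0

namespace Gate

variable {d : ℕ} [NeZero d] {N : ℕ}

/-- The wires on which a gate acts, controls included. -/
def support : Gate d N → Finset (Fin N)
  | single t _ => {t}
  | controlled c t _ _ => {c, t}
  | qMOD t S _ => insert t S
  | qTH _ t S _ => insert t S

/-- The operator of a gate on the space of all `N` qudits. -/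
def op : Gate d N → Matrix (Fin N → ZMod d) (Fin N → ZMod d) ℂ
  | single t U => onTarget t fun _ => (U : Matrix (ZMod d) (ZMod d) ℂ)
  | controlled c t _ U => onTarget t fun y => (U : Matrix (ZMod d) (ZMod d) ℂ) ^ (y c).val
  | qMOD t S _ => onTarget t fun y => shift (∑ j ∈ S, y j)
  | qTH k t S _ => onTarget t fun y => shift (threshold k S y)

end Gate

/-- A layer: gates acting on pairwise disjoint sets of wires, hence applied in parallel. -/
structure Layer (d : ℕ) [NeZero d] (N : ℕ) where
  gates : List (Gate d N)
  disjoint : gates.Pairwise fun g h => Disjoint g.support h.support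

/-- The operator of a layer. The factors commute, as the gates act on disjoint wires. -/
def Layer.op {d : ℕ} [NeZero d] {N : ℕ} (L : Layer d N) :
    Matrix (Fin N → ZMod d) (Fin N → ZMod d) ℂ :=
  (L.gates.map Gate.op).prod

/-- A circuit: a list of layers, the head of the list being applied first. -/
structure Circuit (d : ℕ) [NeZero d] (N : ℕ) where
  layers : List (Layer d N)

/-- A gate set: the gates that are allowed, for each number of wires. -/
abbrev GateSet (d : ℕ) [NeZero d] : Type := ∀ N : ℕ, Set (Gate d N)

namespace Circuit

variable {d : ℕ} [NeZero d] {N : ℕ}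

/-- The number of layers. -/
def depth (C : Circuit d N) : ℕ := C.layers.length

/-- The total number of gates. -/
def gateCount (C : Circuit d N) : ℕ := (C.layers.map fun L => L.gates.length).sum

/-- All gates of the circuit belong to the gate set `𝒢`. -/
def UsesOnly (C : Circuit d N) (𝒢 : GateSet d) : Prop :=
  ∀ L ∈ C.layers, ∀ g ∈ L.gates, g ∈ 𝒢 N

/-- The operator of a circuit. -/
def op (C : Circuit d N) : Matrix (Fin N → ZMod d) (Fin N → ZMod d) ℂ :=
  (C.layers.map Layer.op).reverse.prod

/-- A circuit on `w + a` wires implements exactly the operator `U` on its first `w` qudits, the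
other `a` qudits being ancillas that start in `|0⟩` and are returned to `|0⟩`:
`C (|ψ⟩ ⊗ |0⟩) = (U |ψ⟩) ⊗ |0⟩` for all `ψ`. -/
def Implements {w a : ℕ} (C : Circuit d (w + a))
    (U : Matrix (Fin w → ZMod d) (Fin w → ZMod d) ℂ) : Prop :=
  ∀ (x y : Fin w → ZMod d) (r : Fin a → ZMod d),
    C.op (Fin.append x r) (Fin.append y 0) = if r = 0 then U x y else 0

end Circuit

/-- The operator `U` on `w` qudits is implemented exactly, with clean ancillas, by a circuit over
`𝒢` of depth at most `D` that has at most `s` qudits (ancillas included) and at most `s` gates. -/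
def ImplementableIn {d : ℕ} [NeZero d] (𝒢 : GateSet d) {w : ℕ}
    (U : Matrix (Fin w → ZMod d) (Fin w → ZMod d) ℂ) (D s : ℕ) : Prop :=
  ∃ (a : ℕ) (C : Circuit d (w + a)),
    C.UsesOnly 𝒢 ∧ C.Implements U ∧ C.depth ≤ D ∧ w + a ≤ s ∧ C.gateCount ≤ s

/-- A family of unitary operations, the `n`-th one acting on `width n` qudits. -/
structure OperationFamily (d : ℕ) [NeZero d] where
  width : ℕ → ℕ
  op : ∀ n, Matrix.unitaryGroup (Fin (width n) → ZMod d) ℂ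

/-- The families of operations implemented by constant-depth, polynomial-size circuits over `𝒢`. -/
def constantDepthClass {d : ℕ} [NeZero d] (𝒢 : GateSet d) : Set (OperationFamily d) :=
  {F | ∃ (D : ℕ) (P : Polynomial ℕ), ∀ n : ℕ, ImplementableIn 𝒢
    (F.op n : Matrix (Fin (F.width n) → ZMod d) (Fin (F.width n) → ZMod d) ℂ) D (P.eval n)}

/-- The infinite gate set of all one-qudit unitaries and all singly controlled one-qudit
unitaries. -/
def baseGates (d : ℕ) [NeZero d] : GateSet d := fun _ =>
  {g | (∃ t U, g = Gate.single t U) ∨ ∃ c t h U, g = Gate.controlled c t h U}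

/-- The infinite gate set together with the unbounded fan-in quantum modular gates. -/
def modGates (d : ℕ) [NeZero d] : GateSet d := fun N =>
  baseGates d N ∪ {g | ∃ t S h, g = Gate.qMOD t S h}

/-- The infinite gate set together with the unbounded fan-in quantum threshold gates. -/
def thresholdGates (d : ℕ) [NeZero d] : GateSet d := fun N =>
  baseGates d N ∪ {g | ∃ k t S h, g = Gate.qTH k t S h}

/-- The class `i-QNC_d⁰[d]`. -/
def iQNCMod (d : ℕ) [NeZero d] : Set (OperationFamily d) := constantDepthClass (modGates d)

/-- The class `i-QTC_d⁰`. -/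
def iQTC (d : ℕ) [NeZero d] : Set (OperationFamily d) := constantDepthClass (thresholdGates d)

/-- The quantum threshold gate `qTH_k` on `n + 1` qudits `|x₀, x₁, …, xₙ⟩`, with target `x₀`. -/
def qTHGate (d : ℕ) [NeZero d] (n k : ℕ) : Gate d (n + 1) :=
  Gate.qTH k 0 (Finset.univ.erase 0) (Finset.notMem_erase 0 Finset.univ)

end Qudit

namespace Qudit

open Matrix

set_option linter.unusedSectionVars false

/-! Both inclusions pass through fan-out. Conjugation by the one-qudit Fourier transform turns
shifts into phases, so the modular gate, the fan-out `copyOp` and the diagonal operator `starOp` all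
amount to the same thing (`feas_starOp_of_modOp`, `feas_copyOp_of_starOp`, `feas_modOp_of_starOp`).
Once fan-out is available, polynomially many commuting phases can be applied at once on separate
copies of the input (`Feas.diag_prod`). Garbage is removed by computing, applying a phase and
uncomputing (`Feas.diag_conj`); the computed state may be a superposition as long as the phase is
constant on its support.

Thresholds from modular gates: let `s` be the integer sum of the inputs. For each candidate `t`,
logarithmically many qudits receive the Fourier phases of `(s - t) / p ^ (k + 1)`. If `s = t` they
all stay zero; otherwise the qudit at the `p`-adic valuation of `s - t` is certainly nonzero
(`cmpOp_ne_zero`). Whether such a short register vanishes is decided exactly by averaging over all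
linear forms (`two_mul_sum_linear`, `feas_neqZero`), of which there are only polynomially many.
Adding up the tests over `t ≥ k` gives the threshold (`feas_threshold_diag`).

Modular gates from thresholds: the crux is a state whose designated qudits are all 0 or all 1, each
with probability one half (`exists_feas_cat`). A column of odd length is prepared that is all zero
with high probability and all one with probability of order `1 / m`. About `m` such columns form a
grid, and the disjunction along each row yields constant masses on the two constant row patterns. An
extra qudit trims both masses to `sin (π / 18) ^ 2 / 2`, and two rounds of amplitude amplification
are then exact, since the angle goes `π / 18`, `π / 6`, `π / 2` (`boost_boost_col`). Phase kickback
on this state detects parity (`exists_feas_parity`), hence gives fan-out of bits. A qudit is a sum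
of threshold bits, so `starOp` follows (`feas_starOp_th`).

Finally, gate-by-gate replacement compares the two classes (`Translates.constantDepthClass_subset`).
-/

/-- Operators on the qudits labelled by `ι`. -/
abbrev Op (d : ℕ) (ι : Type) : Type := Matrix (ι → ZMod d) (ι → ZMod d) ℂ

/-! ### Operators on labelled wires, their extension to more wires, and ancillas. -/

section Operators

variable {d : ℕ} [NeZero d] {ι κ α β : Type}
  [Fintype ι] [DecidableEq ι] [Fintype κ] [DecidableEq κ]
  [Fintype α] [DecidableEq α] [Fintype β] [DecidableEq β]

/-- Apply `W y` to wire `t` on the basis state `y`. -/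
def tgt (t : ι) (W : (ι → ZMod d) → Matrix (ZMod d) (ZMod d) ℂ) : Op d ι :=
  fun x y => if ∀ j, j ≠ t → x j = y j then W y (x t) (y t) else 0

/-- `W` does not depend on coordinate `t`. -/
def Indep (t : ι) (W : (ι → ZMod d) → Matrix (ZMod d) (ZMod d) ℂ) : Prop :=
  ∀ x y, (∀ j, j ≠ t → x j = y j) → W x = W y

open Classical in
/-- The operator `U` on the wires in the range of `e`, the identity elsewhere. -/
noncomputable def lift (e : ι ↪ κ) (U : Op d ι) : Op d κ :=
  fun x y => if ∀ j, j ∉ Set.range e → x j = y j then U (x ∘ e) (y ∘ e) else 0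

/-- The state `ψ` together with ancillas in the state `0`. -/
def inflate (α : Type) [Fintype α] [DecidableEq α] (ψ : (ι → ZMod d) → ℂ) :
    (ι ⊕ α → ZMod d) → ℂ :=
  fun z => if z ∘ Sum.inr = 0 then ψ (z ∘ Sum.inl) else 0

lemma indep_const (t : ι) (V : Matrix (ZMod d) (ZMod d) ℂ) : Indep t (fun _ => V) :=
  fun _ _ _ => rfl

lemma tgt_conjTranspose {t : ι} {W : (ι → ZMod d) → Matrix (ZMod d) (ZMod d) ℂ}
    (hW : Indep t W) : (tgt t W)ᴴ = tgt t (fun y => (W y)ᴴ) := by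
  ext x y
  simp only [conjTranspose_apply, tgt]
  by_cases h : ∀ j, j ≠ t → x j = y j
  · have h' : ∀ j, j ≠ t → y j = x j := fun j hj => (h j hj).symm
    rw [if_pos h, if_pos h', hW x y h]
  · have h' : ¬ ∀ j, j ≠ t → y j = x j := fun h' => h fun j hj => (h' j hj).symm
    rw [if_neg h, if_neg h', star_zero]

lemma tgt_mulVec (t : ι) (W : (ι → ZMod d) → Matrix (ZMod d) (ZMod d) ℂ)
    (ψ : (ι → ZMod d) → ℂ) (x : ι → ZMod d) :
    (tgt t W *ᵥ ψ) x =
      ∑ m, W (Function.update x t m) (x t) m * ψ (Function.update x t m) := by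
  simp only [mulVec, dotProduct, tgt, ite_mul, zero_mul]
  rw [← Finset.sum_filter]
  refine Finset.sum_nbij' (fun y => y t) (fun m => Function.update x t m) ?_ ?_ ?_ ?_ ?_
  · simp
  · intro m _
    simp only [Finset.mem_filter, Finset.mem_univ, true_and]
    intro j hj
    simp [hj]
  · intro y hy
    simp only [Finset.mem_filter, Finset.mem_univ, true_and] at hy
    funext j
    by_cases hj : j = t
    · subst hj; simp
    · simp [hj, hy j hj]
  · simp
  · intro y hy
    simp only [Finset.mem_filter, Finset.mem_univ, true_and] at hy
    have : Function.update x t (y t) = y := by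
      funext j
      by_cases hj : j = t
      · subst hj; simp
      · simp [hj, hy j hj]
    rw [this]

lemma op_ext {U V : Op d ι} (h : ∀ ψ x, (U *ᵥ ψ) x = (V *ᵥ ψ) x) : U = V := by
  ext x y
  simpa using h (Pi.single y 1) x

lemma tgt_mul {t : ι} {W W' : (ι → ZMod d) → Matrix (ZMod d) (ZMod d) ℂ}
    (hW : Indep t W) (hW' : Indep t W') :
    tgt t W * tgt t W' = tgt t (fun y => W y * W' y) := by
  refine op_ext fun ψ x => ?_
  rw [← mulVec_mulVec, tgt_mulVec, tgt_mulVec]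
  have key : ∀ m, W (Function.update x t m) = W x :=
    fun m => hW _ _ fun j hj => by simp [hj]
  have key' : ∀ m, W' (Function.update x t m) = W' x :=
    fun m => hW' _ _ fun j hj => by simp [hj]
  simp only [tgt_mulVec, Function.update_self, Function.update_idem, key, key', Matrix.mul_apply,
    Finset.mul_sum, Finset.sum_mul]
  rw [Finset.sum_comm]
  refine Finset.sum_congr rfl fun m _ => Finset.sum_congr rfl fun l _ => by ring

lemma tgt_one (t : ι) : tgt t (fun _ => (1 : Matrix (ZMod d) (ZMod d) ℂ)) = 1 := by
  ext x y
  simp only [tgt, Matrix.one_apply]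
  by_cases h : x = y
  · simp [h]
  · rw [if_neg h]
    split_ifs with h1 h2
    · refine absurd (funext fun j => ?_) h
      by_cases hj : j = t
      · exact hj ▸ h2
      · exact h1 j hj
    · rfl
    · rfl

lemma tgt_pow {t : ι} {W : (ι → ZMod d) → Matrix (ZMod d) (ZMod d) ℂ}
    (hW : Indep t W) (k : ℕ) : tgt t W ^ k = tgt t (fun y => W y ^ k) := by
  induction k with
  | zero => simp [tgt_one]
  | succ k ih =>
    rw [pow_succ, ih, tgt_mul (fun x y h => by rw [hW x y h]) hW]
    simp only [pow_succ]

lemma tgt_unitary {t : ι} {W : (ι → ZMod d) → Matrix (ZMod d) (ZMod d) ℂ}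
    (hW : Indep t W) (hU : ∀ y, (W y)ᴴ * W y = 1) : (tgt t W)ᴴ * tgt t W = 1 := by
  rw [tgt_conjTranspose hW, tgt_mul (fun x y h => by rw [hW x y h]) hW]
  simp only [hU, tgt_one]

section Lift

lemma lift_mulVec (e : ι ↪ κ) (U : Op d ι) (ψ : (κ → ZMod d) → ℂ) (x : κ → ZMod d) :
    (lift e U *ᵥ ψ) x = ∑ y, U (x ∘ e) y * ψ (Function.extend e y x) := by
  classical
  simp only [mulVec, dotProduct, lift, ite_mul, zero_mul]
  rw [← Finset.sum_filter]
  have hx : ∀ y : κ → ZMod d, (∀ j, j ∉ Set.range e → x j = y j) →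
      Function.extend e (y ∘ e) x = y := by
    intro y hy
    funext j
    by_cases hj : j ∈ Set.range e
    · obtain ⟨i, rfl⟩ := hj
      rw [e.injective.extend_apply]; rfl
    · rw [Function.extend_apply' _ _ _ (by simpa using hj), hy j hj]
  refine Finset.sum_nbij' (fun y => y ∘ e) (fun y => Function.extend e y x) ?_ ?_ ?_ ?_ ?_
  · simp
  · intro y _
    simp only [Finset.mem_filter, Finset.mem_univ, true_and]
    intro j hj
    rw [Function.extend_apply' _ _ _ (by simpa using hj)]
  · intro y hy
    simp only [Finset.mem_filter, Finset.mem_univ, true_and] at hy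
    exact hx y hy
  · intro y _
    exact Function.extend_comp e.injective _ _
  · intro y hy
    simp only [Finset.mem_filter, Finset.mem_univ, true_and] at hy
    rw [hx y hy]

lemma extend_extend (e : ι ↪ κ) (y z : ι → ZMod d) (x : κ → ZMod d) :
    Function.extend e y (Function.extend e z x) = Function.extend e y x := by
  funext j
  by_cases hj : ∃ i, e i = j
  · obtain ⟨i, rfl⟩ := hj
    rw [e.injective.extend_apply, e.injective.extend_apply]
  · rw [Function.extend_apply' _ _ _ hj, Function.extend_apply' _ _ _ hj,
      Function.extend_apply' _ _ _ hj]

lemma lift_mul (e : ι ↪ κ) (U V : Op d ι) : lift e (U * V) = lift e U * lift e V := by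
  refine op_ext fun ψ x => ?_
  rw [← mulVec_mulVec, lift_mulVec, lift_mulVec]
  simp only [lift_mulVec, extend_extend, Function.extend_comp e.injective, Matrix.mul_apply,
    Finset.mul_sum, Finset.sum_mul]
  rw [Finset.sum_comm]
  refine Finset.sum_congr rfl fun m _ => Finset.sum_congr rfl fun l _ => by ring

lemma lift_one (e : ι ↪ κ) : lift e (1 : Op d ι) = 1 := by
  classical
  ext x y
  simp only [lift, Matrix.one_apply]
  by_cases h : x = y
  · simp [h]
  · rw [if_neg h]
    split_ifs with h1 h2
    · refine absurd (funext fun j => ?_) h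
      by_cases hj : j ∈ Set.range e
      · obtain ⟨i, rfl⟩ := hj
        exact congrFun h2 i
      · exact h1 j hj
    · rfl
    · rfl

lemma lift_tgt (e : ι ↪ κ) (t : ι)
    (W : (ι → ZMod d) → Matrix (ZMod d) (ZMod d) ℂ) :
    lift e (tgt t W) = tgt (e t) (fun y => W (y ∘ e)) := by
  classical
  ext x y
  simp only [lift, tgt, ← ite_and, Function.comp_apply]
  congr 1
  rw [eq_iff_iff]
  constructor
  · rintro ⟨h1, h2⟩ j hj
    by_cases hr : j ∈ Set.range e
    · obtain ⟨i, rfl⟩ := hr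
      exact h2 i fun h => hj (h ▸ rfl)
    · exact h1 j hr
  · intro h
    refine ⟨fun j hj => h j fun hjt => hj ⟨t, hjt.symm⟩, fun i hi => h _ fun he => hi (e.injective he)⟩

lemma lift_diagonal (e : ι ↪ κ) (φ : (ι → ZMod d) → ℂ) :
    lift e (diagonal φ) = diagonal (fun x => φ (x ∘ e)) := by
  classical
  ext x y
  by_cases h : x = y
  · simp [lift, h]
  · rw [diagonal_apply_ne _ h, lift]
    split_ifs with h1
    · refine diagonal_apply_ne _ fun h2 => h (funext fun j => ?_)
      by_cases hj : j ∈ Set.range e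
      · obtain ⟨i, rfl⟩ := hj
        exact congrFun h2 i
      · exact h1 j hj
    · rfl

/-- Overwriting the wires of `e` does not change what `f` reads, and conversely, so the two double
sums agree after exchanging the order of summation. -/
lemma lift_commute {e : ι ↪ κ} {f : α ↪ κ} (h : Disjoint (Set.range e) (Set.range f))
    (U : Op d ι) (V : Op d α) : Commute (lift e U) (lift f V) := by
  have h1 : ∀ (y : ι → ZMod d) (x : κ → ZMod d), Function.extend e y x ∘ f = x ∘ f := by
    intro y x
    funext i
    refine Function.extend_apply' _ _ _ ?_
    rintro ⟨j, hj⟩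
    exact Set.disjoint_left.mp h ⟨j, hj⟩ ⟨i, rfl⟩
  have h2 : ∀ (y : α → ZMod d) (x : κ → ZMod d), Function.extend f y x ∘ e = x ∘ e := by
    intro y x
    funext i
    refine Function.extend_apply' _ _ _ ?_
    rintro ⟨j, hj⟩
    exact Set.disjoint_left.mp h ⟨i, rfl⟩ ⟨j, hj⟩
  have h3 : ∀ (y : ι → ZMod d) (z : α → ZMod d) (x : κ → ZMod d),
      Function.extend f z (Function.extend e y x) = Function.extend e y (Function.extend f z x) := by
    intro y z x
    funext j
    by_cases hj : ∃ i, e i = j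
    · obtain ⟨i, rfl⟩ := hj
      rw [e.injective.extend_apply, Function.extend_apply' _ _ _, e.injective.extend_apply]
      rintro ⟨k, hk⟩
      exact Set.disjoint_left.mp h ⟨i, rfl⟩ ⟨k, hk⟩
    · rw [Function.extend_apply' (f := e) _ _ _ hj]
      by_cases hk : ∃ i, f i = j
      · obtain ⟨i, rfl⟩ := hk
        rw [f.injective.extend_apply, f.injective.extend_apply]
      · rw [Function.extend_apply' (f := f) _ _ _ hk, Function.extend_apply' (f := f) _ _ _ hk,
          Function.extend_apply' (f := e) _ _ _ hj]
  refine op_ext fun ψ x => ?_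
  rw [← mulVec_mulVec, lift_mulVec, ← mulVec_mulVec, lift_mulVec]
  simp only [lift_mulVec, h1, h2, h3, Finset.mul_sum]
  rw [Finset.sum_comm]
  refine Finset.sum_congr rfl fun m _ => Finset.sum_congr rfl fun l _ => by ring

lemma lift_equiv_apply (e : ι ≃ κ) (U : Op d ι) (x y : κ → ZMod d) :
    lift e.toEmbedding U x y = U (x ∘ e) (y ∘ e) := by
  classical
  rw [lift, if_pos]
  · rfl
  · intro j hj
    exact absurd ⟨e.symm j, by simp⟩ hj

end Lift

section Inflate

lemma inflate_add (ψ φ : (ι → ZMod d) → ℂ) :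
    inflate α (ψ + φ) = inflate α ψ + inflate α φ := by
  funext z
  simp only [inflate, Pi.add_apply]
  split_ifs <;> simp

lemma inflate_single (x : ι → ZMod d) :
    inflate α (Pi.single x 1) = Pi.single (Sum.elim x (0 : α → ZMod d)) 1 := by
  funext z
  simp only [inflate, Pi.single_apply]
  by_cases h : z = Sum.elim x 0
  · subst h; simp
  · rw [if_neg h]
    split_ifs with h1 h2
    · refine absurd (funext fun j => ?_) h
      cases j with
      | inl j => exact congrFun h2 j
      | inr j => exact congrFun h1 j
    · rfl
    · rfl

lemma dotProduct_inflate (ψ φ : (ι → ZMod d) → ℂ) :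
    star (inflate α ψ) ⬝ᵥ inflate α φ = star ψ ⬝ᵥ φ := by
  simp only [dotProduct, Pi.star_apply]
  rw [← (Equiv.sumArrowEquivProdArrow ι α (ZMod d)).symm.sum_comp, Fintype.sum_prod_type]
  refine Finset.sum_congr rfl fun x _ => ?_
  rw [Finset.sum_eq_single 0]
  · simp [inflate, Equiv.sumArrowEquivProdArrow]
  · intro r _ hr
    simp [inflate, Equiv.sumArrowEquivProdArrow, hr]
  · simp

/-- An operator on `ι ⊕ α` that simulates `U` simulates it on more ancillas, too. -/
lemma lift_inflate_right (f : α ↪ β) {C : Op d (ι ⊕ α)} {U : Op d ι}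
    (h : ∀ ψ, C *ᵥ inflate α ψ = inflate α (U *ᵥ ψ)) (ψ : (ι → ZMod d) → ℂ) :
    lift ((Function.Embedding.refl ι).sumMap f) C *ᵥ inflate β ψ = inflate β (U *ᵥ ψ) := by
  classical
  funext x
  rw [lift_mulVec]
  set e := (Function.Embedding.refl ι).sumMap f
  have hl : ∀ y : ι ⊕ α → ZMod d, Function.extend e y x ∘ Sum.inl = y ∘ Sum.inl := by
    intro y; funext i; exact e.injective.extend_apply y x (Sum.inl i)
  have hr : ∀ y : ι ⊕ α → ZMod d, ∀ i, Function.extend e y x (Sum.inr (f i)) = y (Sum.inr i) := by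
    intro y i; exact e.injective.extend_apply y x (Sum.inr i)
  have hn : ∀ y : ι ⊕ α → ZMod d, ∀ j, j ∉ Set.range f →
      Function.extend e y x (Sum.inr j) = x (Sum.inr j) := by
    intro y j hj
    refine Function.extend_apply' _ _ _ ?_
    rintro ⟨i | i, hi⟩
    · simp [e] at hi
    · exact hj ⟨i, by simpa [e] using hi⟩
  have key : ∀ y, inflate β ψ (Function.extend e y x) =
      if ∀ j, j ∉ Set.range f → x (Sum.inr j) = 0 then inflate α ψ y else 0 := by
    intro y
    simp only [inflate, hl, ← ite_and]
    congr 1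
    rw [eq_iff_iff]
    constructor
    · intro h0
      refine ⟨fun j hj => ?_, funext fun i => ?_⟩
      · rw [← hn y j hj]; exact congrFun h0 j
      · simpa [hr] using congrFun h0 (f i)
    · rintro ⟨h1, h2⟩
      funext j
      by_cases hj : j ∈ Set.range f
      · obtain ⟨i, rfl⟩ := hj
        simpa [hr] using congrFun h2 i
      · simpa [hn y j hj] using h1 j hj
  simp only [key]
  by_cases h0 : ∀ j, j ∉ Set.range f → x (Sum.inr j) = 0
  · simp only [if_pos h0]
    have := congrFun (h ψ) (x ∘ e)
    simp only [mulVec, dotProduct] at this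
    rw [this]
    simp only [inflate]
    have : (x ∘ e) ∘ Sum.inl = x ∘ Sum.inl := by funext i; simp [e]
    rw [this]
    refine if_congr ?_ rfl rfl
    constructor
    · intro h2
      funext j
      by_cases hj : j ∈ Set.range f
      · obtain ⟨i, rfl⟩ := hj
        simpa [e] using congrFun h2 i
      · exact h0 j hj
    · intro h2
      funext i
      simpa [e] using congrFun h2 (f i)
  · simp only [if_neg h0, mul_zero, Finset.sum_const_zero, inflate]
    rw [if_neg]
    intro h1
    exact h0 fun j _ => congrFun h1 j

/-- An operator that simulates `U` yields one that simulates `lift e U`. -/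
lemma lift_inflate_left (e : ι ↪ κ) {C : Op d (ι ⊕ α)} {U : Op d ι}
    (h : ∀ ψ, C *ᵥ inflate α ψ = inflate α (U *ᵥ ψ)) (ψ : (κ → ZMod d) → ℂ) :
    lift (e.sumMap (Function.Embedding.refl α)) C *ᵥ inflate α ψ =
      inflate α (lift e U *ᵥ ψ) := by
  classical
  funext x
  rw [lift_mulVec]
  set e' := e.sumMap (Function.Embedding.refl α)
  have key : ∀ y, inflate α ψ (Function.extend e' y x) =
      inflate α (fun y' => ψ (Function.extend e y' (x ∘ Sum.inl))) y := by
    intro y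
    have h1 : Function.extend e' y x ∘ Sum.inr = y ∘ Sum.inr := by
      funext i; exact e'.injective.extend_apply y x (Sum.inr i)
    have h2 : Function.extend e' y x ∘ Sum.inl =
        Function.extend e (y ∘ Sum.inl) (x ∘ Sum.inl) := by
      funext j
      by_cases hj : ∃ i, e i = j
      · obtain ⟨i, rfl⟩ := hj
        rw [e.injective.extend_apply]
        exact e'.injective.extend_apply y x (Sum.inl i)
      · rw [Function.extend_apply' _ _ _ hj]
        refine Function.extend_apply' _ _ _ ?_
        rintro ⟨i | i, hi⟩
        · exact hj ⟨i, by simpa [e'] using hi⟩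
        · simp [e'] at hi
    simp only [inflate, h1, h2]
  simp only [key]
  have := congrFun (h fun y' => ψ (Function.extend e y' (x ∘ Sum.inl))) (x ∘ e')
  simp only [mulVec, dotProduct] at this
  rw [this]
  simp only [inflate]
  have h1 : (x ∘ e') ∘ Sum.inr = x ∘ Sum.inr := by funext i; simp [e']
  have h2 : (x ∘ e') ∘ Sum.inl = (x ∘ Sum.inl) ∘ e := by funext i; simp [e']
  rw [h1, h2, lift_mulVec]
  rfl

end Inflate

end Operators

/-! ### Circuits over arbitrary wire labels, and implementation with clean ancillas. -/

/-- The two kinds of unbounded fan-in gates. -/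
inductive Fanin
  | mod
  | th

section Nets

variable {d : ℕ} [NeZero d] {ι κ α β : Type}
  [Fintype ι] [DecidableEq ι] [Fintype κ] [DecidableEq κ]
  [Fintype α] [DecidableEq α] [Fintype β] [DecidableEq β]

/-- The threshold function on an arbitrary set of wires. -/
def thr (k : ℕ) (S : Finset ι) (x : ι → ZMod d) : ZMod d :=
  if k ≤ ∑ j ∈ S, (x j).val then 1 else 0

/-- The operators of the allowed gates, with their supports. -/
inductive IsGate (K : Fanin) : Finset ι → Op d ι → Prop
  | single (t : ι) (U : Matrix.unitaryGroup (ZMod d) ℂ) :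
      IsGate K {t} (tgt t fun _ => (U : Matrix (ZMod d) (ZMod d) ℂ))
  | ctrl (c t : ι) (h : c ≠ t) (U : Matrix.unitaryGroup (ZMod d) ℂ) :
      IsGate K {c, t} (tgt t fun y => (U : Matrix (ZMod d) (ZMod d) ℂ) ^ (y c).val)
  | mod (hK : K = Fanin.mod) (t : ι) (S : Finset ι) (h : t ∉ S) :
      IsGate K (insert t S) (tgt t fun y => shift (∑ j ∈ S, y j))
  | th (hK : K = Fanin.th) (k : ℕ) (t : ι) (S : Finset ι) (h : t ∉ S) :
      IsGate K (insert t S) (tgt t fun y => shift (thr k S y))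

/-- `Net K S D g U`: a circuit with all its gates inside `S`, of depth `D` and with at most `g`
gates has the operator `U`. -/
inductive Net (K : Fanin) : Finset ι → ℕ → ℕ → Op d ι → Prop
  | gate {S : Finset ι} {U : Op d ι} : IsGate K S U → Net K S 1 1 U
  | nil (D : ℕ) : Net K ∅ D 0 1
  | seq {S : Finset ι} {D D' g g' : ℕ} {U V : Op d ι} :
      Net K S D g U → Net K S D' g' V → Net K S (D + D') (g + g') (V * U)
  | par {S T : Finset ι} {D g g' : ℕ} {U V : Op d ι} : Disjoint S T →
      Net K S D g U → Net K T D g' V → Net K (S ∪ T) D (g + g') (U * V)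
  | mono {S T : Finset ι} {D g g' : ℕ} {U : Op d ι} : S ⊆ T → g ≤ g' →
      Net K S D g U → Net K T D g' U

variable {K : Fanin}

lemma shift_zero : shift (0 : ZMod d) = 1 := by
  ext l m
  simp [shift, Matrix.one_apply]

lemma shift_mul (s t : ZMod d) : shift s * shift t = shift (s + t) := by
  ext l m
  simp only [shift, Matrix.mul_apply, ite_mul, one_mul, zero_mul]
  rw [Finset.sum_eq_single (m + t)]
  · simp [add_assoc, add_comm t s]
  · intro b _ hb
    simp [hb]
  · simp

lemma shift_conjTranspose (s : ZMod d) : (shift s)ᴴ = shift (-s) := by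
  ext l m
  simp only [shift, Matrix.conjTranspose_apply]
  by_cases h : m = l + s
  · rw [if_pos h, if_pos (by rw [h]; ring), star_one]
  · rw [if_neg h, if_neg (fun h' => h (by rw [h']; ring)), star_zero]

lemma shift_pow (s : ZMod d) (k : ℕ) : shift s ^ k = shift ((k : ZMod d) * s) := by
  induction k with
  | zero => simp [shift_zero]
  | succ k ih => rw [pow_succ, ih, shift_mul]; congr 1; push_cast; ring

lemma shift_unitary (s : ZMod d) : (shift s)ᴴ * shift s = 1 := by
  rw [shift_conjTranspose, shift_mul, neg_add_cancel, shift_zero]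

lemma indep_ctrl {c t : ι} (h : c ≠ t) (U : Matrix (ZMod d) (ZMod d) ℂ) :
    Indep t (fun y : ι → ZMod d => U ^ (y c).val) :=
  fun x y hxy => by simp only [hxy c h]

lemma indep_mod {t : ι} {S : Finset ι} (h : t ∉ S) :
    Indep t (fun y : ι → ZMod d => shift (∑ j ∈ S, y j)) := by
  intro x y hxy
  have : ∑ j ∈ S, x j = ∑ j ∈ S, y j :=
    Finset.sum_congr rfl fun j hj => hxy j fun hjt => h (hjt ▸ hj)
  simp only [this]

lemma indep_th {k : ℕ} {t : ι} {S : Finset ι} (h : t ∉ S) :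
    Indep t (fun y : ι → ZMod d => shift (thr k S y)) := by
  intro x y hxy
  have : ∑ j ∈ S, (x j).val = ∑ j ∈ S, (y j).val :=
    Finset.sum_congr rfl fun j hj => by rw [hxy j fun hjt => h (hjt ▸ hj)]
  simp only [thr, this]

lemma unitaryGroup_mul (U : Matrix.unitaryGroup (ZMod d) ℂ) :
    (U : Matrix (ZMod d) (ZMod d) ℂ)ᴴ * U = 1 := Matrix.mem_unitaryGroup_iff'.mp U.2

lemma pow_unitary {U : Matrix (ZMod d) (ZMod d) ℂ} (h : Uᴴ * U = 1) (k : ℕ) :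
    (U ^ k)ᴴ * U ^ k = 1 := by
  have : U ∈ Matrix.unitaryGroup (ZMod d) ℂ := Matrix.mem_unitaryGroup_iff'.mpr h
  exact Matrix.mem_unitaryGroup_iff'.mp (pow_mem this k)

lemma IsGate.unitary {S : Finset ι} {U : Op d ι} (h : IsGate K S U) : Uᴴ * U = 1 := by
  cases h with
  | single t U => exact tgt_unitary (indep_const _ _) fun _ => unitaryGroup_mul U
  | ctrl c t h U =>
    exact tgt_unitary (indep_ctrl h _) fun _ => pow_unitary (unitaryGroup_mul U) _
  | mod hK t S h => exact tgt_unitary (indep_mod h) fun _ => shift_unitary _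
  | th hK k t S h => exact tgt_unitary (indep_th h) fun _ => shift_unitary _

lemma unitary_mul {U V : Op d ι} (hU : Uᴴ * U = 1) (hV : Vᴴ * V = 1) :
    (U * V)ᴴ * (U * V) = 1 := by
  rw [conjTranspose_mul, Matrix.mul_assoc, ← Matrix.mul_assoc Uᴴ, hU, Matrix.one_mul, hV]

lemma Net.unitary {S : Finset ι} {D g : ℕ} {U : Op d ι} (h : Net K S D g U) : Uᴴ * U = 1 := by
  induction h with
  | gate h => exact h.unitary
  | nil D => simp
  | seq _ _ h1 h2 => exact unitary_mul h2 h1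
  | par _ _ _ h1 h2 => exact unitary_mul h1 h2
  | mono _ _ _ h => exact h

/-- Padding by empty layers; parallel composition demands equal depths. -/
lemma Net.weaken_depth {S : Finset ι} {D g : ℕ} {U : Op d ι} (h : Net K S D g U)
    {D' : ℕ} (hD : D ≤ D') : Net K S D' g U := by
  obtain ⟨k, rfl⟩ := Nat.exists_eq_add_of_le hD
  simpa using h.seq ((Net.nil k).mono (Finset.empty_subset S) le_rfl)

lemma Net.pow {S : Finset ι} {D g : ℕ} {U : Op d ι} (h : Net K S D g U) (k : ℕ) :
    Net K S (k * D) (k * g) (U ^ k) := by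
  induction k with
  | zero => simpa using (Net.nil 0).mono (Finset.empty_subset S) (Nat.zero_le _)
  | succ k ih =>
    rw [pow_succ', Nat.succ_mul, Nat.succ_mul]
    exact ih.seq h

/-- Every gate is a `lift` of an operator on its own support, so `lift_commute` settles single
gates; commutation then passes through products. -/
lemma Net.commute {S T : Finset ι} {D D' g g' : ℕ} {U V : Op d ι} (hST : Disjoint S T)
    (hU : Net K S D g U) (hV : Net K T D' g' V) : Commute U V := by
  have gate_lift : ∀ {S : Finset ι} {U : Op d ι}, IsGate K S U →
      ∃ U' : Op d S, U = lift (Function.Embedding.subtype (· ∈ S)) U' := by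
    intro S U h
    have aux : ∀ (t : ι) (ht : t ∈ S) (W : (ι → ZMod d) → Matrix (ZMod d) (ZMod d) ℂ),
        (∀ x y, (∀ j ∈ S, x j = y j) → W x = W y) →
        ∃ U' : Op d S, tgt t W = lift (Function.Embedding.subtype (· ∈ S)) U' := by
      intro t ht W hW
      -- The value 0 outside `S` is harmless because `W` only reads wires of `S`.
      refine ⟨tgt ⟨t, ht⟩ fun y => W fun j => if hj : j ∈ S then y ⟨j, hj⟩ else 0, ?_⟩
      rw [lift_tgt]
      congr 1
      funext y
      refine hW _ _ fun j hj => ?_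
      simp [hj]
    cases h with
    | single t U => exact aux t (by simp) _ fun _ _ _ => rfl
    | ctrl c t h U => exact aux t (by simp) _ fun x y hxy => by rw [hxy c (by simp)]
    | mod hK t S h =>
      refine aux t (by simp) _ fun x y hxy => ?_
      rw [Finset.sum_congr rfl fun j hj => hxy j (Finset.mem_insert_of_mem hj)]
    | th hK k t S h =>
      refine aux t (by simp) _ fun x y hxy => ?_
      rw [thr, Finset.sum_congr rfl fun j hj => by rw [hxy j (Finset.mem_insert_of_mem hj)], thr]
  induction hU with
  | gate hU =>
    induction hV with
    | gate hV =>
      obtain ⟨U', rfl⟩ := gate_lift hU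
      obtain ⟨V', rfl⟩ := gate_lift hV
      refine lift_commute ?_ _ _
      rw [Set.disjoint_left]
      rintro _ ⟨i, rfl⟩ ⟨j, hj⟩
      refine Finset.disjoint_left.mp hST i.2 ?_
      have : (j : ι) = i := hj
      rw [← this]; exact j.2
    | nil D => exact Commute.one_right _
    | seq _ _ h1 h2 => exact (h2 hST).mul_right (h1 hST)
    | par _ _ _ h1 h2 =>
      rw [Finset.disjoint_union_right] at hST
      exact (h1 hST.1).mul_right (h2 hST.2)
    | mono hs _ _ h => exact h (Finset.disjoint_of_subset_right hs hST)
  | nil D => exact Commute.one_left _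
  | seq _ _ h1 h2 => exact (h2 hST).mul_left (h1 hST)
  | par _ _ _ h1 h2 =>
    rw [Finset.disjoint_union_left] at hST
    exact (h1 hST.1).mul_left (h2 hST.2)
  | mono hs _ _ h => exact h (Finset.disjoint_of_subset_left hs hST)

/-- The base gates are closed under inverses. The fan-in gates add an element of `ZMod d`, so they
have order dividing `d` and their inverse is the power `d - 1`; this costs the factor `d`. -/
lemma IsGate.conjTranspose {S : Finset ι} {U : Op d ι} (h : IsGate K S U) :
    Net K S d d Uᴴ := by
  have hd : 1 ≤ d := NeZero.one_le
  have aux : ∀ V : Op d ι, IsGate K S V → Net K S d d V := fun V hV =>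
    ((Net.gate hV).weaken_depth hd).mono le_rfl hd
  have hpow : ∀ s : ZMod d, shift s ^ (d - 1) = (shift s)ᴴ := by
    intro s
    rw [shift_pow, shift_conjTranspose, Nat.cast_sub hd]
    simp
  have aux' : ∀ V : Op d ι, IsGate K S V → V ^ (d - 1) = Vᴴ → Net K S d d Vᴴ := by
    intro V hV h
    have := (Net.gate hV).pow (d - 1)
    rw [h, mul_one] at this
    exact (this.weaken_depth (Nat.sub_le _ _)).mono le_rfl (Nat.sub_le _ _)
  cases h with
  | single t U =>
    rw [tgt_conjTranspose (indep_const _ _)]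
    exact aux _ (IsGate.single t (star U))
  | ctrl c t h U =>
    rw [tgt_conjTranspose (indep_ctrl h _)]
    simp only [conjTranspose_pow]
    exact aux _ (IsGate.ctrl c t h (star U))
  | mod hK t S h =>
    refine aux' _ (IsGate.mod hK t S h) ?_
    rw [tgt_pow (indep_mod h), tgt_conjTranspose (indep_mod h)]
    simp only [hpow]
  | th hK k t S h =>
    refine aux' _ (IsGate.th hK k t S h) ?_
    rw [tgt_pow (indep_th h), tgt_conjTranspose (indep_th h)]
    simp only [hpow]

lemma Net.conjTranspose {S : Finset ι} {D g : ℕ} {U : Op d ι} (h : Net K S D g U) :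
    Net K S (d * D) (d * g) Uᴴ := by
  induction h with
  | gate h => simpa using h.conjTranspose
  | nil D => simpa using Net.nil (d * D)
  | seq _ _ h1 h2 =>
    rw [conjTranspose_mul]
    convert h2.seq h1 using 1 <;> ring
  | par hST hU hV h1 h2 =>
    -- The factors are swapped first so that the adjoint reverses them back into the order required
    -- by `par`.
    rw [(Net.commute hST hU hV).eq, conjTranspose_mul, Nat.mul_add]
    exact h1.par hST h2
  | mono hs hg _ h => exact h.mono hs (Nat.mul_le_mul_left _ hg)

lemma IsGate.lift (e : ι ↪ κ) {S : Finset ι} {U : Op d ι} (h : IsGate K S U) :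
    IsGate K (S.map e) (lift e U) := by
  cases h with
  | single t U =>
    rw [lift_tgt, Finset.map_singleton]
    exact IsGate.single (e t) U
  | ctrl c t h U =>
    rw [lift_tgt, Finset.map_insert, Finset.map_singleton]
    exact IsGate.ctrl (e c) (e t) (fun h' => h (e.injective h')) U
  | mod hK t S h =>
    rw [lift_tgt, Finset.map_insert]
    have := IsGate.mod (d := d) hK (e t) (S.map e) (by simpa using h)
    simpa only [Finset.sum_map, Function.comp_apply] using this
  | th hK k t S h =>
    rw [lift_tgt, Finset.map_insert]
    have := IsGate.th (d := d) hK k (e t) (S.map e) (by simpa using h)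
    simpa only [thr, Finset.sum_map, Function.comp_apply] using this

lemma Net.lift (e : ι ↪ κ) {S : Finset ι} {D g : ℕ} {U : Op d ι} (h : Net K S D g U) :
    Net K (S.map e) D g (lift e U) := by
  induction h with
  | gate h => exact Net.gate (h.lift e)
  | nil D => rw [lift_one, Finset.map_empty]; exact Net.nil D
  | seq _ _ h1 h2 => rw [lift_mul]; exact h1.seq h2
  | par hST _ _ h1 h2 =>
    rw [lift_mul, Finset.map_union]
    exact h1.par (by simpa using hST) h2
  | mono hs hg _ h => exact h.mono (Finset.map_subset_map.mpr hs) hg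

/-- `U` is implemented on the wires `S`, with clean ancillas, in depth `D` and with at most `s`
ancillas and at most `s` gates. -/
def ImplOn (K : Fanin) (S : Finset ι) (D s : ℕ) (U : Op d ι) : Prop :=
  ∃ (α : Type) (_ : Fintype α) (_ : DecidableEq α) (C : Op d (ι ⊕ α)),
    Net K (S.disjSum Finset.univ) D s C ∧ Fintype.card α ≤ s ∧
      ∀ ψ, C *ᵥ inflate α ψ = inflate α (U *ᵥ ψ)

namespace ImplOn

lemma of_net {S : Finset ι} {D g : ℕ} {U : Op d ι} (h : Net K S D g U) : ImplOn K S D g U := by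
  refine ⟨PEmpty, inferInstance, inferInstance, Qudit.lift ⟨Sum.inl, Sum.inl_injective⟩ U,
    (h.lift _).mono ?_ le_rfl, by simp, fun ψ => ?_⟩
  · intro x hx
    simp only [Finset.mem_map] at hx
    obtain ⟨i, hi, rfl⟩ := hx
    exact Finset.inl_mem_disjSum.mpr hi
  · funext x
    rw [lift_mulVec]
    simp only [inflate, eq_iff_true_of_subsingleton, if_true, mulVec, dotProduct]
    refine Finset.sum_congr rfl fun y _ => ?_
    congr 2
    exact Function.extend_comp Sum.inl_injective _ _

lemma mono {S T : Finset ι} {D D' s s' : ℕ} {U : Op d ι} (h : ImplOn K S D s U)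
    (hS : S ⊆ T) (hD : D ≤ D') (hs : s ≤ s') : ImplOn K T D' s' U := by
  obtain ⟨α, i1, i2, C, hC, hc, hψ⟩ := h
  exact ⟨α, i1, i2, C, (hC.weaken_depth hD).mono (Finset.disjSum_mono hS le_rfl) hs,
    hc.trans hs, hψ⟩

lemma one (S : Finset ι) (D : ℕ) : ImplOn K S D 0 (1 : Op d ι) :=
  (of_net (Net.nil D)).mono (Finset.empty_subset _) le_rfl le_rfl

lemma gate {S : Finset ι} {U : Op d ι} (h : IsGate K S U) : ImplOn K S 1 1 U :=
  of_net (Net.gate h)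

/-- Each factor gets its own ancillas; those of the other factor are untouched and remain zero. -/
lemma mul {S : Finset ι} {D D' s s' : ℕ} {U V : Op d ι} (h : ImplOn K S D s U)
    (h' : ImplOn K S D' s' V) : ImplOn K S (D + D') (s + s') (V * U) := by
  obtain ⟨α, _, _, A, hA, ha, hψ⟩ := h
  obtain ⟨β, _, _, B, hB, hb, hφ⟩ := h'
  refine ⟨α ⊕ β, inferInstance, inferInstance, _,
    ((hA.lift ((Function.Embedding.refl ι).sumMap Function.Embedding.inl)).mono
      (T := S.disjSum Finset.univ) ?_ le_rfl).seq
    ((hB.lift ((Function.Embedding.refl ι).sumMap Function.Embedding.inr)).mono ?_ le_rfl),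
    by simpa using add_le_add ha hb, fun ψ => ?_⟩
  · intro x hx
    simp only [Finset.mem_map] at hx
    obtain ⟨i | i, hi, rfl⟩ := hx
    · simpa using hi
    · simp
  · intro x hx
    simp only [Finset.mem_map] at hx
    obtain ⟨i | i, hi, rfl⟩ := hx
    · simpa using hi
    · simp
  · rw [← mulVec_mulVec, lift_inflate_right _ hψ, lift_inflate_right _ hφ, mulVec_mulVec]

lemma par {S T : Finset ι} {D s s' : ℕ} {U V : Op d ι} (hST : Disjoint S T)
    (h : ImplOn K S D s U) (h' : ImplOn K T D s' V) :
    ImplOn K (S ∪ T) D (s + s') (U * V) := by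
  obtain ⟨α, _, _, A, hA, ha, hψ⟩ := h
  obtain ⟨β, _, _, B, hB, hb, hφ⟩ := h'
  refine ⟨α ⊕ β, inferInstance, inferInstance, _,
    (Net.par ?_ (hA.lift ((Function.Embedding.refl ι).sumMap Function.Embedding.inl))
    (hB.lift ((Function.Embedding.refl ι).sumMap Function.Embedding.inr))).mono ?_ le_rfl,
    by simpa using add_le_add ha hb, fun ψ => ?_⟩
  · rw [Finset.disjoint_left]
    intro x hx hy
    simp only [Finset.mem_map] at hx hy
    obtain ⟨i | i, hi, rfl⟩ := hx <;> obtain ⟨j | j, hj, hij⟩ := hy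
    · simp at hi hj hij
      subst hij
      exact Finset.disjoint_left.mp hST hi hj
    · simp at hij
    · simp at hij
    · simp at hij
  · intro x hx
    simp only [Finset.mem_union, Finset.mem_map] at hx
    rcases hx with ⟨i | i, hi, rfl⟩ | ⟨i | i, hi, rfl⟩
    · simp at hi; simp [hi]
    · simp
    · simp at hi; simp [hi]
    · simp
  · rw [← mulVec_mulVec, lift_inflate_right _ hφ, lift_inflate_right _ hψ, mulVec_mulVec]

/-- The circuit is unitary and `inflate` preserves inner products, so `U` preserves them as well. -/
lemma unitary {S : Finset ι} {D s : ℕ} {U : Op d ι} (h : ImplOn K S D s U) : Uᴴ * U = 1 := by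
  obtain ⟨α, _, _, A, hA, ha, hψ⟩ := h
  have key : ∀ ψ φ : (ι → ZMod d) → ℂ, star (U *ᵥ ψ) ⬝ᵥ (U *ᵥ φ) = star ψ ⬝ᵥ φ := by
    intro ψ φ
    rw [← dotProduct_inflate (α := α), ← hψ, ← hψ, star_mulVec, ← dotProduct_mulVec,
      mulVec_mulVec, hA.unitary, one_mulVec, dotProduct_inflate]
  ext x y
  have := key (Pi.single x 1) (Pi.single y 1)
  rw [star_mulVec, ← dotProduct_mulVec, mulVec_mulVec] at this
  have hs : star (Pi.single x 1 : (ι → ZMod d) → ℂ) = Pi.single x 1 := by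
    funext z
    by_cases hz : z = x
    · subst hz; simp
    · simp [hz]
  rw [hs, single_one_dotProduct, single_one_dotProduct] at this
  rw [mulVec_single_one] at this
  rw [Matrix.one_apply, ← Pi.single_apply]
  simpa [Matrix.col_apply, Pi.single_apply, eq_comm] using this

/-- A circuit returning its ancillas to zero does so in reverse too: `U` is onto, so every clean
state is the image of a clean state. -/
lemma conjTranspose {S : Finset ι} {D s : ℕ} {U : Op d ι} (h : ImplOn K S D s U) :
    ImplOn K S (d * D) (d * s) Uᴴ := by
  have hU := h.unitary
  obtain ⟨α, _, _, A, hA, ha, hψ⟩ := h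
  refine ⟨α, inferInstance, inferInstance, Aᴴ, hA.conjTranspose,
    ha.trans (Nat.le_mul_of_pos_left _ (NeZero.pos d)), fun ψ => ?_⟩
  have : inflate α ψ = A *ᵥ inflate α (Uᴴ *ᵥ ψ) := by
    rw [hψ, mulVec_mulVec, mul_eq_one_comm.mp hU, one_mulVec]
  rw [this, mulVec_mulVec, hA.unitary, one_mulVec]

lemma lift (e : ι ↪ κ) {S : Finset ι} {D s : ℕ} {U : Op d ι} (h : ImplOn K S D s U) :
    ImplOn K (S.map e) D s (lift e U) := by
  obtain ⟨α, _, _, A, hA, ha, hψ⟩ := h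
  refine ⟨α, inferInstance, inferInstance, _,
    (hA.lift (e.sumMap (Function.Embedding.refl α))).mono ?_ le_rfl, ha,
    lift_inflate_left e hψ⟩
  intro x hx
  simp only [Finset.mem_map] at hx
  obtain ⟨i | i, hi, rfl⟩ := hx
  · simpa using hi
  · simp

/-- Demotes the wires `β` to ancillas. By linearity, clean behaviour need only be checked on basis
states. -/
lemma ancilla {D s : ℕ} {U : Op d ι} {W : Op d (ι ⊕ β)}
    (h : ImplOn K Finset.univ D s W)
    (hW : ∀ x : ι → ZMod d, W *ᵥ Pi.single (Sum.elim x (0 : β → ZMod d)) 1 =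
      inflate β (U *ᵥ Pi.single x 1)) :
    ImplOn K Finset.univ D (Fintype.card β + s) U := by
  have hW' : ∀ ψ, W *ᵥ inflate β ψ = inflate β (U *ᵥ ψ) := by
    let L : ((ι → ZMod d) → ℂ) →ₗ[ℂ] ((ι ⊕ β → ZMod d) → ℂ) :=
      { toFun := inflate β
        map_add' := inflate_add
        map_smul' := by
          intro c ψ; funext z; simp only [inflate, Pi.smul_apply]; split_ifs <;> simp }
    have : (Matrix.toLin' W).comp L = L.comp (Matrix.toLin' U) := by
      refine LinearMap.pi_ext' fun x => LinearMap.ext_ring ?_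
      simp only [LinearMap.comp_apply, LinearMap.single_apply, Matrix.toLin'_apply]
      change W *ᵥ inflate β (Pi.single x 1) = inflate β (U *ᵥ Pi.single x 1)
      rw [inflate_single, hW]
    intro ψ
    exact LinearMap.congr_fun this ψ
  obtain ⟨α, _, _, A, hA, ha, hψ⟩ := h
  refine ⟨β ⊕ α, inferInstance, inferInstance, _,
    ((hA.lift (Equiv.sumAssoc ι β α).toEmbedding).mono ?_ (Nat.le_add_left _ _)),
    by simpa using ha, fun ψ => ?_⟩
  · intro x _
    obtain x | x := x <;> simp
  · have hinf : ∀ (φ : (ι → ZMod d) → ℂ) (x : ι ⊕ (β ⊕ α) → ZMod d),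
        inflate (β ⊕ α) φ x = inflate α (inflate β φ) (x ∘ Equiv.sumAssoc ι β α) := by
      intro φ x
      simp only [inflate, ← ite_and]
      refine if_congr ?_ rfl rfl
      constructor
      · intro h
        exact ⟨funext fun i => congrFun h (Sum.inr i), funext fun i => congrFun h (Sum.inl i)⟩
      · rintro ⟨h1, h2⟩
        funext i
        cases i with
        | inl i => exact congrFun h2 i
        | inr i => exact congrFun h1 i
    funext x
    rw [hinf, ← hW', ← hψ, lift_mulVec]
    simp only [mulVec, dotProduct]
    refine Finset.sum_congr rfl fun y _ => ?_
    rw [hinf]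
    congr 2
    exact Function.extend_comp (Equiv.sumAssoc ι β α).injective _ _

end ImplOn

end Nets

/-! ### Passage between abstract circuits and layered circuits. -/

/-- The gate set with the given kind of unbounded fan-in gates. -/
def gateSet (d : ℕ) [NeZero d] : Fanin → GateSet d
  | Fanin.mod => modGates d
  | Fanin.th => thresholdGates d

section Realization

variable {d : ℕ} [NeZero d] {N : ℕ} {K : Fanin}

lemma tgt_eq_onTarget (t : Fin N) (W : (Fin N → ZMod d) → Matrix (ZMod d) (ZMod d) ℂ) :
    tgt t W = onTarget t W := by
  ext x y
  simp only [tgt, onTarget]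
  congr

lemma IsGate.exists_gate {S : Finset (Fin N)} {U : Op d (Fin N)} (h : IsGate K S U) :
    ∃ G : Gate d N, G ∈ gateSet d K N ∧ G.support = S ∧ G.op = U := by
  have hbase : ∀ G ∈ baseGates d N, G ∈ gateSet d K N := by
    intro G hG
    cases K
    · exact Or.inl hG
    · exact Or.inl hG
  cases h with
  | single t U =>
    exact ⟨Gate.single t U, hbase _ (Or.inl ⟨t, U, rfl⟩), rfl, (tgt_eq_onTarget _ _).symm⟩
  | ctrl c t h U =>
    exact ⟨Gate.controlled c t h U, hbase _ (Or.inr ⟨c, t, h, U, rfl⟩), rfl,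
      (tgt_eq_onTarget _ _).symm⟩
  | mod hK t S h =>
    subst hK
    exact ⟨Gate.qMOD t S h, Or.inr ⟨t, S, h, rfl⟩, rfl, (tgt_eq_onTarget _ _).symm⟩
  | th hK k t S h =>
    subst hK
    exact ⟨Gate.qTH k t S h, Or.inr ⟨k, t, S, h, rfl⟩, rfl, (tgt_eq_onTarget _ _).symm⟩

lemma isGate_base {G : Gate d N} (hG : G ∈ baseGates d N) : IsGate K G.support G.op := by
  rcases hG with ⟨t, U, rfl⟩ | ⟨c, t, h, U, rfl⟩
  · rw [Gate.op, ← tgt_eq_onTarget]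
    exact IsGate.single t U
  · rw [Gate.op, ← tgt_eq_onTarget]
    exact IsGate.ctrl c t h U

lemma Layer.commute_of_disjoint {L L' : Layer d N} (h : ∀ G ∈ L.gates, ∀ G' ∈ L'.gates,
    Commute G.op G'.op) : Commute L.op L'.op := by
  refine Commute.list_prod_left _ _ fun U hU => Commute.list_prod_right _ _ fun V hV => ?_
  obtain ⟨G, hG, rfl⟩ := List.mem_map.mp hU
  obtain ⟨G', hG', rfl⟩ := List.mem_map.mp hV
  exact h G hG G' hG'

/-- The operator of a list of layers, the head of the list being applied first. -/
noncomputable def layersOp (Ls : List (Layer d N)) : Op d (Fin N) :=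
  (Ls.map Layer.op).reverse.prod

lemma layersOp_append (Ls Ls' : List (Layer d N)) :
    layersOp (Ls ++ Ls') = layersOp Ls' * layersOp Ls := by
  simp [layersOp]

lemma layersOp_cons (L : Layer d N) (Ls : List (Layer d N)) :
    layersOp (L :: Ls) = layersOp Ls * L.op := by
  simp [layersOp]

lemma layersOp_nil : layersOp ([] : List (Layer d N)) = 1 := by
  simp [layersOp]

/-- Ls consists of allowed gates supported in `S`. -/
def LayersIn (K : Fanin) (S : Finset (Fin N)) (Ls : List (Layer d N)) : Prop :=
  ∀ L ∈ Ls, ∀ G ∈ L.gates, G ∈ gateSet d K N ∧ G.support ⊆ S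

/-- Two lists of layers are zipped, gates of corresponding layers being placed side by side;
disjointness keeps the layers legal. -/
lemma exists_merge (K : Fanin) {S T : Finset (Fin N)} (hST : Disjoint S T)
    (comm : ∀ G G' : Gate d N, G ∈ gateSet d K N → G' ∈ gateSet d K N → G.support ⊆ S →
      G'.support ⊆ T → Commute G.op G'.op) :
    ∀ Ls Ls' : List (Layer d N), Ls.length = Ls'.length → LayersIn K S Ls → LayersIn K T Ls' →
      ∃ Ms : List (Layer d N), Ms.length = Ls.length ∧ LayersIn K (S ∪ T) Ms ∧
        (Ms.map fun L => L.gates.length).sum =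
          (Ls.map fun L => L.gates.length).sum + (Ls'.map fun L => L.gates.length).sum ∧
        layersOp Ms = layersOp Ls * layersOp Ls' := by
  intro Ls
  induction Ls with
  | nil =>
    intro Ls' hl _ _
    have : Ls' = [] := by simpa using hl.symm
    subst this
    exact ⟨[], rfl, by simp [LayersIn], by simp, by simp [layersOp_nil]⟩
  | cons L Ls ih =>
    intro Ls' hl h h'
    cases Ls' with
    | nil => simp at hl
    | cons L' Ls' =>
      obtain ⟨Ms, h1, h2, h3, h4⟩ := ih Ls' (by simpa using hl)
        (fun M hM => h M (List.mem_cons_of_mem _ hM))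
        (fun M hM => h' M (List.mem_cons_of_mem _ hM))
      have hL := h L (by simp)
      have hL' := h' L' (by simp)
      refine ⟨⟨L.gates ++ L'.gates, ?_⟩ :: Ms, by simpa using h1, ?_, ?_, ?_⟩
      · rw [List.pairwise_append]
        refine ⟨L.disjoint, L'.disjoint, fun G hG G' hG' => ?_⟩
        exact Finset.disjoint_of_subset_left (hL G hG).2
          (Finset.disjoint_of_subset_right (hL' G' hG').2 hST)
      · intro M hM G hG
        rcases List.mem_cons.mp hM with rfl | hM
        · rcases List.mem_append.mp hG with hG | hG
          · exact ⟨(hL G hG).1, (hL G hG).2.trans Finset.subset_union_left⟩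
          · exact ⟨(hL' G hG).1, (hL' G hG).2.trans Finset.subset_union_right⟩
        · exact h2 M hM G hG
      · simp only [List.map_cons, List.sum_cons, h3, List.length_append]
        ring
      · have hop : (Layer.op ⟨L.gates ++ L'.gates, by
            rw [List.pairwise_append]
            refine ⟨L.disjoint, L'.disjoint, fun G hG G' hG' => ?_⟩
            exact Finset.disjoint_of_subset_left (hL G hG).2
              (Finset.disjoint_of_subset_right (hL' G' hG').2 hST)⟩ : Op d (Fin N)) =
            L.op * L'.op := by
          simp [Layer.op]
        -- The first layer on `S` has to move past all later layers on `T`.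
        have hc : Commute L.op (layersOp Ls') := by
          refine Commute.list_prod_right _ _ fun V hV => ?_
          rw [List.mem_reverse, List.mem_map] at hV
          obtain ⟨M, hM, rfl⟩ := hV
          refine Layer.commute_of_disjoint fun G hG G' hG' => ?_
          have hG2 := h' M (List.mem_cons_of_mem _ hM) G' hG'
          exact comm G G' (hL G hG).1 hG2.1 (hL G hG).2 hG2.2
        rw [layersOp_cons, layersOp_cons, layersOp_cons, hop, h4]
        rw [Matrix.mul_assoc, Matrix.mul_assoc, ← Matrix.mul_assoc (layersOp Ls') L.op,
          ← hc.eq, Matrix.mul_assoc]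

lemma Net.exists_layers {S : Finset (Fin N)} {D g : ℕ} {U : Op d (Fin N)}
    (h : Net K S D g U) : ∃ Ls : List (Layer d N), Ls.length = D ∧ LayersIn K S Ls ∧
      (Ls.map fun L => L.gates.length).sum ≤ g ∧ layersOp Ls = U := by
  induction h with
  | gate h =>
    obtain ⟨G, h1, h2, h3⟩ := h.exists_gate
    exact ⟨[⟨[G], by simp⟩], rfl, by simp [LayersIn, h1, h2], by simp,
      by simp [layersOp, Layer.op, h3]⟩
  | nil D =>
    refine ⟨List.replicate D ⟨[], List.Pairwise.nil⟩, by simp, ?_, by simp, ?_⟩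
    · intro L hL
      rw [List.eq_of_mem_replicate hL]
      simp
    · simp [layersOp, Layer.op]
  | seq _ _ h1 h2 =>
    obtain ⟨Ls, a1, a2, a3, a4⟩ := h1
    obtain ⟨Ms, b1, b2, b3, b4⟩ := h2
    refine ⟨Ls ++ Ms, by simp [a1, b1], ?_, by simpa using add_le_add a3 b3,
      by rw [layersOp_append, a4, b4]⟩
    intro L hL
    rcases List.mem_append.mp hL with hL | hL
    · exact a2 L hL
    · exact b2 L hL
  | @par S T D g g' U V hST _ _ h1 h2 =>
    obtain ⟨Ls, a1, a2, a3, a4⟩ := h1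
    obtain ⟨Ms, b1, b2, b3, b4⟩ := h2
    have comm : ∀ G G' : Gate d N, G ∈ gateSet d K N → G' ∈ gateSet d K N → G.support ⊆ S →
        G'.support ⊆ T → Commute G.op G'.op := by
      intro G G' hG hG' hs hs'
      have aux : ∀ G ∈ gateSet d K N, IsGate K G.support G.op := by
        intro G hG
        cases K
        · rcases hG with hG | ⟨t, S, h, rfl⟩
          · exact isGate_base hG
          · rw [Gate.op, ← tgt_eq_onTarget]; exact IsGate.mod rfl t S h
        · rcases hG with hG | ⟨k, t, S, h, rfl⟩
          · exact isGate_base hG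
          · rw [Gate.op, ← tgt_eq_onTarget]; exact IsGate.th rfl k t S h
      exact Net.commute (Finset.disjoint_of_subset_left hs (Finset.disjoint_of_subset_right hs' hST))
        (Net.gate (aux G hG)) (Net.gate (aux G' hG'))
    obtain ⟨Ns, c1, c2, c3, c4⟩ := exists_merge K hST comm Ls Ms (a1.trans b1.symm) a2 b2
    exact ⟨Ns, c1.trans a1, c2, c3.le.trans (add_le_add a3 b3), by rw [c4, a4, b4]⟩
  | mono hs hg _ h =>
    obtain ⟨Ls, a1, a2, a3, a4⟩ := h
    exact ⟨Ls, a1, fun L hL G hG => ⟨(a2 L hL G hG).1, (a2 L hL G hG).2.trans hs⟩,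
      a3.trans hg, a4⟩

lemma ImplOn.implementableIn {w D s : ℕ} {U : Op d (Fin w)}
    (h : ImplOn K Finset.univ D s U) : ImplementableIn (gateSet d K) U D (w + s) := by
  obtain ⟨α, _, _, C, hC, hα, hψ⟩ := h
  let e : Fin w ⊕ α ≃ Fin (w + Fintype.card α) :=
    ((Equiv.refl _).sumCongr (Fintype.equivFin α)).trans finSumFinEquiv
  obtain ⟨Ls, h1, h2, h3, h4⟩ := (hC.lift e.toEmbedding).exists_layers
  refine ⟨Fintype.card α, ⟨Ls⟩, fun L hL G hG => (h2 L hL G hG).1, ?_, h1.le,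
    Nat.add_le_add_left hα _, h3.trans (Nat.le_add_left _ _)⟩
  intro x y r
  have : Circuit.op (⟨Ls⟩ : Circuit d (w + Fintype.card α)) = Qudit.lift e.toEmbedding C := h4
  rw [this, lift_equiv_apply]
  have hx : ∀ (x : Fin w → ZMod d) (r : Fin (Fintype.card α) → ZMod d),
      Fin.append x r ∘ e = Sum.elim x (r ∘ Fintype.equivFin α) := by
    intro x r
    funext j
    cases j with
    | inl j => simp [e]
    | inr j => simp [e]
  rw [hx, hx]
  have h5 := congrFun (hψ (Pi.single y 1)) (Sum.elim x (r ∘ Fintype.equivFin α))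
  rw [inflate_single, mulVec_single_one, Matrix.col_apply] at h5
  have h0 : (0 : Fin (Fintype.card α) → ZMod d) ∘ Fintype.equivFin α = 0 := rfl
  rw [h0, h5]
  simp only [inflate, Sum.elim_comp_inr, Sum.elim_comp_inl, mulVec_single_one, Matrix.col_apply]
  refine if_congr ?_ rfl rfl
  constructor
  · intro h
    funext i
    simpa using congrFun h ((Fintype.equivFin α).symm i)
  · rintro rfl; rfl

/-- Gate-by-gate substitution. Gates of one layer have disjoint supports, so their replacements run
in parallel and depth is multiplied by `D'`; the size counts the old ancillas and at most `s'` for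
each of the at most `s` gates. -/
lemma ImplementableIn.implOn {𝒢 : GateSet d} {w D s : ℕ} {U : Op d (Fin w)}
    (h : ImplementableIn 𝒢 U D s) {D' s' : ℕ}
    (hG : ∀ N ≤ s, ∀ G ∈ 𝒢 N, ImplOn K G.support D' s' (Gate.op G)) :
    ImplOn K Finset.univ (D * D') (s + s * s') U := by
  obtain ⟨a, C, h1, h2, h3, h4, h5⟩ := h
  have layer : ∀ Gs : List (Gate d (w + a)), (∀ G ∈ Gs, G ∈ 𝒢 (w + a)) →
      Gs.Pairwise (fun g h => Disjoint g.support h.support) →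
      ∃ S : Finset (Fin (w + a)), (∀ j ∈ S, ∃ G ∈ Gs, j ∈ G.support) ∧
        ImplOn K S D' (Gs.length * s') (Gs.map Gate.op).prod := by
    intro Gs
    induction Gs with
    | nil => intro _ _; exact ⟨∅, by simp, by simpa using ImplOn.one ∅ D'⟩
    | cons G Gs ih =>
      intro hG' hd
      rw [List.pairwise_cons] at hd
      obtain ⟨S, hS, hI⟩ := ih (fun G hG => hG' G (List.mem_cons_of_mem _ hG)) hd.2
      refine ⟨G.support ∪ S, ?_, ?_⟩
      · intro j hj
        rcases Finset.mem_union.mp hj with hj | hj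
        · exact ⟨G, by simp, hj⟩
        · obtain ⟨G', hG1, hG2⟩ := hS j hj
          exact ⟨G', List.mem_cons_of_mem _ hG1, hG2⟩
      · have := (hG _ h4 G (hG' G (by simp))).par (T := S) (V := (Gs.map Gate.op).prod) ?_ hI
        · rw [List.map_cons, List.prod_cons, List.length_cons]
          convert this using 1
          ring
        · rw [Finset.disjoint_left]
          intro j hj hj'
          obtain ⟨G', hG1, hG2⟩ := hS j hj'
          exact Finset.disjoint_left.mp (hd.1 G' hG1) hj hG2
  have all : ∀ Ls : List (Layer d (w + a)), (∀ L ∈ Ls, ∀ G ∈ L.gates, G ∈ 𝒢 (w + a)) →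
      ImplOn K Finset.univ (Ls.length * D') ((Ls.map fun L => L.gates.length).sum * s')
        (layersOp Ls) := by
    intro Ls
    induction Ls with
    | nil => intro _; simpa [layersOp_nil] using ImplOn.one Finset.univ 0
    | cons L Ls ih =>
      intro hL
      obtain ⟨S, _, hI⟩ := layer L.gates (hL L (by simp)) L.disjoint
      have := (hI.mono (Finset.subset_univ _) le_rfl le_rfl).mul
        (ih fun L hL' => hL L (List.mem_cons_of_mem _ hL'))
      rw [layersOp_cons]
      convert this using 1
      · rw [List.length_cons]; ring
      · rw [List.map_cons, List.sum_cons]; ring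
      · rfl
  have hC := (all C.layers h1).lift finSumFinEquiv.symm.toEmbedding
  have := (hC.mono (Finset.subset_univ _) le_rfl le_rfl).ancilla (U := U) ?_
  · refine this.mono le_rfl (Nat.mul_le_mul_right _ h3) (add_le_add ?_ (Nat.mul_le_mul_right _ h5))
    rw [Fintype.card_fin]; omega
  · intro y
    funext z
    rw [mulVec_single_one, Matrix.col_apply, lift_equiv_apply]
    have hx : ∀ z : Fin w ⊕ Fin a → ZMod d, z ∘ finSumFinEquiv.symm =
        Fin.append (z ∘ Sum.inl) (z ∘ Sum.inr) := by
      intro z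
      funext j
      refine Fin.addCases (fun j => ?_) (fun j => ?_) j <;> simp
    rw [hx, hx]
    have := h2 (z ∘ Sum.inl) y (z ∘ Sum.inr)
    simp only [Sum.elim_comp_inl, Sum.elim_comp_inr]
    refine Eq.trans this ?_
    simp only [inflate, mulVec_single_one, Matrix.col_apply]

end Realization

/-! ### Tensor products: independent blocks in parallel. -/

section Tensor

variable {d : ℕ} [NeZero d] {B : Type} [Fintype B] [DecidableEq B] {ι : B → Type}
  [∀ b, Fintype (ι b)] [∀ b, DecidableEq (ι b)] {K : Fanin}

/-- The tensor product of a family of operators. -/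
noncomputable def tensor (U : ∀ b, Op d (ι b)) : Op d (Σ b, ι b) :=
  fun x y => ∏ b, U b (fun i => x ⟨b, i⟩) (fun i => y ⟨b, i⟩)

lemma sum_prod_sigma (f : ∀ b, (ι b → ZMod d) → ℂ) :
    ∑ x : (Σ b, ι b) → ZMod d, ∏ b, f b (fun i => x ⟨b, i⟩) = ∏ b, ∑ x, f b x := by
  rw [Fintype.prod_sum, ← (Equiv.piCurry fun (b : B) (_ : ι b) => ZMod d).sum_comp]
  rfl

lemma tensor_mul (U V : ∀ b, Op d (ι b)) :
    tensor U * tensor V = tensor fun b => U b * V b := by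
  ext x y
  simp only [Matrix.mul_apply, tensor, ← Finset.prod_mul_distrib]
  exact sum_prod_sigma fun b z => U b (fun i => x ⟨b, i⟩) z * V b z (fun i => y ⟨b, i⟩)

lemma tensor_diagonal (φ : ∀ b, (ι b → ZMod d) → ℂ) :
    tensor (fun b => diagonal (φ b)) = diagonal fun x => ∏ b, φ b fun i => x ⟨b, i⟩ := by
  ext x y
  by_cases h : x = y
  · subst h; simp [tensor]
  · rw [diagonal_apply_ne _ h, tensor]
    have : ∃ b i, x ⟨b, i⟩ ≠ y ⟨b, i⟩ := by
      by_contra! h'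
      exact h (funext fun ⟨b, i⟩ => h' b i)
    obtain ⟨b, i, hi⟩ := this
    exact Finset.prod_eq_zero (Finset.mem_univ b)
      (diagonal_apply_ne _ fun h' => hi (congrFun h' i))

lemma tensor_one : tensor (fun b => (1 : Op d (ι b))) = 1 := by
  have := tensor_diagonal (d := d) (ι := ι) fun _ _ => 1
  simp only [Finset.prod_const_one] at this
  simpa using this

lemma lift_sigmaMk (b : B) (U : Op d (ι b)) :
    lift (Function.Embedding.sigmaMk b) U =
      tensor (Function.update (fun b => (1 : Op d (ι b))) b U) := by
  classical
  ext x y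
  rw [tensor, lift, ← Finset.mul_prod_erase _ _ (Finset.mem_univ b), Function.update_self]
  have : ∏ c ∈ Finset.univ.erase b, (Function.update (fun b => (1 : Op d (ι b))) b U) c
      (fun i => x ⟨c, i⟩) (fun i => y ⟨c, i⟩) =
      if ∀ j, j ∉ Set.range (Function.Embedding.sigmaMk (β := ι) b) → x j = y j
        then 1 else 0 := by
    split_ifs with h
    · refine Finset.prod_eq_one fun c hc => ?_
      rw [Function.update_of_ne (Finset.ne_of_mem_erase hc), Matrix.one_apply, if_pos]
      funext i
      refine h _ ?_
      rintro ⟨k, hk⟩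
      exact Finset.ne_of_mem_erase hc (congrArg Sigma.fst hk).symm
    · push Not at h
      obtain ⟨⟨c, i⟩, hj, hne⟩ := h
      have hc : c ≠ b := by
        rintro rfl
        exact hj ⟨i, rfl⟩
      refine Finset.prod_eq_zero (Finset.mem_erase.mpr ⟨hc, Finset.mem_univ c⟩) ?_
      rw [Function.update_of_ne hc, Matrix.one_apply, if_neg]
      exact fun h' => hne (congrFun h' i)
  rw [this]
  split_ifs
  · rw [mul_one]; rfl
  · rw [mul_zero]

/-- The blocks occupy disjoint wires, so sizes add up while the depth stays `D`. The induction adds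
one block at a time. -/
lemma ImplOn.tensor {D s : ℕ} {U : ∀ b, Op d (ι b)}
    (h : ∀ b, ImplOn K Finset.univ D s (U b)) :
    ImplOn K Finset.univ D (Fintype.card B * s) (tensor U) := by
  have key : ∀ T : Finset B, ImplOn K (T.sigma fun b => (Finset.univ : Finset (ι b))) D
      (T.card * s) (Qudit.tensor fun b => if b ∈ T then U b else 1) := by
    intro T
    induction T using Finset.induction_on with
    | empty =>
      have := ImplOn.one (d := d) (K := K) (∅ : Finset (Σ b, ι b)) D
      simpa [tensor_one] using this.mono (Finset.empty_subset _) le_rfl le_rfl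
    | insert b T hb ih =>
      have h1 := ((h b).lift (Function.Embedding.sigmaMk b)).par ?_ ih
      · rw [lift_sigmaMk, tensor_mul] at h1
        have h2 := h1.mono (T := (insert b T).sigma fun b => (Finset.univ : Finset (ι b))) ?_ le_rfl
          (s' := (insert b T).card * s) ?_
        · convert h2 using 2
          funext c
          by_cases hc : c = b
          · subst hc; simp [hb]
          · simp [hc]
        · intro x hx
          rcases Finset.mem_union.mp hx with hx | hx
          · obtain ⟨i, _, rfl⟩ := Finset.mem_map.mp hx
            simp
          · simp only [Finset.mem_sigma, Finset.mem_univ, and_true] at hx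
            simp [hx]
        · rw [Finset.card_insert_of_notMem hb]
          exact le_of_eq (by ring)
      · rw [Finset.disjoint_left]
        intro x hx hx'
        obtain ⟨i, _, rfl⟩ := Finset.mem_map.mp hx
        simp only [Finset.mem_sigma, Finset.mem_univ, and_true] at hx'
        exact hb hx'
  have := key Finset.univ
  simpa using this.mono (Finset.subset_univ _) le_rfl le_rfl

end Tensor

/-! ### Families of operators with uniform bounds on depth and size. -/

section Families

variable {d : ℕ} [NeZero d]

/-- Polynomial bounds relative to a size function. -/
def PolyLE {J : Type*} (sz f : J → ℕ) : Prop :=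
  ∃ P : Polynomial ℕ, ∀ j, f j ≤ P.eval (sz j)

lemma polynomial_eval_mono (P : Polynomial ℕ) {m n : ℕ} (h : m ≤ n) : P.eval m ≤ P.eval n := by
  simp only [Polynomial.eval_eq_sum, Polynomial.sum]
  exact Finset.sum_le_sum fun i _ => Nat.mul_le_mul_left _ (Nat.pow_le_pow_left h i)

namespace PolyLE

variable {J J' : Type*} {sz : J → ℕ} {f g : J → ℕ}

lemma of_le (h : ∀ j, f j ≤ sz j) : PolyLE sz f := ⟨Polynomial.X, by simpa using h⟩

lemma const (c : ℕ) : PolyLE sz fun _ => c := ⟨Polynomial.C c, by simp⟩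

lemma add (hf : PolyLE sz f) (hg : PolyLE sz g) : PolyLE sz fun j => f j + g j := by
  obtain ⟨P, hP⟩ := hf
  obtain ⟨Q, hQ⟩ := hg
  exact ⟨P + Q, fun j => by simpa using add_le_add (hP j) (hQ j)⟩

lemma mul (hf : PolyLE sz f) (hg : PolyLE sz g) : PolyLE sz fun j => f j * g j := by
  obtain ⟨P, hP⟩ := hf
  obtain ⟨Q, hQ⟩ := hg
  exact ⟨P * Q, fun j => by simpa using Nat.mul_le_mul (hP j) (hQ j)⟩

lemma mono (hf : PolyLE sz f) (h : ∀ j, g j ≤ f j) : PolyLE sz g := by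
  obtain ⟨P, hP⟩ := hf
  exact ⟨P, fun j => (h j).trans (hP j)⟩

lemma comp {P : Polynomial ℕ} (hf : PolyLE sz f) : PolyLE sz fun j => P.eval (f j) := by
  obtain ⟨Q, hQ⟩ := hf
  exact ⟨P.comp Q, fun j => by
    rw [Polynomial.eval_comp]; exact polynomial_eval_mono P (hQ j)⟩

lemma sigma {B : J → Type*} (hf : PolyLE sz f) :
    PolyLE (fun j : Σ j, B j => sz j.1) fun j => f j.1 := by
  obtain ⟨P, hP⟩ := hf
  exact ⟨P, fun j => hP j.1⟩

lemma refl : PolyLE sz sz := of_le fun _ => le_rfl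

end PolyLE

/-- The operators `U j` have circuits of bounded depth and of size polynomial in `sz j`. -/
def Feas (K : Fanin) {J : Type*} (sz : J → ℕ) {ι : J → Type} [∀ j, Fintype (ι j)]
    [∀ j, DecidableEq (ι j)] (U : ∀ j, Op d (ι j)) : Prop :=
  ∃ (D : ℕ) (P : Polynomial ℕ), ∀ j, ImplOn K Finset.univ D (P.eval (sz j)) (U j)

namespace Feas

variable {K : Fanin} {J J' : Type*} {sz : J → ℕ} {sz' : J' → ℕ} {ι κ β : J → Type}
  [∀ j, Fintype (ι j)] [∀ j, DecidableEq (ι j)] [∀ j, Fintype (κ j)] [∀ j, DecidableEq (κ j)]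
  [∀ j, Fintype (β j)] [∀ j, DecidableEq (β j)]
  {U V : ∀ j, Op d (ι j)}

lemma congr (h : Feas K sz U) (hUV : ∀ j, U j = V j) : Feas K sz V := by
  have : U = V := funext hUV
  rwa [← this]

lemma of_implOn {D : ℕ} {s : J → ℕ} (h : ∀ j, ImplOn K Finset.univ D (s j) (U j))
    (hs : PolyLE sz s) : Feas K sz U := by
  obtain ⟨P, hP⟩ := hs
  exact ⟨D, P, fun j => (h j).mono le_rfl le_rfl (hP j)⟩

lemma of_gate {S : ∀ j, Finset (ι j)} (h : ∀ j, IsGate K (S j) (U j)) : Feas K sz U :=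
  of_implOn (fun j => (ImplOn.gate (h j)).mono (Finset.subset_univ _) le_rfl le_rfl)
    (PolyLE.const 1)

lemma one : Feas K sz fun j => (1 : Op d (ι j)) :=
  of_implOn (fun _ => ImplOn.one _ 0) (PolyLE.const 0)

lemma mul (hU : Feas K sz U) (hV : Feas K sz V) : Feas K sz fun j => U j * V j := by
  obtain ⟨D, P, hP⟩ := hU
  obtain ⟨E, Q, hQ⟩ := hV
  exact ⟨E + D, Q + P, fun j => by simpa using (hQ j).mul (hP j)⟩

lemma unitary (hU : Feas K sz U) (j : J) : (U j)ᴴ * U j = 1 := by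
  obtain ⟨D, P, hP⟩ := hU
  exact (hP j).unitary

lemma conjTranspose (hU : Feas K sz U) : Feas K sz fun j => (U j)ᴴ := by
  obtain ⟨D, P, hP⟩ := hU
  exact ⟨d * D, Polynomial.C d * P, fun j => by simpa using (hP j).conjTranspose⟩

lemma lift (hU : Feas K sz U) (e : ∀ j, ι j ↪ κ j) : Feas K sz fun j => Qudit.lift (e j) (U j) := by
  obtain ⟨D, P, hP⟩ := hU
  exact ⟨D, P, fun j => ((hP j).lift (e j)).mono (Finset.subset_univ _) le_rfl le_rfl⟩

lemma comap (hU : Feas K sz U) (f : J' → J) (hf : PolyLE sz' fun j => sz (f j)) :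
    Feas K sz' fun j => U (f j) := by
  obtain ⟨D, P, hP⟩ := hU
  exact of_implOn (fun j => hP (f j)) (hf.comp (P := P))

lemma ancilla {W : ∀ j, Op d (ι j ⊕ β j)} (hW : Feas K sz W)
    (hβ : PolyLE sz fun j => Fintype.card (β j))
    (h : ∀ j, ∀ x : ι j → ZMod d, W j *ᵥ Pi.single (Sum.elim x (0 : β j → ZMod d)) 1 =
      inflate (β j) (U j *ᵥ Pi.single x 1)) : Feas K sz U := by
  obtain ⟨D, P, hP⟩ := hW
  exact of_implOn (fun j => (hP j).ancilla (h j)) (hβ.add ⟨P, fun _ => le_rfl⟩)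

/-- Indexing the hypothesis by pairs `(j, b)` forces one depth and one polynomial for all blocks of
all members of the family. -/
lemma tensor {B : J → Type} [∀ j, Fintype (B j)] [∀ j, DecidableEq (B j)]
    {ι : ∀ j, B j → Type} [∀ j b, Fintype (ι j b)] [∀ j b, DecidableEq (ι j b)]
    {U : ∀ j b, Op d (ι j b)}
    (hU : Feas K (J := Σ j, B j) (ι := fun j => ι j.1 j.2) (fun j => sz j.1)
      (fun j => U j.1 j.2))
    (hB : PolyLE sz fun j => Fintype.card (B j)) :
    Feas K sz fun j => Qudit.tensor (U j) := by
  obtain ⟨D, P, hP⟩ := hU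
  exact of_implOn (fun j => ImplOn.tensor fun b => hP ⟨j, b⟩) (hB.mul ⟨P, fun _ => le_rfl⟩)

lemma diag_mul {φ ψ : ∀ j, (ι j → ZMod d) → ℂ} (hφ : Feas K sz fun j => diagonal (φ j))
    (hψ : Feas K sz fun j => diagonal (ψ j)) :
    Feas K sz fun j => diagonal fun x => φ j x * ψ j x :=
  (hφ.mul hψ).congr fun _ => diagonal_mul_diagonal _ _

lemma diag_lift {φ : ∀ j, (ι j → ZMod d) → ℂ} (hφ : Feas K sz fun j => diagonal (φ j))
    (e : ∀ j, ι j ↪ κ j) : Feas K sz fun j => diagonal fun x : κ j → ZMod d => φ j (x ∘ e j) :=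
  (hφ.lift e).congr fun _ => lift_diagonal _ _

/-- If `A` computes, from clean ancillas, basis states on which the phase `ψ` equals the
phase `φ` of the input, then `φ` is feasible: compute, apply `ψ`, uncompute. -/
lemma diag_conj {A : ∀ j, Op d (ι j ⊕ β j)} {ψ : ∀ j, (ι j ⊕ β j → ZMod d) → ℂ}
    {φ : ∀ j, (ι j → ZMod d) → ℂ} (hA : Feas K sz A)
    (hψ : Feas K sz fun j => diagonal (ψ j))
    (hβ : PolyLE sz fun j => Fintype.card (β j))
    (h : ∀ j z x, A j z (Sum.elim x 0) ≠ 0 → ψ j z = φ j x) :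
    Feas K sz fun j => diagonal (φ j) := by
  refine ((hA.conjTranspose.mul hψ).mul hA).ancilla hβ fun j x => ?_
  -- The computed state may be a superposition, but `ψ` is constant on its support, so the phase is
  -- a scalar and the inverse of `A` restores the input.
  have h1 : diagonal (ψ j) *ᵥ (A j *ᵥ Pi.single (Sum.elim x 0) 1) =
      φ j x • (A j *ᵥ Pi.single (Sum.elim x 0) 1) := by
    funext z
    rw [mulVec_diagonal, mulVec_single_one, Pi.smul_apply, Matrix.col_apply, smul_eq_mul]
    by_cases hz : A j z (Sum.elim x 0) = 0
    · rw [hz]; simp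
    · rw [h j z x hz]
  rw [← mulVec_mulVec, ← mulVec_mulVec, h1, mulVec_smul, mulVec_mulVec, hA.unitary j, one_mulVec]
  have h2 : diagonal (φ j) *ᵥ (Pi.single x 1 : (ι j → ZMod d) → ℂ) = φ j x • Pi.single x 1 := by
    funext z
    rw [mulVec_diagonal, Pi.smul_apply, smul_eq_mul]
    by_cases hz : z = x
    · rw [hz]
    · simp [hz]
  rw [h2, ← inflate_single]
  funext z
  simp only [inflate, Pi.smul_apply]
  split_ifs <;> simp

end Feas

end Families

/-! ### Controlled one-qudit operators and supports of matrix entries. -/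

section Local

variable {d : ℕ} [NeZero d] {α β ι κ γ : Type} [Fintype α] [DecidableEq α] [Fintype β] [DecidableEq β]
  [Fintype ι] [DecidableEq ι] [Fintype κ] [DecidableEq κ] [Fintype γ] [DecidableEq γ]

/-- A one-qudit operator on every wire. -/
noncomputable def locals (V : ι → Matrix (ZMod d) (ZMod d) ℂ) : Op d ι :=
  fun x y => ∏ i, V i (x i) (y i)

/-- One-qudit operators on the wires in `β`, controlled by the wires in `α`. -/
noncomputable def ctrlLocals (V : (α → ZMod d) → β → Matrix (ZMod d) (ZMod d) ℂ) :
    Op d (α ⊕ β) :=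
  fun z x => if z ∘ Sum.inl = x ∘ Sum.inl then
    ∏ k, V (x ∘ Sum.inl) k (z (Sum.inr k)) (x (Sum.inr k)) else 0

lemma ctrlLocals_mul (V V' : (α → ZMod d) → β → Matrix (ZMod d) (ZMod d) ℂ) :
    ctrlLocals V * ctrlLocals V' = ctrlLocals fun a k => V a k * V' a k := by
  ext z x
  simp only [Matrix.mul_apply, ctrlLocals]
  rw [← (Equiv.sumArrowEquivProdArrow α β (ZMod d)).symm.sum_comp, Fintype.sum_prod_type]
  have hl : ∀ (a : α → ZMod d) (b : β → ZMod d),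
      (Equiv.sumArrowEquivProdArrow α β (ZMod d)).symm (a, b) ∘ Sum.inl = a := fun _ _ => rfl
  have hr : ∀ (a : α → ZMod d) (b : β → ZMod d) (k : β),
      (Equiv.sumArrowEquivProdArrow α β (ZMod d)).symm (a, b) (Sum.inr k) = b k :=
    fun _ _ _ => rfl
  simp only [hl, hr]
  rw [Finset.sum_eq_single (x ∘ Sum.inl)]
  · simp only [if_true]
    by_cases h : z ∘ Sum.inl = x ∘ Sum.inl
    · simp only [if_pos h, ← Finset.prod_mul_distrib]
      rw [Fintype.prod_sum]
    · simp [if_neg h]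
  · intro a _ ha
    simp [if_neg ha]
  · simp

lemma lift_inr_locals (V : β → Matrix (ZMod d) (ZMod d) ℂ) :
    lift (Function.Embedding.inr : β ↪ α ⊕ β) (locals V) = ctrlLocals fun _ => V := by
  classical
  ext x y
  simp only [lift, locals, ctrlLocals]
  refine if_congr ?_ rfl rfl
  constructor
  · intro h
    funext a
    exact h _ (by simp)
  · rintro h (j | j) hj
    · exact congrFun h j
    · simp at hj

lemma ctrlLocals_diagonal (φ : (α → ZMod d) → β → ZMod d → ℂ) :
    ctrlLocals (fun a k => diagonal (φ a k)) =
      diagonal fun z : α ⊕ β → ZMod d => ∏ k, φ (z ∘ Sum.inl) k (z (Sum.inr k)) := by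
  ext z x
  by_cases h : z = x
  · subst h; simp [ctrlLocals]
  · rw [diagonal_apply_ne _ h, ctrlLocals]
    split_ifs with h1
    · have : ∃ k, z (Sum.inr k) ≠ x (Sum.inr k) := by
        by_contra! h'
        refine h (funext fun j => ?_)
        cases j with
        | inl j => exact congrFun h1 j
        | inr j => exact h' j
      obtain ⟨k, hk⟩ := this
      exact Finset.prod_eq_zero (Finset.mem_univ k) (diagonal_apply_ne _ hk)
    · rfl

lemma tgt_diagonal (t : ι) (w : (ι → ZMod d) → ZMod d → ℂ) :
    tgt t (fun y => diagonal (w y)) = diagonal fun z => w z (z t) := by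
  ext x y
  by_cases h : x = y
  · subst h; simp [tgt]
  · rw [diagonal_apply_ne _ h, tgt]
    split_ifs with h1
    · refine diagonal_apply_ne _ fun h2 => h (funext fun j => ?_)
      by_cases hj : j = t
      · rw [hj, h2]
      · exact h1 j hj
    · rfl

lemma tgt_eq_ctrlLocals (W : (α → ZMod d) → Matrix (ZMod d) (ZMod d) ℂ) :
    tgt (Sum.inr ()) (fun y : α ⊕ Unit → ZMod d => W (y ∘ Sum.inl)) =
      ctrlLocals fun a _ => W a := by
  ext x y
  simp only [tgt, ctrlLocals, Fintype.prod_unique]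
  refine if_congr ?_ rfl rfl
  constructor
  · intro h
    funext a
    exact h _ (by simp)
  · rintro h (j | j) hj
    · exact congrFun h j
    · exact absurd rfl hj

lemma diagonal_mem_unitary {v : ZMod d → ℂ} (hv : ∀ l, ‖v l‖ = 1) :
    diagonal v ∈ Matrix.unitaryGroup (ZMod d) ℂ := by
  rw [Matrix.mem_unitaryGroup_iff', star_eq_conjTranspose, diagonal_conjTranspose,
    diagonal_mul_diagonal, ← diagonal_one]
  congr 1
  funext l
  rw [Pi.star_apply, RCLike.star_def, Complex.conj_mul', hv]
  simp

lemma ctrlLocals_ne_zero {V : (α → ZMod d) → β → Matrix (ZMod d) (ZMod d) ℂ}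
    {z x : α ⊕ β → ZMod d} (h : ctrlLocals V z x ≠ 0) :
    z ∘ Sum.inl = x ∘ Sum.inl ∧ ∀ k, V (x ∘ Sum.inl) k (z (Sum.inr k)) (x (Sum.inr k)) ≠ 0 := by
  rw [ctrlLocals] at h
  split_ifs at h with h1
  · exact ⟨h1, fun k => Finset.prod_ne_zero_iff.mp h k (Finset.mem_univ k)⟩
  · exact absurd rfl h

lemma tensor_ne_zero {B : Type} [Fintype B] [DecidableEq B] {ι : B → Type}
    [∀ b, Fintype (ι b)] [∀ b, DecidableEq (ι b)] {U : ∀ b, Op d (ι b)}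
    {x y : (Σ b, ι b) → ZMod d} (h : tensor U x y ≠ 0) (b : B) :
    U b (fun i => x ⟨b, i⟩) (fun i => y ⟨b, i⟩) ≠ 0 :=
  Finset.prod_ne_zero_iff.mp h b (Finset.mem_univ b)

lemma lift_ne_zero {e : ι ↪ κ} {U : Op d ι} {x y : κ → ZMod d} (h : lift e U x y ≠ 0) :
    (∀ j, j ∉ Set.range e → x j = y j) ∧ U (x ∘ e) (y ∘ e) ≠ 0 := by
  classical
  rw [lift] at h
  split_ifs at h with h1
  · exact ⟨h1, h⟩
  · exact absurd rfl h

lemma mul_ne_zero_exists {U V : Op d ι} {x y : ι → ZMod d} (h : (U * V) x y ≠ 0) :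
    ∃ z, U x z ≠ 0 ∧ V z y ≠ 0 := by
  rw [Matrix.mul_apply] at h
  obtain ⟨z, _, hz⟩ := Finset.exists_ne_zero_of_sum_ne_zero h
  exact ⟨z, left_ne_zero_of_mul hz, right_ne_zero_of_mul hz⟩

end Local

/-! ### Feasible layers of one-qudit operators and elementary phases. -/

namespace Feas

variable {d : ℕ} [NeZero d] {K : Fanin} {J J' : Type*} {sz : J → ℕ} {ι β : J → Type}
  [∀ j, Fintype (ι j)] [∀ j, DecidableEq (ι j)]
  [∀ j, Fintype (β j)] [∀ j, DecidableEq (β j)]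

lemma locals {V : ∀ j, ι j → Matrix (ZMod d) (ZMod d) ℂ} (hV : ∀ j i, (V j i)ᴴ * V j i = 1)
    (hι : PolyLE sz fun j => Fintype.card (ι j)) : Feas K sz fun j => Qudit.locals (V j) := by
  have h1 : Feas K (J := Σ j, ι j) (ι := fun _ => Unit) (fun j => sz j.1)
      (fun j => tgt () fun _ : Unit → ZMod d => V j.1 j.2) :=
    of_gate fun j => IsGate.single () ⟨V j.1 j.2, Matrix.mem_unitaryGroup_iff'.mpr (hV _ _)⟩
  refine ((h1.tensor (B := ι) (ι := fun _ _ => Unit)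
    (U := fun j i => tgt () fun _ => V j i) hι).lift
    fun j => (Equiv.sigmaPUnit (ι j)).toEmbedding).congr fun j => ?_
  ext x y
  rw [lift_equiv_apply]
  simp [Qudit.tensor, Qudit.locals, tgt]

/-- Conjugating controlled one-qudit operators by a one-qudit unitary on the targets. -/
lemma ctrlLocals_conj {V : ∀ j, (ι j → ZMod d) → β j → Matrix (ZMod d) (ZMod d) ℂ}
    (hV : Feas K sz fun j => Qudit.ctrlLocals (V j))
    {G : Matrix (ZMod d) (ZMod d) ℂ} (hG : Gᴴ * G = 1)
    (hβ : PolyLE sz fun j => Fintype.card (β j)) :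
    Feas K sz fun j => Qudit.ctrlLocals fun (a : ι j → ZMod d) (k : β j) =>
      Gᴴ * V j a k * G := by
  have h1 : Feas K sz fun j => Qudit.lift (Function.Embedding.inr : β j ↪ ι j ⊕ β j)
      (Qudit.locals fun _ => G) := (locals (fun _ _ => hG) hβ).lift _
  have h2 : Feas K sz fun j => Qudit.lift (Function.Embedding.inr : β j ↪ ι j ⊕ β j)
      (Qudit.locals fun _ => Gᴴ) :=
    (locals (fun _ _ => by rw [conjTranspose_conjTranspose]; exact mul_eq_one_comm.mp hG)
      hβ).lift _
  refine ((h2.mul hV).mul h1).congr fun j => ?_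
  rw [lift_inr_locals, lift_inr_locals, ctrlLocals_mul, ctrlLocals_mul]

/-- Reduces a controlled operator to a diagonal one: a basis change on the targets alone
diagonalizes all the operators simultaneously. -/
lemma ctrlLocals {φ : ∀ j, (ι j → ZMod d) → β j → ZMod d → ℂ}
    (hφ : Feas K sz fun j => diagonal fun z : ι j ⊕ β j → ZMod d =>
      ∏ k, φ j (z ∘ Sum.inl) k (z (Sum.inr k)))
    {G : Matrix (ZMod d) (ZMod d) ℂ} (hG : Gᴴ * G = 1)
    (hβ : PolyLE sz fun j => Fintype.card (β j)) :
    Feas K sz fun j => Qudit.ctrlLocals fun (a : ι j → ZMod d) (k : β j) =>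
      Gᴴ * diagonal (φ j a k) * G :=
  ctrlLocals_conj (hφ.congr fun _ => (ctrlLocals_diagonal _).symm) hG hβ

lemma phase {v : J → ZMod d → ℂ} (hv : ∀ j l, ‖v j l‖ = 1) (t : ∀ j, ι j) :
    Feas K sz fun j => diagonal fun z : ι j → ZMod d => v j (z (t j)) := by
  have h : Feas K sz fun j => tgt (t j) fun _ : ι j → ZMod d => diagonal (v j) :=
    of_gate fun j => IsGate.single (t j) ⟨_, diagonal_mem_unitary (hv j)⟩
  exact h.congr fun j => tgt_diagonal _ _

lemma ctrl_phase {v : J → ZMod d → ℂ} (hv : ∀ j l, ‖v j l‖ = 1) (c t : ∀ j, ι j)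
    (hct : ∀ j, c j ≠ t j) :
    Feas K sz fun j => diagonal fun z : ι j → ZMod d => v j (z (t j)) ^ (z (c j)).val := by
  have h : Feas K sz fun j => tgt (t j) fun z : ι j → ZMod d => diagonal (v j) ^ (z (c j)).val :=
    of_gate fun j => IsGate.ctrl (c j) (t j) (hct j) ⟨_, diagonal_mem_unitary (hv j)⟩
  refine h.congr fun j => ?_
  simp only [diagonal_pow]
  exact tgt_diagonal _ _

end Feas

/-! ### Fan-out and simultaneous application of many phases. -/

section Copying

variable {d : ℕ} [NeZero d] {K : Fanin}

/-- The fan-out of one qudit to the qudits in `B`. -/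
noncomputable def copyOp (d : ℕ) [NeZero d] (B : Type) [Fintype B] [DecidableEq B] :
    Op d (Unit ⊕ B) :=
  ctrlLocals fun a _ => shift (a ())

variable {J : Type*} {sz : J → ℕ} {ι B : J → Type}
  [∀ j, Fintype (ι j)] [∀ j, DecidableEq (ι j)] [∀ j, Fintype (B j)] [∀ j, DecidableEq (B j)]

lemma Feas.copyOp (hcopy : Feas K (fun n : ℕ => n) fun n => Qudit.copyOp d (Fin n))
    (hB : PolyLE sz fun j => Fintype.card (B j)) : Feas K sz fun j => Qudit.copyOp d (B j) := by
  refine ((hcopy.comap (fun j => Fintype.card (B j)) hB).lift fun j =>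
    ((Equiv.refl Unit).sumCongr (Fintype.equivFin (B j)).symm).toEmbedding).congr fun j => ?_
  ext x y
  rw [lift_equiv_apply]
  simp only [Qudit.copyOp, Qudit.ctrlLocals]
  refine if_congr Iff.rfl ?_ rfl
  exact (Fintype.equivFin (B j)).symm.prod_comp
    fun b => shift (y (Sum.inl ())) (x (Sum.inr b)) (y (Sum.inr b))

/-- Products of polynomially many feasible phases are feasible if fan-out is. -/
lemma Feas.diag_prod (hcopy : Feas K (fun n : ℕ => n) fun n => Qudit.copyOp d (Fin n))
    {φ : ∀ j, B j → (ι j → ZMod d) → ℂ}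
    (hφ : Feas K (J := Σ j, B j) (ι := fun j => ι j.1) (fun j => sz j.1)
      (fun j => diagonal (φ j.1 j.2)))
    (hB : PolyLE sz fun j => Fintype.card (B j))
    (hι : PolyLE sz fun j => Fintype.card (ι j)) :
    Feas K sz fun j => diagonal fun x => ∏ b, φ j b x := by
  -- The ancilla `(i, b)` holds the copy of wire `i` reserved for the phase `b`. Through `f` below,
  -- each phase acts on its private copy of the input, so all of them run in parallel.
  let e : ∀ j, (Σ _ : ι j, Unit ⊕ B j) ≃ ι j ⊕ (ι j × B j) := fun j =>
    { toFun := fun x => Sum.elim (fun _ => Sum.inl x.1) (fun b => Sum.inr (x.1, b)) x.2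
      invFun := Sum.elim (fun i => ⟨i, Sum.inl ()⟩) (fun x => ⟨x.1, Sum.inr x.2⟩)
      left_inv := by rintro ⟨i, (u | b)⟩ <;> rfl
      right_inv := by rintro (i | ⟨i, b⟩) <;> rfl }
  let f : ∀ j, (Σ _ : B j, ι j) ↪ ι j ⊕ (ι j × B j) := fun j =>
    ⟨fun x => Sum.inr (x.2, x.1), by rintro ⟨b, i⟩ ⟨b', i'⟩ h; simp at h; simp [h]⟩
  have hA : Feas K sz fun j => Qudit.lift (e j).toEmbedding
      (Qudit.tensor fun _ : ι j => Qudit.copyOp d (B j)) := by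
    refine Feas.lift (Feas.tensor (B := ι) (ι := fun j _ => Unit ⊕ B j)
      (U := fun j _ => Qudit.copyOp d (B j)) ?_ hι) _
    refine Feas.copyOp hcopy ?_
    obtain ⟨P, hP⟩ := hB
    exact ⟨P, fun j => hP j.1⟩
  have hψ : Feas K sz fun j => diagonal fun z : ι j ⊕ (ι j × B j) → ZMod d =>
      ∏ b, φ j b fun i => z (Sum.inr (i, b)) := by
    have := (Feas.tensor (B := B) (ι := fun j _ => ι j)
      (U := fun j b => diagonal (φ j b)) hφ hB).lift f
    refine this.congr fun j => ?_
    rw [tensor_diagonal, lift_diagonal]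
    rfl
  refine Feas.diag_conj hA hψ ((hι.mul hB).mono fun j => by simp) fun j z x h => ?_
  rw [lift_equiv_apply] at h
  refine Finset.prod_congr rfl fun b _ => ?_
  congr 1
  funext i
  have h1 := (ctrlLocals_ne_zero (tensor_ne_zero h i)).2 b
  by_contra h2
  refine h1 (if_neg ?_)
  simpa [e] using h2

end Copying

/-! ### The one-qudit Fourier transform. -/

section Fourier

variable {d : ℕ} [NeZero d]

open ZMod (stdAddChar)

lemma norm_stdAddChar (x : ZMod d) : ‖stdAddChar x‖ = 1 := by
  rw [ZMod.stdAddChar_apply, Circle.norm_coe]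

lemma star_stdAddChar (x : ZMod d) : star (stdAddChar x) = stdAddChar (-x) := by
  rw [AddChar.map_neg_eq_inv, RCLike.star_def, Complex.inv_eq_conj (norm_stdAddChar x)]

lemma stdAddChar_mul_pow (x y : ZMod d) : stdAddChar x ^ y.val = stdAddChar (x * y) := by
  rw [← AddChar.map_nsmul_eq_pow, nsmul_eq_mul, ZMod.natCast_zmod_val, mul_comm]

lemma stdAddChar_sum {ι : Type} (s : Finset ι) (f : ι → ZMod d) :
    stdAddChar (∑ i ∈ s, f i) = ∏ i ∈ s, stdAddChar (f i) := by
  classical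
  induction s using Finset.induction_on with
  | empty => simp
  | insert i s hi ih =>
    rw [Finset.sum_insert hi, Finset.prod_insert hi, AddChar.map_add_eq_mul, ih]

/-- The Fourier transform of one qudit. -/
noncomputable def four (d : ℕ) [NeZero d] : Matrix (ZMod d) (ZMod d) ℂ :=
  fun l m => stdAddChar (l * m) / (Real.sqrt d : ℝ)

lemma four_conj_diagonal (f : ZMod d → ℂ) (z x : ZMod d) :
    ((four d)ᴴ * diagonal f * four d) z x = (∑ l, f l * stdAddChar (l * (x - z))) / d := by
  have hd : ((Real.sqrt d : ℝ) : ℂ) * (Real.sqrt d : ℝ) = d := by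
    rw [← Complex.ofReal_mul, Real.mul_self_sqrt (Nat.cast_nonneg d), Complex.ofReal_natCast]
  rw [Matrix.mul_apply, Finset.sum_div]
  refine Finset.sum_congr rfl fun l _ => ?_
  rw [mul_diagonal, conjTranspose_apply, four, four, star_div₀, star_stdAddChar, mul_sub, sub_eq_add_neg,
    AddChar.map_add_eq_mul, RCLike.star_def, Complex.conj_ofReal, ← hd]
  have : ((Real.sqrt d : ℝ) : ℂ) ≠ 0 := by
    intro h
    rw [h, zero_mul] at hd
    exact NeZero.ne d (by exact_mod_cast hd.symm)
  field_simp

lemma sum_stdAddChar (x : ZMod d) :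
    ∑ l : ZMod d, stdAddChar (l * x) = if x = 0 then (d : ℂ) else 0 := by
  rw [AddChar.sum_mulShift x (ZMod.isPrimitive_stdAddChar d)]
  simp [ZMod.card]

/-- Orthogonality of characters: a linear phase in the Fourier basis is a translation in the
computational basis. -/
lemma four_conj_char (s : ZMod d) :
    (four d)ᴴ * diagonal (fun l => stdAddChar (l * s)) * four d = shift s := by
  ext z x
  rw [four_conj_diagonal]
  simp only [← AddChar.map_add_eq_mul, ← mul_add]
  rw [sum_stdAddChar, shift]
  have hd : (d : ℂ) ≠ 0 := by exact_mod_cast NeZero.ne d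
  by_cases h : z = x + s
  · rw [if_pos h, if_pos (by rw [h]; ring), div_self hd]
  · rw [if_neg h, if_neg, zero_div]
    intro h'
    exact h (by linear_combination -h')

lemma four_unitary : (four d)ᴴ * four d = 1 := by
  have := four_conj_char (d := d) 0
  simpa [shift_zero] using this

lemma conj_shift (s : ZMod d) :
    (four d)ᴴᴴ * shift s * (four d)ᴴ = diagonal (fun l => stdAddChar (l * s)) := by
  have h : four d * (four d)ᴴ = 1 := mul_eq_one_comm.mp four_unitary
  rw [← four_conj_char, conjTranspose_conjTranspose]
  simp only [← Matrix.mul_assoc, h, Matrix.one_mul]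
  rw [Matrix.mul_assoc, h, Matrix.mul_one]

end Fourier

/-! ### Equivalence of modular gate, fan-out and `starOp`. -/

section Star

variable {d : ℕ} [NeZero d] {K : Fanin}

open ZMod (stdAddChar)

/-- The modular gate with controls `Fin n`. -/
noncomputable def modOp (d : ℕ) [NeZero d] (n : ℕ) : Op d (Fin n ⊕ Unit) :=
  ctrlLocals fun a _ => shift (∑ i, a i)

/-- The threshold gate with controls `Fin n`. -/
noncomputable def thOp (d : ℕ) [NeZero d] (n k : ℕ) : Op d (Fin n ⊕ Unit) :=
  ctrlLocals fun a _ => shift (thr k Finset.univ a)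

/-- The product of the controlled phases between one qudit and `n` others. -/
noncomputable def starOp (d : ℕ) [NeZero d] (n : ℕ) : Op d (Unit ⊕ Fin n) :=
  diagonal fun z => ∏ k, stdAddChar (z (Sum.inl ()) * z (Sum.inr k))

lemma sum_univ_map_inl {α : Type} [Fintype α] {M : Type*} [AddCommMonoid M]
    (f : α ⊕ Unit → M) :
    ∑ j ∈ (Finset.univ : Finset α).map Function.Embedding.inl, f j = ∑ i, f (Sum.inl i) := by
  rw [Finset.sum_map]; rfl

lemma isGate_modOp (n : ℕ) : IsGate Fanin.mod
    (insert (Sum.inr ()) (Finset.univ.map Function.Embedding.inl)) (modOp d n) := by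
  have h := IsGate.mod (d := d) rfl (Sum.inr () : Fin n ⊕ Unit)
    (Finset.univ.map Function.Embedding.inl) (by simp)
  simp only [sum_univ_map_inl] at h
  rw [modOp, ← tgt_eq_ctrlLocals]
  exact h

/-- The phases of `starOp` are symmetric in the distinguished qudit and the others. Fourier
conjugation on the `n` others yields fan-out; on the distinguished qudit it yields the modular gate,
as in the next two lemmas. -/
lemma feas_copyOp_of_starOp (h : Feas K (fun n : ℕ => n) (starOp d)) :
    Feas K (fun n : ℕ => n) fun n => copyOp d (Fin n) := by
  have := Feas.ctrlLocals (ι := fun _ => Unit) (β := fun n => Fin n)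
    (φ := fun n (a : Unit → ZMod d) _ l => stdAddChar (a () * l)) h four_unitary
    (PolyLE.of_le (by simp))
  refine this.congr fun n => ?_
  rw [copyOp]
  congr 1
  funext a k
  rw [← four_conj_char]
  simp only [mul_comm]

lemma feas_starOp_of_modOp (h : Feas K (fun n : ℕ => n) (modOp d)) :
    Feas K (fun n : ℕ => n) (starOp d) := by
  have h1 : (four d)ᴴᴴ * (four d)ᴴ = 1 := by
    rw [conjTranspose_conjTranspose]; exact mul_eq_one_comm.mp four_unitary
  have := (Feas.ctrlLocals_conj h h1 (PolyLE.const _)).lift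
    (κ := fun n => Unit ⊕ Fin n) fun n => (Equiv.sumComm _ _).toEmbedding
  refine this.congr fun n => ?_
  simp only [conj_shift]
  rw [ctrlLocals_diagonal (fun a _ l => stdAddChar (l * ∑ i, a i)), lift_diagonal, starOp]
  congr 1
  funext z
  simp [Finset.mul_sum, stdAddChar_sum]

lemma feas_modOp_of_starOp (h : Feas K (fun n : ℕ => n) (starOp d)) :
    Feas K (fun n : ℕ => n) (modOp d) := by
  have h1 := h.lift (κ := fun n => Fin n ⊕ Unit) fun n => (Equiv.sumComm _ _).toEmbedding
  have := Feas.ctrlLocals (ι := fun n => Fin n) (β := fun _ => Unit)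
    (φ := fun n (a : Fin n → ZMod d) _ l => stdAddChar (l * ∑ i, a i)) (h1.congr fun n => ?_)
    four_unitary (PolyLE.const _)
  · refine this.congr fun n => ?_
    simp only [four_conj_char]
    rfl
  · rw [starOp, lift_diagonal]
    congr 1
    funext z
    simp [Finset.mul_sum, stdAddChar_sum]

lemma feas_thOp_of_diag
    (h : Feas K (J := ℕ × ℕ) (fun j => j.1) (ι := fun j => Unit ⊕ Fin j.1) fun j =>
      diagonal fun z : Unit ⊕ Fin j.1 → ZMod d =>
        stdAddChar (z (Sum.inl ()) * thr j.2 Finset.univ (z ∘ Sum.inr))) :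
    Feas K (J := ℕ × ℕ) (fun j => j.1) (ι := fun j => Fin j.1 ⊕ Unit) fun j => thOp d j.1 j.2 := by
  have h1 := h.lift (κ := fun j => Fin j.1 ⊕ Unit) fun n => (Equiv.sumComm _ _).toEmbedding
  have := Feas.ctrlLocals (ι := fun j : ℕ × ℕ => Fin j.1) (β := fun _ => Unit)
    (φ := fun j (a : Fin j.1 → ZMod d) _ l => stdAddChar (l * thr j.2 Finset.univ a))
    (h1.congr fun n => ?_) four_unitary (PolyLE.const _)
  · refine this.congr fun n => ?_
    simp only [four_conj_char]
    rfl
  · rw [lift_diagonal]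
    congr 1
    funext z
    simp only [Fintype.prod_unique]
    rfl

end Star

/-! ### Testing whether the integer sum of the inputs equals a given number. -/

section Equality

variable {p : ℕ} [Fact p.Prime] {K : Fanin}

open ZMod (stdAddChar)

/-- The number of digits needed to separate the integers between `0` and `n * p`. -/
@[irreducible] def digits (p n : ℕ) : ℕ := Nat.log p (n * p + 1) + 1

lemma lt_pow_digits (n : ℕ) : n * p + 1 < p ^ digits p n :=
  by rw [digits]; exact Nat.lt_pow_succ_log_self (Fact.out : p.Prime).one_lt _

lemma pow_digits_le (n : ℕ) : p ^ digits p n ≤ (n * p + 1) * p := by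
  rw [digits, pow_succ]
  exact Nat.mul_le_mul_right _ (Nat.pow_log_le_self _ (by simp))

lemma digits_le (n : ℕ) : digits p n ≤ n * p + 1 + 1 :=
  by rw [digits]; exact Nat.add_le_add_right (Nat.log_le_self _ _) _

lemma sum_val_lt {n : ℕ} (x : Fin n → ZMod p) : ∑ i, (x i).val < n * p + 1 := by
  have : ∑ i, (x i).val ≤ ∑ _i : Fin n, p := Finset.sum_le_sum fun i _ => (ZMod.val_lt _).le
  simpa [Nat.lt_succ_iff] using this

/-- The phase `exp (2 π i l a / p ^ (k + 1))`. -/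
noncomputable def digitPhase (p : ℕ) (k : ℕ) (a : ℤ) (l : ZMod p) : ℂ :=
  Complex.exp (((2 * Real.pi * l.val * a / p ^ (k + 1) : ℝ) : ℂ) * Complex.I)

lemma norm_digitPhase (k : ℕ) (a : ℤ) (l : ZMod p) : ‖digitPhase p k a l‖ = 1 :=
  Complex.norm_exp_ofReal_mul_I _

lemma digitPhase_add (k : ℕ) (a b : ℤ) (l : ZMod p) :
    digitPhase p k (a + b) l = digitPhase p k a l * digitPhase p k b l := by
  rw [digitPhase, digitPhase, digitPhase, ← Complex.exp_add, ← add_mul, ← Complex.ofReal_add]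
  congr 3
  push_cast
  ring

lemma digitPhase_pow (k : ℕ) (m : ℕ) (l : ZMod p) :
    digitPhase p k 1 l ^ m = digitPhase p k m l := by
  induction m with
  | zero => simp [digitPhase]
  | succ m ih => rw [pow_succ, ih, ← digitPhase_add]; push_cast; rfl

lemma digitPhase_sum {ι : Type} (s : Finset ι) (k : ℕ) (f : ι → ℕ) (l : ZMod p) :
    ∏ i ∈ s, digitPhase p k (f i) l = digitPhase p k ((∑ i ∈ s, f i : ℕ) : ℤ) l := by
  classical
  induction s using Finset.induction_on with
  | empty => simp [digitPhase]
  | insert i s hi ih => rw [Finset.prod_insert hi, ih, ← digitPhase_add, Finset.sum_insert hi]; rfl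

lemma digitPhase_zero (k : ℕ) (l : ZMod p) : digitPhase p k 0 l = 1 := by simp [digitPhase]

/-- After cancelling `p ^ k` the phase is a genuine character of `ZMod p`, so its Fourier conjugate
is an exact shift by `u`. -/
lemma digitPhase_pow_mul (k : ℕ) (u : ℤ) (l : ZMod p) :
    digitPhase p k (p ^ k * u) l = stdAddChar (l * (u : ZMod p)) := by
  have hp : (p : ℂ) ≠ 0 := by exact_mod_cast (Fact.out : p.Prime).ne_zero
  have : l * (u : ZMod p) = ((l.val * u : ℤ) : ZMod p) := by simp
  rw [this, ZMod.stdAddChar_coe, digitPhase]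
  congr 1
  push_cast
  rw [pow_succ]
  field_simp

/-- The register whose `k`-th qudit vanishes for all `k` exactly when the sum of the inputs is
`t`. -/
noncomputable def cmpOp (p : ℕ) [Fact p.Prime] (n t : ℕ) : Op p (Fin n ⊕ Fin (digits p n)) :=
  ctrlLocals fun x k => (four p)ᴴ *
    diagonal (digitPhase p k (((∑ i, (x i).val : ℕ) : ℤ) - t)) * four p

/-- For `s ≠ t` most qudits of the register may end in superposition, but one of them is in a known
nonzero basis state, and that is enough. -/
lemma cmpOp_ne_zero {n t : ℕ} (ht : t < n * p + 1) {z x : Fin n ⊕ Fin (digits p n) → ZMod p}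
    (h0 : x ∘ Sum.inr = 0) (h : cmpOp p n t z x ≠ 0) :
    z ∘ Sum.inl = x ∘ Sum.inl ∧
      (z ∘ Sum.inr = 0 ↔ ∑ i, (x (Sum.inl i)).val = t) := by
  obtain ⟨h1, h2⟩ := ctrlLocals_ne_zero h
  have h0' : ∀ k, x (Sum.inr k) = 0 := fun k => congrFun h0 k
  simp only [h0', Function.comp_apply] at h2
  refine ⟨h1, ?_⟩
  set s := ∑ i, (x (Sum.inl i)).val with hs
  have hslt : s < n * p + 1 := sum_val_lt (x ∘ Sum.inl)
  constructor
  · intro hz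
    by_contra hst
    have hm : ((s : ℤ) - t) ≠ 0 := fun h => hst (by omega)
    -- Write `s - t = p ^ v * u` with `p` not dividing `u`. The qudit number `v` then carries
    -- exactly `u` modulo `p`.
    obtain ⟨u, hu⟩ := padicValInt_dvd (p := p) ((s : ℤ) - t)
    set v := padicValInt p ((s : ℤ) - t)
    have hpu : ¬ (p : ℤ) ∣ u := by
      rintro ⟨w, rfl⟩
      have : (p : ℤ) ^ (v + 1) ∣ (s : ℤ) - t := ⟨w, by rw [hu]; ring⟩
      rw [padicValInt_dvd_iff] at this
      rcases this with h | h
      · exact hm h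
      · omega
    -- Both `s` and `t` lie between 0 and `n * p`, so a nonzero difference is not divisible by `p ^
    -- digits p n`, which is larger.
    have hv : v < digits p n := by
      by_contra! hv
      have h3 : (p : ℤ) ^ digits p n ∣ (s : ℤ) - t := (pow_dvd_pow _ hv).trans ⟨u, hu⟩
      have h4 : (n * p + 1 : ℤ) < (p : ℤ) ^ digits p n := by exact_mod_cast lt_pow_digits n
      refine hm (Int.eq_zero_of_abs_lt_dvd h3 ?_)
      rw [abs_lt]
      constructor <;> linarith [show (s : ℤ) < n * p + 1 by exact_mod_cast hslt,
        show (t : ℤ) < n * p + 1 by exact_mod_cast ht]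
    have h5 := h2 ⟨v, hv⟩
    rw [hu] at h5
    have h6 : digitPhase p v ((p : ℤ) ^ v * u) = fun l => stdAddChar (l * (u : ZMod p)) :=
      funext fun l => digitPhase_pow_mul v u l
    rw [h6, four_conj_char, shift] at h5
    have h7 : z (Sum.inr ⟨v, hv⟩) = 0 := congrFun hz _
    rw [h7, zero_add] at h5
    refine h5 (if_neg fun h8 => hpu ?_)
    exact (ZMod.intCast_zmod_eq_zero_iff_dvd u p).mp h8.symm
  · intro hst
    funext k
    have h3 := h2 k
    rw [hst, sub_self] at h3
    have h4 : digitPhase p k 0 = fun l => stdAddChar (l * 0) := by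
      funext l
      rw [digitPhase_zero, mul_zero, AddChar.map_zero_eq_one]
    rw [h4, four_conj_char, shift, add_zero] at h3
    by_contra h5
    exact h3 (if_neg h5)

lemma polyLE_digits : PolyLE (fun j : ℕ × ℕ => j.1) fun j => digits p j.1 :=
    ((((PolyLE.of_le fun _ => le_rfl).mul (PolyLE.const p)).add (PolyLE.const 1)).add
      (PolyLE.const 1)).mono fun j => digits_le j.1

/-- Each digit phase is additive in `s - t`: it splits into one controlled phase per input and a
one-qudit phase for `-t`. Fan-out is used twice, over the inputs and over the digits. -/
lemma feas_cmpOp (hcopy : Feas K (fun n : ℕ => n) fun n => copyOp p (Fin n)) :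
    Feas K (J := ℕ × ℕ) (fun j => j.1) (ι := fun j => Fin j.1 ⊕ Fin (digits p j.1))
      fun j => cmpOp p j.1 j.2 := by
  have hdig : PolyLE (fun j : ℕ × ℕ => j.1) fun j => digits p j.1 := polyLE_digits
  have hcard : PolyLE (fun j : ℕ × ℕ => j.1)
      fun j => Fintype.card (Fin j.1 ⊕ Fin (digits p j.1)) :=
    ((PolyLE.of_le fun _ => le_rfl).add hdig).mono fun j => by simp
  have hcard' : PolyLE (fun j : Σ j : ℕ × ℕ, Fin (digits p j.1) => j.1.1)
      fun j => Fintype.card (Fin j.1.1 ⊕ Fin (digits p j.1.1)) := by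
    obtain ⟨P, hP⟩ := hcard
    exact ⟨P, fun j => hP j.1⟩
  refine Feas.ctrlLocals (ι := fun j : ℕ × ℕ => Fin j.1) (β := fun j => Fin (digits p j.1))
    (φ := fun j x k => digitPhase p k (((∑ i, (x i).val : ℕ) : ℤ) - j.2)) ?_ four_unitary
    (by simpa using hdig)
  refine Feas.diag_prod hcopy (B := fun j : ℕ × ℕ => Fin (digits p j.1))
    (φ := fun j k z => digitPhase p k (((∑ i, (z (Sum.inl i)).val : ℕ) : ℤ) - j.2)
      (z (Sum.inr k))) ?_ (by simpa using hdig) hcard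
  have h0 := Feas.ctrl_phase (K := K) (J := Σ j : (Σ j : ℕ × ℕ, Fin (digits p j.1)), Fin j.1.1)
    (sz := fun j => j.1.1.1) (ι := fun j => Fin j.1.1.1 ⊕ Fin (digits p j.1.1.1))
    (v := fun j => digitPhase p j.1.2 1)
    (fun _ _ => norm_digitPhase _ _ _) (fun j => Sum.inl j.2)
    (fun j => Sum.inr j.1.2) (fun _ => by simp)
  have h1 := Feas.diag_prod hcopy (J := Σ j : ℕ × ℕ, Fin (digits p j.1)) (sz := fun j => j.1.1)
    (ι := fun j => Fin j.1.1 ⊕ Fin (digits p j.1.1)) (B := fun j => Fin j.1.1)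
    (φ := fun j i z => digitPhase p j.2 1 (z (Sum.inr j.2)) ^ (z (Sum.inl i)).val)
    h0 (PolyLE.of_le fun j => by simp) hcard'
  have h2 := Feas.phase (K := K) (J := Σ j : ℕ × ℕ, Fin (digits p j.1)) (sz := fun j => j.1.1)
    (ι := fun j => Fin j.1.1 ⊕ Fin (digits p j.1.1))
    (v := fun j => digitPhase p j.2 (-(j.1.2 : ℤ)))
    (fun _ _ => norm_digitPhase _ _ _) (fun j => Sum.inr j.2)
  refine (Feas.diag_mul h1 h2).congr fun j => ?_
  congr 1
  funext z
  simp only [digitPhase_pow]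
  rw [digitPhase_sum, ← digitPhase_add, sub_eq_add_neg]


lemma two_mul_sum_val : 2 * ∑ c : ZMod p, c.val = p * (p - 1) := by
  have h : ∑ c : ZMod p, c.val = ∑ i ∈ Finset.range p, i := by
    obtain ⟨q, rfl⟩ := Nat.exists_eq_succ_of_ne_zero (Fact.out : p.Prime).ne_zero
    exact Fin.sum_univ_eq_sum_range (fun i => i) (q + 1)
  rw [h, mul_comm, Finset.sum_range_id_mul_two]

/-- The linear forms over `ZMod p` take all values equally often at a nonzero point. -/
lemma two_mul_sum_linear {κ : Type} [Fintype κ] [DecidableEq κ] (z : κ → ZMod p) :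
    2 * ∑ a : κ → ZMod p, (∑ k, a k * z k).val =
      if z = 0 then 0 else p ^ Fintype.card κ * (p - 1) := by
  split_ifs with h
  · simp [h]
  · obtain ⟨k, hk⟩ : ∃ k, z k ≠ 0 := by
      by_contra! h'
      exact h (funext h')
    have hp : 0 < p := (Fact.out : p.Prime).pos
    -- Multiplying by `p` allows averaging over all translates `c` of the value of the linear form.
    refine Nat.eq_of_mul_eq_mul_left hp ?_
    have key : ∀ c : ZMod p, ∑ a : κ → ZMod p, (∑ k, a k * z k).val =
        ∑ a : κ → ZMod p, ((∑ k, a k * z k) + c).val := by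
      intro c
      -- Changing the coefficient at a coordinate with `z k ≠ 0` by `c / z k` adds `c` to the value.
      rw [← Equiv.sum_comp (Equiv.addRight (Pi.single k (c / z k) : κ → ZMod p))]
      refine Finset.sum_congr rfl fun a _ => ?_
      congr 1
      simp only [Equiv.coe_addRight, Pi.add_apply, add_mul, Finset.sum_add_distrib]
      congr 1
      rw [Finset.sum_eq_single k]
      · simp [hk]
      · intro b _ hb
        simp [hb]
      · simp
    have h1 : p * ∑ a : κ → ZMod p, (∑ k, a k * z k).val =
        ∑ a : κ → ZMod p, ∑ c : ZMod p, c.val := by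
      calc p * ∑ a : κ → ZMod p, (∑ k, a k * z k).val
          = ∑ c : ZMod p, ∑ a : κ → ZMod p, (∑ k, a k * z k).val := by simp [ZMod.card]
        _ = ∑ c : ZMod p, ∑ a : κ → ZMod p, ((∑ k, a k * z k) + c).val :=
            Finset.sum_congr rfl fun c _ => key c
        _ = _ := by
          rw [Finset.sum_comm]
          refine Finset.sum_congr rfl fun a _ => ?_
          exact Equiv.sum_comp (Equiv.addLeft (∑ k, a k * z k)) fun c : ZMod p => c.val
    rw [mul_left_comm, h1, Finset.sum_const, Finset.card_univ, Fintype.card_fun, ZMod.card,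
      smul_eq_mul, mul_left_comm, two_mul_sum_val]
    ring

end Equality

/-! ### Threshold gates from fan-out. -/

section Threshold

variable {p : ℕ} [Fact p.Prime] {K : Fanin}

open ZMod (stdAddChar)

/-- The operator that adds the linear form with coefficients `a` to the last qudit. -/
noncomputable def linOp (p : ℕ) [Fact p.Prime] {κ : Type} [Fintype κ] [DecidableEq κ]
    (a : κ → ZMod p) : Op p ((Unit ⊕ κ) ⊕ Unit) :=
  ctrlLocals fun w _ => shift (∑ k, a k * w (Sum.inr k))

lemma feas_linOp (hcopy : Feas K (fun n : ℕ => n) fun n => copyOp p (Fin n))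
    {J : Type*} {sz : J → ℕ} {κ : J → Type} [∀ j, Fintype (κ j)] [∀ j, DecidableEq (κ j)]
    (hκ : PolyLE sz fun j => Fintype.card (κ j)) (a : ∀ j, κ j → ZMod p) :
    Feas K sz fun j => linOp p (a j) := by
  have h0 := Feas.ctrl_phase (K := K) (J := Σ j, κ j)
    (sz := fun j => sz j.1) (ι := fun j => (Unit ⊕ κ j.1) ⊕ Unit)
    (v := fun j l => stdAddChar (l * a j.1 j.2))
    (fun _ _ => norm_stdAddChar _) (fun j => Sum.inl (Sum.inr j.2))
    (fun j => Sum.inr ()) (fun _ => by simp)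
  have h1 := Feas.diag_prod hcopy (J := J) (sz := sz)
    (ι := fun j => (Unit ⊕ κ j) ⊕ Unit) (B := κ)
    (φ := fun j k z => stdAddChar (z (Sum.inr ()) * a j k) ^ (z (Sum.inl (Sum.inr k))).val)
    h0 hκ (((PolyLE.const 2).add hκ).mono fun j => by simp)
  have h2 := Feas.ctrlLocals (K := K) (ι := fun j => Unit ⊕ κ j) (β := fun _ => Unit) (sz := sz)
    (φ := fun j w _ l => stdAddChar (l * ∑ k, a j k * w (Sum.inr k))) (h1.congr fun j => ?_)
    four_unitary (PolyLE.const _)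
  · refine h2.congr fun j => ?_
    simp only [four_conj_char]
    rfl
  · congr 1
    funext z
    simp only [stdAddChar_mul_pow, Fintype.prod_unique, Finset.mul_sum, stdAddChar_sum, mul_assoc]
    rfl

/-- The phase `exp (2 π i (2 l) / (p M))`. -/
noncomputable def finePhase (p : ℕ) (M : ℕ) (l : ZMod p) : ℂ :=
  Complex.exp (((2 * Real.pi * l.val * 2 / (p * M) : ℝ) : ℂ) * Complex.I)

lemma norm_finePhase (M : ℕ) (l : ZMod p) : ‖finePhase p M l‖ = 1 :=
  Complex.norm_exp_ofReal_mul_I _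

/-- The factor 2 in `finePhase` matches `two_mul_sum_linear` and avoids halving `M`. -/
lemma finePhase_pow {M s : ℕ} (hM : M ≠ 0) (h : 2 * s = M) (l : ZMod p) :
    finePhase p M l ^ s = stdAddChar l := by
  have hp : (p : ℂ) ≠ 0 := by exact_mod_cast (Fact.out : p.Prime).ne_zero
  have hM' : (M : ℂ) ≠ 0 := by exact_mod_cast hM
  have h' : (2 : ℂ) * s = M := by exact_mod_cast h
  have : l = ((l.val : ℤ) : ZMod p) := by simp
  conv_rhs => rw [this]
  rw [ZMod.stdAddChar_coe, finePhase, ← Complex.exp_nat_mul]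
  congr 1
  push_cast
  field_simp
  linear_combination (l.val : ℂ) * h'

/-- An exact disjunction of the register: every linear form contributes a tiny phase proportional to
its value in `{0, …, p - 1}`. By `two_mul_sum_linear` the total is trivial at zero and the same full
phase at every nonzero point. There are `p ^ digits p n` forms, polynomially many in `n`. -/
lemma feas_neqZero (hcopy : Feas K (fun n : ℕ => n) fun n => copyOp p (Fin n)) :
    Feas K (J := ℕ × ZMod p) (fun j => j.1) (ι := fun j => Unit ⊕ Fin (digits p j.1)) fun j =>
      diagonal fun z : Unit ⊕ Fin (digits p j.1) → ZMod p =>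
        stdAddChar (j.2 * z (Sum.inl ()) * if z ∘ Sum.inr = 0 then 0 else 1) := by
  have hdig : PolyLE (fun j : ℕ × ZMod p => j.1) fun j => Fintype.card (Fin (digits p j.1)) := by
    simp only [Fintype.card_fin]
    exact (((PolyLE.refl.mul (PolyLE.const p)).add (PolyLE.const 1)).add
      (PolyLE.const 1)).mono fun j => digits_le j.1
  have hpow : PolyLE (fun j : ℕ × ZMod p => j.1)
      fun j => Fintype.card (Fin (digits p j.1) → ZMod p) := by
    simp only [Fintype.card_fun, Fintype.card_fin, ZMod.card]
    exact (((PolyLE.refl.mul (PolyLE.const p)).add (PolyLE.const 1)).mul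
      (PolyLE.const p)).mono fun j => pow_digits_le j.1
  have hA := feas_linOp hcopy (J := Σ j : ℕ × ZMod p, Fin (digits p j.1) → ZMod p)
    (sz := fun j => j.1.1) (κ := fun j => Fin (digits p j.1.1)) hdig.sigma fun j => j.2
  have hψ := Feas.ctrl_phase (K := K) (J := Σ j : ℕ × ZMod p, Fin (digits p j.1) → ZMod p)
    (sz := fun j => j.1.1) (ι := fun j => (Unit ⊕ Fin (digits p j.1.1)) ⊕ Unit)
    (v := fun j l => finePhase p (p ^ digits p j.1.1 * (p - 1)) (j.1.2 * l))
    (fun _ _ => norm_finePhase _ _) (fun j => Sum.inr ()) (fun j => Sum.inl (Sum.inl ()))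
    (fun _ => by simp)
  have h1 := Feas.diag_conj (J := Σ j : ℕ × ZMod p, Fin (digits p j.1) → ZMod p)
    (sz := fun j => j.1.1) (ι := fun j => Unit ⊕ Fin (digits p j.1.1)) (β := fun _ => Unit)
    (φ := fun j z => finePhase p (p ^ digits p j.1.1 * (p - 1)) (j.1.2 * z (Sum.inl ())) ^
      (∑ k, j.2 k * z (Sum.inr k)).val) hA hψ (PolyLE.const _) ?_
  · have h2 := Feas.diag_prod hcopy (J := ℕ × ZMod p) (sz := fun j => j.1)
      (ι := fun j => Unit ⊕ Fin (digits p j.1)) (B := fun j => Fin (digits p j.1) → ZMod p)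
      (φ := fun j a z => finePhase p (p ^ digits p j.1 * (p - 1)) (j.2 * z (Sum.inl ())) ^
        (∑ k, a k * z (Sum.inr k)).val) h1 hpow
      (((PolyLE.const 1).add hdig).mono fun j => by simp)
    refine h2.congr fun j => ?_
    congr 1
    funext z
    -- The common base turns the product over all linear forms into a power whose exponent is the
    -- sum of their values.
    rw [Finset.prod_pow_eq_pow_sum]
    have h3 := two_mul_sum_linear (z ∘ Sum.inr)
    simp only [Function.comp_apply, Fintype.card_fin] at h3
    split_ifs at h3 ⊢ with h4
    · have : ∑ a : Fin (digits p j.1) → ZMod p, (∑ k, a k * z (Sum.inr k)).val = 0 := by omega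
      rw [this]; simp
    · rw [finePhase_pow _ h3, mul_one]
      have := (Fact.out : p.Prime).two_le
      exact Nat.mul_ne_zero (pow_ne_zero _ (by omega)) (by omega)
  · intro j z x h
    obtain ⟨h2, h3⟩ := ctrlLocals_ne_zero h
    have h4 := h3 ()
    simp only [Sum.elim_comp_inl, Sum.elim_inr, Pi.zero_apply, shift, zero_add] at h4
    have h5 : z (Sum.inr ()) = ∑ k, j.2 k * x (Sum.inr k) := by
      by_contra h6
      exact h4 (if_neg h6)
    have h6 : z (Sum.inl (Sum.inl ())) = x (Sum.inl ()) := congrFun h2 _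
    simp only [h5, h6]

lemma feas_neqSum (hcopy : Feas K (fun n : ℕ => n) fun n => copyOp p (Fin n)) :
    Feas K (J := Σ j : ℕ × ZMod p, Fin (j.1 * p + 1)) (fun j => j.1.1)
      (ι := fun j => Unit ⊕ Fin j.1.1) fun j =>
      diagonal fun z : Unit ⊕ Fin j.1.1 → ZMod p => stdAddChar
        (j.1.2 * z (Sum.inl ()) * if ∑ i, (z (Sum.inr i)).val = j.2 then 0 else 1) := by
  have hdig : PolyLE (fun j : ℕ × ZMod p => j.1) fun j => Fintype.card (Fin (digits p j.1)) := by
    simp only [Fintype.card_fin]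
    exact (((PolyLE.refl.mul (PolyLE.const p)).add (PolyLE.const 1)).add
      (PolyLE.const 1)).mono fun j => digits_le j.1
  have hA := ((feas_cmpOp hcopy).comap (J' := Σ j : ℕ × ZMod p, Fin (j.1 * p + 1))
    (sz' := fun j => j.1.1) (fun j => (j.1.1, j.2.val)) PolyLE.refl).lift
    (κ := fun j => (Unit ⊕ Fin j.1.1) ⊕ Fin (digits p j.1.1))
    fun j => Function.Embedding.inr.sumMap (Function.Embedding.refl _)
  have hψ := ((feas_neqZero hcopy).comap (J' := Σ j : ℕ × ZMod p, Fin (j.1 * p + 1))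
    (sz' := fun j => j.1.1) (fun j => j.1) PolyLE.refl).diag_lift
    (κ := fun j => (Unit ⊕ Fin j.1.1) ⊕ Fin (digits p j.1.1))
    fun j => Function.Embedding.inl.sumMap (Function.Embedding.refl _)
  refine Feas.diag_conj (β := fun j => Fin (digits p j.1.1)) hA hψ hdig.sigma ?_
  intro j z x h
  obtain ⟨h1, h2⟩ := lift_ne_zero h
  obtain ⟨h3, h4⟩ := cmpOp_ne_zero (x := _ ∘ _) j.2.2 (by funext k; simp) h2
  have h5 : z (Sum.inl (Sum.inl ())) = x (Sum.inl ()) := h1 _ (by simp)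
  have h6 : (z ∘ ((Function.Embedding.inl : Unit ↪ Unit ⊕ Fin j.1.1).sumMap
      (Function.Embedding.refl (Fin (digits p j.1.1))))) (Sum.inl ()) = x (Sum.inl ()) := h5
  simp only [h6]
  congr 2
  refine if_congr ?_ rfl rfl
  exact h4

/-- The threshold is the sum over `t ≥ k` of the indicators of `s = t`. Each indicator is one minus
the available indicator of `s ≠ t`, hence the coefficient `-1` in `h1` and the compensating phase in
`h2`. -/
lemma feas_threshold_diag (hcopy : Feas K (fun n : ℕ => n) fun n => copyOp p (Fin n)) :
    Feas K (J := ℕ × ℕ) (fun j => j.1) (ι := fun j => Unit ⊕ Fin j.1) fun j =>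
      diagonal fun z : Unit ⊕ Fin j.1 → ZMod p =>
        stdAddChar (z (Sum.inl ()) * thr j.2 Finset.univ (z ∘ Sum.inr)) := by
  have h1 := (feas_neqSum hcopy).comap (J' := Σ j : ℕ × ℕ, Fin (j.1 * p + 1))
    (sz' := fun j => j.1.1)
    (fun j => ⟨(j.1.1, if j.1.2 ≤ j.2.val then -1 else 0), j.2⟩) PolyLE.refl
  have h2 := Feas.phase (K := K) (J := Σ j : ℕ × ℕ, Fin (j.1 * p + 1)) (sz := fun j => j.1.1)
    (ι := fun j => Unit ⊕ Fin j.1.1)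
    (v := fun j (l : ZMod p) => stdAddChar ((if j.1.2 ≤ j.2.val then (1 : ZMod p) else 0) * l))
    (fun _ _ => norm_stdAddChar _) (fun j => Sum.inl ())
  have h3 := Feas.diag_prod hcopy (J := ℕ × ℕ) (sz := fun j => j.1)
    (ι := fun j => Unit ⊕ Fin j.1) (B := fun j => Fin (j.1 * p + 1))
    (φ := fun j t z => stdAddChar ((if j.2 ≤ t.val then -1 else 0) * z (Sum.inl ()) *
        if ∑ i, (z (Sum.inr i)).val = t then 0 else 1) *
      stdAddChar ((if j.2 ≤ t.val then 1 else 0) * z (Sum.inl ()))) (Feas.diag_mul h1 h2)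
    (((PolyLE.refl.mul (PolyLE.const p)).add (PolyLE.const 1)).mono fun j => by simp)
    (((PolyLE.const 1).add PolyLE.refl).mono fun j => by simp)
  refine h3.congr fun j => ?_
  congr 1
  funext z
  simp only [← AddChar.map_add_eq_mul]
  rw [← stdAddChar_sum]
  congr 1
  have hs : ∑ i, (z (Sum.inr i)).val < j.1 * p + 1 := sum_val_lt (z ∘ Sum.inr)
  rw [Finset.sum_eq_single ⟨∑ i, (z (Sum.inr i)).val, hs⟩]
  · simp only [if_true, mul_zero, zero_add, thr, Function.comp_apply]
    rw [mul_comm]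
  · intro t _ ht
    have : ¬ ∑ i, (z (Sum.inr i)).val = t := fun h => ht (Fin.ext h.symm)
    rw [if_neg this]
    split_ifs <;> ring
  · simp

/-- Fan-out makes all threshold gates feasible. -/
lemma feas_thOp (hcopy : Feas K (fun n : ℕ => n) fun n => copyOp p (Fin n)) :
    Feas K (J := ℕ × ℕ) (fun j => j.1) (ι := fun j => Fin j.1 ⊕ Unit)
      fun j => thOp p j.1 j.2 :=
  feas_thOp_of_diag (feas_threshold_diag hcopy)

lemma feas_thOp_mod : Feas Fanin.mod (J := ℕ × ℕ) (fun j => j.1) (ι := fun j => Fin j.1 ⊕ Unit)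
    fun j => thOp p j.1 j.2 :=
  feas_thOp (feas_copyOp_of_starOp (feas_starOp_of_modOp
    (Feas.of_gate fun n => isGate_modOp n)))

end Threshold

/-! ### Exact amplitude amplification. -/

section Amplification

variable {d : ℕ} [NeZero d] {ι : Type} [Fintype ι] [DecidableEq ι]

/-- The reflection that fixes the all-zero basis state and negates all others. -/
noncomputable def zeroReflection (d : ℕ) [NeZero d] (ι : Type) [Fintype ι] [DecidableEq ι] :
    Op d ι :=
  diagonal fun x => if x = 0 then 1 else -1

/-- Conjugation carries the reflection about the zero state to the reflection about its image, the
column `A.col 0`. -/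
lemma zeroReflection_conj_mulVec {A : Op d ι} (hA : Aᴴ * A = 1) (w : (ι → ZMod d) → ℂ) :
    (A * zeroReflection d ι * Aᴴ) *ᵥ w = (2 * ∑ z, star (A z 0) * w z) • A.col 0 - w := by
  have h1 : ∀ u : (ι → ZMod d) → ℂ,
      zeroReflection d ι *ᵥ u = (2 * u 0) • Pi.single 0 1 - u := by
    intro u
    funext z
    rw [zeroReflection, mulVec_diagonal]
    by_cases hz : z = 0
    · subst hz; simp; ring
    · simp [hz]
  have h2 : (Aᴴ *ᵥ w) 0 = ∑ z, star (A z 0) * w z := rfl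
  rw [← mulVec_mulVec, ← mulVec_mulVec, h1, mulVec_sub, mulVec_smul, mulVec_single_one,
    mulVec_mulVec, mul_eq_one_comm.mp hA, one_mulVec, h2]

/-- One round of amplitude amplification. -/
noncomputable def boost (A S : Op d ι) : Op d ι := A * zeroReflection d ι * Aᴴ * S * A

lemma star_mul_self_eq (z : ℂ) : star z * z = ((‖z‖ ^ 2 : ℝ) : ℂ) := by
  rw [RCLike.star_def, Complex.conj_mul', Complex.ofReal_pow]

lemma sum_norm_sq_col {A : Op d ι} (hA : Aᴴ * A = 1) : ∑ z, ‖A z 0‖ ^ 2 = 1 := by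
  have h : (Aᴴ * A) 0 0 = 1 := by rw [hA]; simp
  rw [Matrix.mul_apply] at h
  simp only [conjTranspose_apply, star_mul_self_eq] at h
  exact_mod_cast h

/-- With good mass `s`, the inner product of the prepared state and its image under the oracle is `2
* s - 1`. Reflecting therefore rescales good amplitudes by `4 * s - 3` and bad ones by `4 * s - 1`,
keeping relative weights inside each class. -/
lemma boost_col {A : Op d ι} (hA : Aᴴ * A = 1) (g : (ι → ZMod d) → Prop) [DecidablePred g]
    (z : ι → ZMod d) :
    boost A (diagonal fun x => if g x then 1 else -1) z 0 =
      if g z then ((4 * (∑ z, if g z then ‖A z 0‖ ^ 2 else 0) - 3 : ℝ) : ℂ) * A z 0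
      else ((4 * (∑ z, if g z then ‖A z 0‖ ^ 2 else 0) - 1 : ℝ) : ℂ) * A z 0 := by
  set s := ∑ z, if g z then ‖A z 0‖ ^ 2 else 0 with hs
  have h1 : ∀ M : Op d ι, M z 0 = (M *ᵥ Pi.single 0 1) z := by
    intro M; rw [mulVec_single_one]; rfl
  have h2 : ∑ z, star (A z 0) * (((diagonal fun x => if g x then (1 : ℂ) else -1) : Op d ι) *ᵥ
      A.col 0) z = ((2 * s - 1 : ℝ) : ℂ) := by
    have : ∀ z, star (A z 0) * (((diagonal fun x => if g x then (1 : ℂ) else -1) : Op d ι) *ᵥ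
        A.col 0) z = ((2 * (if g z then ‖A z 0‖ ^ 2 else 0) - ‖A z 0‖ ^ 2 : ℝ) : ℂ) := by
      intro z
      rw [mulVec_diagonal, Matrix.col_apply, mul_left_comm, star_mul_self_eq]
      split_ifs
      · push_cast; ring
      · push_cast; ring
    simp only [this]
    rw [← Complex.ofReal_sum, Finset.sum_sub_distrib, ← Finset.mul_sum, sum_norm_sq_col hA]
  rw [h1 (boost A _), boost, ← mulVec_mulVec, ← mulVec_mulVec, mulVec_single_one,
    zeroReflection_conj_mulVec hA, h2]
  simp only [Pi.sub_apply, Pi.smul_apply, smul_eq_mul, mulVec_diagonal, Matrix.col_apply]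
  split_ifs
  · push_cast; ring
  · push_cast; ring

/-- Two rounds of amplification are exact if the initial amplitude is `sin (π / 18)`. -/
lemma boost_boost_col {A S : Op d ι} (hA : Aᴴ * A = 1) (g : (ι → ZMod d) → Prop)
    [DecidablePred g] (hS : S = diagonal fun x => if g x then 1 else -1)
    (hs : ∑ z, (if g z then ‖A z 0‖ ^ 2 else 0) = Real.sin (Real.pi / 18) ^ 2) :
    ∃ c : ℂ, ‖c‖ ^ 2 * Real.sin (Real.pi / 18) ^ 2 = 1 ∧
      ∀ z, boost (boost A S) S z 0 = if g z then c * A z 0 else 0 := by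
  set t := Real.sin (Real.pi / 18) with ht
  -- The triple-angle formula at `π / 18`. Good mass `1 / 4` after the first round makes the bad
  -- factor `4 * (1 / 4) - 1` of the second round vanish.
  have h3 : t ^ 2 * (4 * t ^ 2 - 3) ^ 2 = 1 / 4 := by
    have h := Real.sin_three_mul (Real.pi / 18)
    rw [show 3 * (Real.pi / 18) = Real.pi / 6 by ring, Real.sin_pi_div_six, ← ht] at h
    have : t ^ 2 * (4 * t ^ 2 - 3) ^ 2 = (3 * t - 4 * t ^ 3) ^ 2 := by ring
    rw [this, ← h]
    norm_num
  have hS' : Sᴴ * S = 1 := by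
    rw [hS, diagonal_conjTranspose, diagonal_mul_diagonal, ← diagonal_one]
    congr 1
    funext z
    by_cases hz : g z <;> simp [hz]
  have hR : (zeroReflection d ι)ᴴ * zeroReflection d ι = 1 := by
    rw [zeroReflection, diagonal_conjTranspose, diagonal_mul_diagonal, ← diagonal_one]
    congr 1
    funext z
    by_cases hz : z = 0 <;> simp [hz]
  have hAH : Aᴴᴴ * Aᴴ = 1 := by rw [conjTranspose_conjTranspose]; exact mul_eq_one_comm.mp hA
  have hB : (boost A S)ᴴ * boost A S = 1 :=
    unitary_mul (unitary_mul (unitary_mul (unitary_mul hA hR) hAH) hS') hA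
  have hb : ∀ z, boost A S z 0 = if g z then ((4 * t ^ 2 - 3 : ℝ) : ℂ) * A z 0
      else ((4 * t ^ 2 - 1 : ℝ) : ℂ) * A z 0 := by
    intro z
    rw [hS, boost_col hA g z, hs]
  have hmass : ∑ z, (if g z then ‖boost A S z 0‖ ^ 2 else 0) = 1 / 4 := by
    rw [← h3, ← hs, Finset.sum_mul]
    refine Finset.sum_congr rfl fun z _ => ?_
    rw [hb]
    split_ifs
    · rw [norm_mul, mul_pow, Complex.norm_real, Real.norm_eq_abs, sq_abs, hs, mul_comm]
    · ring
  refine ⟨((-2 * (4 * t ^ 2 - 3) : ℝ) : ℂ), ?_, fun z => ?_⟩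
  · rw [Complex.norm_real, Real.norm_eq_abs, sq_abs]
    linear_combination 4 * h3
  · have := boost_col hB g z
    rw [hmass, ← hS] at this
    rw [this, hb]
    split_ifs
    · push_cast; ring
    · norm_num

end Amplification

/-! ### Qudits restricted to the values 0 and 1. -/

section Bits

variable {p : ℕ} [Fact p.Prime]

/-- The real reflection of one qudit that maps `|0⟩` to `a |0⟩ + b |1⟩`. -/
noncomputable def bitReflection (p : ℕ) (a b : ℝ) : Matrix (ZMod p) (ZMod p) ℂ :=
  fun l m => if l = 0 then (if m = 0 then (a : ℂ) else if m = 1 then (b : ℂ) else 0)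
    else if l = 1 then (if m = 0 then (b : ℂ) else if m = 1 then -(a : ℂ) else 0)
    else if l = m then 1 else 0

lemma bitReflection_mulVec (a b : ℝ) (ψ : ZMod p → ℂ) (l : ZMod p) :
    (bitReflection p a b *ᵥ ψ) l =
      if l = 0 then a * ψ 0 + b * ψ 1 else if l = 1 then b * ψ 0 - a * ψ 1 else ψ l := by
  have key : ∀ (c e : ℂ), ∑ m, (if m = 0 then c else if m = 1 then e else 0) * ψ m =
      c * ψ 0 + e * ψ 1 := by
    intro c e
    have : ∀ m : ZMod p, (if m = 0 then c else if m = 1 then e else 0) * ψ m =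
        (if m = 0 then c * ψ 0 else 0) + (if m = 1 then e * ψ 1 else 0) := by
      intro m
      by_cases h0 : m = 0
      · subst h0; simp
      · by_cases h1 : m = 1
        · subst h1; simp
        · simp [h0, h1]
    simp only [this, Finset.sum_add_distrib, Finset.sum_ite_eq', Finset.mem_univ, if_true]
  simp only [mulVec, dotProduct, bitReflection]
  split_ifs with h0 h1
  · exact key _ _
  · rw [key]; ring
  · simp

lemma bitReflection_conjTranspose (a b : ℝ) : (bitReflection p a b)ᴴ = bitReflection p a b := by
  ext l m
  rw [conjTranspose_apply, bitReflection, bitReflection]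
  by_cases l0 : l = 0 <;> by_cases m0 : m = 0 <;> by_cases l1 : l = 1 <;>
    by_cases m1 : m = 1 <;> simp_all [eq_comm]

lemma bitReflection_unitary {a b : ℝ} (h : a ^ 2 + b ^ 2 = 1) :
    (bitReflection p a b)ᴴ * bitReflection p a b = 1 := by
  rw [bitReflection_conjTranspose]
  ext l m
  have h' : (a : ℂ) ^ 2 + (b : ℂ) ^ 2 = 1 := by exact_mod_cast h
  have := bitReflection_mulVec a b ((bitReflection p a b) *ᵥ Pi.single m 1) l
  rw [mulVec_mulVec, mulVec_single_one, Matrix.col_apply] at this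
  rw [this, Matrix.one_apply, ← Pi.single_apply]
  simp only [bitReflection_mulVec, if_true, one_ne_zero, if_false]
  split_ifs with h0 h1
  · subst h0; linear_combination (Pi.single m (1 : ℂ) : ZMod p → ℂ) 0 * h'
  · subst h1; linear_combination (Pi.single m (1 : ℂ) : ZMod p → ℂ) 1 * h'
  · rfl

lemma val_one_prime : (1 : ZMod p).val = 1 := by
  have : Fact (1 < p) := ⟨(Fact.out : p.Prime).one_lt⟩
  exact ZMod.val_one p

/-- Only 0-1 strings contribute; they correspond to subsets, which are grouped by cardinality. -/
lemma sum_bits {n : ℕ} (f : ZMod p → ℂ) (hf : ∀ l, l ≠ 0 → l ≠ 1 → f l = 0) (g : ℕ → ℂ) :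
    ∑ x : Fin n → ZMod p, (∏ i, f (x i)) * g (∑ i, (x i).val) =
      ∑ k ∈ Finset.range (n + 1), (n.choose k : ℂ) * (f 1 ^ k * f 0 ^ (n - k) * g k) := by
  have h := Finset.sum_powerset_apply_card (fun k => f 1 ^ k * f 0 ^ (n - k) * g k)
    (x := (Finset.univ : Finset (Fin n)))
  simp only [Finset.card_univ, Fintype.card_fin, nsmul_eq_mul] at h
  rw [← h]
  let ind : Finset (Fin n) → (Fin n → ZMod p) := fun T i => if i ∈ T then 1 else 0
  have hinj : Function.Injective ind := by
    intro T T' hT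
    ext i
    have := congrFun hT i
    by_cases h1 : i ∈ T <;> by_cases h2 : i ∈ T' <;> simp_all [ind]
  rw [← Finset.sum_subset (Finset.subset_univ ((Finset.univ : Finset (Fin n)).powerset.image ind)),
    Finset.sum_image fun _ _ _ _ h => hinj h]
  · refine Finset.sum_congr rfl fun T _ => ?_
    congr 1
    · have : ∀ i, f (ind T i) = if i ∈ T then f 1 else f 0 := by
        intro i; by_cases hi : i ∈ T <;> simp [ind, hi]
      simp only [this]
      rw [Finset.prod_ite]
      simp only [Finset.prod_const]
      congr 2
      · congr 1; ext i; simp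
      · have := Finset.card_compl T
        rw [Fintype.card_fin] at this
        rw [← this]
        congr 1; ext i; simp
    · congr 1
      have : ∀ i, (ind T i).val = if i ∈ T then 1 else 0 := by
        intro i; by_cases hi : i ∈ T <;> simp [ind, hi, val_one_prime]
      simp [this]
  · intro x _ hx
    have : ∃ i, x i ≠ 0 ∧ x i ≠ 1 := by
      by_contra! h'
      refine hx (Finset.mem_image.mpr ⟨Finset.univ.filter fun i => x i ≠ 0, by simp, ?_⟩)
      funext i
      by_cases hi : x i = 0
      · simp [ind, hi]
      · simp [ind, h' i hi]
    obtain ⟨i, h0, h1⟩ := this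
    rw [Finset.prod_eq_zero (Finset.mem_univ i) (hf _ h0 h1), zero_mul]

end Bits

/-! ### One column of the grid, and the number of columns. -/

section Column

variable {p : ℕ} [Fact p.Prime]

/-- The state preparation whose output has a large amplitude at both constant bit strings, compared
with `colWeight`. -/
noncomputable def colPrep (p : ℕ) [Fact p.Prime] (m : ℕ) : Op p (Fin (2 * m + 1)) :=
  locals (fun _ => bitReflection p (Real.sqrt 2 / 2) (Real.sqrt 2 / 2)) *
    diagonal (fun x => if m + 1 ≤ ∑ i, (x i).val then Complex.I else 1) *
    locals (fun _ => bitReflection p (Real.sqrt 2 / 2) (-(Real.sqrt 2 / 2)))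

lemma colPrep_apply (m : ℕ) (l : ZMod p) :
    colPrep p m (fun _ => l) 0 = ∑ k ∈ Finset.range (2 * m + 1 + 1), ((2 * m + 1).choose k : ℂ) *
      ((bitReflection p (Real.sqrt 2 / 2) (Real.sqrt 2 / 2) l 1 *
          bitReflection p (Real.sqrt 2 / 2) (-(Real.sqrt 2 / 2)) 1 0) ^ k *
        (bitReflection p (Real.sqrt 2 / 2) (Real.sqrt 2 / 2) l 0 *
          bitReflection p (Real.sqrt 2 / 2) (-(Real.sqrt 2 / 2)) 0 0) ^ (2 * m + 1 - k) *
        if m + 1 ≤ k then Complex.I else 1) := by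
  rw [← sum_bits (p := p) (fun x => bitReflection p (Real.sqrt 2 / 2) (Real.sqrt 2 / 2) l x *
      bitReflection p (Real.sqrt 2 / 2) (-(Real.sqrt 2 / 2)) x 0) (by
        intro x h0 h1
        simp [bitReflection, h0, h1]) fun k => if m + 1 ≤ k then Complex.I else 1]
  rw [colPrep, Matrix.mul_apply]
  refine Finset.sum_congr rfl fun x _ => ?_
  rw [mul_diagonal, locals, locals, Finset.prod_mul_distrib]
  simp only [Pi.zero_apply]
  ring

lemma sqrt_two_half_sq : ((Real.sqrt 2 / 2 : ℝ) : ℂ) * ((Real.sqrt 2 / 2 : ℝ) : ℂ) = 1 / 2 := by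
  rw [← Complex.ofReal_mul, div_mul_div_comm, Real.mul_self_sqrt (by norm_num)]
  norm_num

lemma split_threshold (m k : ℕ) : (if m + 1 ≤ k then Complex.I else (1 : ℂ)) =
    Complex.I + (1 - Complex.I) * (if k < m + 1 then 1 else 0) := by
  by_cases h : m + 1 ≤ k
  · rw [if_pos h, if_neg (by omega)]; ring
  · rw [if_neg h, if_pos (by omega)]; ring

lemma sum_range_restrict (m : ℕ) (f : ℕ → ℂ) :
    ∑ k ∈ Finset.range (2 * m + 1 + 1), f k * (if k < m + 1 then 1 else 0) =
      ∑ k ∈ Finset.range (m + 1), f k := by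
  simp only [mul_ite, mul_one, mul_zero]
  rw [← Finset.sum_filter]
  congr 1
  ext k
  simp only [Finset.mem_filter, Finset.mem_range]
  omega

/-- The full alternating binomial sum vanishes and the one truncated at `m` is, up to sign, a
central binomial coefficient. The odd length `2 * m + 1` puts the majority threshold exactly
halfway. -/
lemma colPrep_zero (m : ℕ) : colPrep p m 0 0 =
    (1 - Complex.I) * ((-1) ^ m * (m.centralBinom : ℂ)) / 2 ^ (2 * m + 1) := by
  have h := colPrep_apply (p := p) m 0
  have h1 : bitReflection p (Real.sqrt 2 / 2) (Real.sqrt 2 / 2) 0 1 *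
      bitReflection p (Real.sqrt 2 / 2) (-(Real.sqrt 2 / 2)) 1 0 = -(1 / 2) := by
    simp only [bitReflection, if_true, one_ne_zero, if_false]
    rw [Complex.ofReal_neg, mul_neg, sqrt_two_half_sq]
  have h0 : bitReflection p (Real.sqrt 2 / 2) (Real.sqrt 2 / 2) 0 0 *
      bitReflection p (Real.sqrt 2 / 2) (-(Real.sqrt 2 / 2)) 0 0 = 1 / 2 := by
    simp only [bitReflection, if_true]
    exact sqrt_two_half_sq
  rw [h1, h0] at h
  have h2 : ∀ k ∈ Finset.range (2 * m + 1 + 1), ((2 * m + 1).choose k : ℂ) *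
      ((-(1 / 2)) ^ k * (1 / 2) ^ (2 * m + 1 - k) * if m + 1 ≤ k then Complex.I else 1) =
      (Complex.I * ((-1) ^ k * ((2 * m + 1).choose k : ℂ)) + (1 - Complex.I) *
        (((-1) ^ k * ((2 * m + 1).choose k : ℂ)) * if k < m + 1 then 1 else 0)) /
          2 ^ (2 * m + 1) := by
    intro k hk
    have hk' : k + (2 * m + 1 - k) = 2 * m + 1 := by
      have := Finset.mem_range.mp hk
      omega
    have : (-(1 / 2) : ℂ) ^ k * (1 / 2) ^ (2 * m + 1 - k) = (-1) ^ k / 2 ^ (2 * m + 1) := by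
      rw [neg_eq_neg_one_mul, mul_pow, mul_assoc, ← pow_add, hk', one_div, inv_pow]
      ring
    rw [this, split_threshold]
    ring
  rw [Finset.sum_congr rfl h2, ← Finset.sum_div, Finset.sum_add_distrib, ← Finset.mul_sum,
    ← Finset.mul_sum, sum_range_restrict] at h
  have h3 : ∑ k ∈ Finset.range (2 * m + 1 + 1), ((-1 : ℂ) ^ k * ((2 * m + 1).choose k : ℂ)) = 0 := by
    have := Int.alternating_sum_range_choose_of_ne (n := 2 * m + 1) (by omega)
    exact_mod_cast congrArg (Int.cast : ℤ → ℂ) this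
  have h4 : ∑ k ∈ Finset.range (m + 1), ((-1 : ℂ) ^ k * ((2 * m + 1).choose k : ℂ)) =
      (-1) ^ m * (m.centralBinom : ℂ) := by
    have := Int.alternating_sum_range_choose_eq_choose (n := 2 * m) (m := m)
    exact_mod_cast congrArg (Int.cast : ℤ → ℂ) this
  rw [h3, h4, mul_zero, zero_add] at h
  exact h

/-- At the all-one string the signs of the two basis changes cancel. The sums are then the full
binomial sum and exactly half of it, so the amplitude does not depend on `m`. -/
lemma colPrep_one (m : ℕ) : colPrep p m (fun _ => 1) 0 = (1 + Complex.I) / 2 := by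
  have h := colPrep_apply (p := p) m 1
  have h1 : bitReflection p (Real.sqrt 2 / 2) (Real.sqrt 2 / 2) 1 1 *
      bitReflection p (Real.sqrt 2 / 2) (-(Real.sqrt 2 / 2)) 1 0 = 1 / 2 := by
    simp only [bitReflection, if_true, one_ne_zero, if_false]
    rw [Complex.ofReal_neg, neg_mul_neg, sqrt_two_half_sq]
  have h0 : bitReflection p (Real.sqrt 2 / 2) (Real.sqrt 2 / 2) 1 0 *
      bitReflection p (Real.sqrt 2 / 2) (-(Real.sqrt 2 / 2)) 0 0 = 1 / 2 := by
    simp only [bitReflection, if_true, one_ne_zero, if_false]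
    exact sqrt_two_half_sq
  rw [h1, h0] at h
  have h2 : ∀ k ∈ Finset.range (2 * m + 1 + 1), ((2 * m + 1).choose k : ℂ) *
      ((1 / 2) ^ k * (1 / 2) ^ (2 * m + 1 - k) * if m + 1 ≤ k then Complex.I else 1) =
      (Complex.I * ((2 * m + 1).choose k : ℂ) + (1 - Complex.I) *
        (((2 * m + 1).choose k : ℂ) * if k < m + 1 then 1 else 0)) /
          2 ^ (2 * m + 1) := by
    intro k hk
    have hk' : k + (2 * m + 1 - k) = 2 * m + 1 := by
      have := Finset.mem_range.mp hk
      omega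
    rw [← pow_add, hk', split_threshold, one_div, inv_pow]
    ring
  rw [Finset.sum_congr rfl h2, ← Finset.sum_div, Finset.sum_add_distrib, ← Finset.mul_sum,
    ← Finset.mul_sum, sum_range_restrict] at h
  have h3 : ∑ k ∈ Finset.range (2 * m + 1 + 1), ((2 * m + 1).choose k : ℂ) = 2 ^ (2 * m + 1) := by
    exact_mod_cast Nat.sum_range_choose (2 * m + 1)
  have h4 : ∑ k ∈ Finset.range (m + 1), ((2 * m + 1).choose k : ℂ) = 4 ^ m := by
    exact_mod_cast Nat.sum_range_choose_halfway m
  have h5 : (2 : ℂ) ^ (2 * m + 1) = 2 * 4 ^ m := by rw [pow_succ, pow_mul]; norm_num; ring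
  have h6 : (4 : ℂ) ^ m ≠ 0 := pow_ne_zero _ (by norm_num)
  rw [h3, h4, h5] at h
  rw [h]
  field_simp
  ring

/-- The weight of the constant bit strings in the columns. -/
noncomputable def colWeight (m : ℕ) : ℝ := (m.centralBinom : ℝ) ^ 2 / (2 * 16 ^ m)

lemma colPrep_zero_norm (m : ℕ) : ‖colPrep p m 0 0‖ ^ 2 = colWeight m := by
  have h1 : ‖(1 - Complex.I : ℂ)‖ ^ 2 = 2 := by
    rw [← Complex.normSq_eq_norm_sq]; simp [Complex.normSq_apply]; norm_num
  have h2 : (16 : ℝ) ^ m = (4 ^ m) ^ 2 := by rw [← pow_mul, mul_comm, pow_mul]; norm_num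
  have h3 : (2 : ℝ) ^ (2 * m + 1) = 2 * 4 ^ m := by rw [pow_succ, pow_mul]; norm_num; ring
  rw [colPrep_zero, norm_div, norm_mul, norm_mul, norm_pow, norm_pow, norm_neg, norm_one, one_pow,
    one_mul, Complex.norm_natCast, Complex.norm_two, div_pow, mul_pow, h1, colWeight, h2, h3]
  have h6 : (4 : ℝ) ^ m ≠ 0 := pow_ne_zero _ (by norm_num)
  field_simp

lemma colPrep_one_norm (m : ℕ) : ‖colPrep p m (fun _ => 1) 0‖ ^ 2 = 1 / 2 := by
  rw [colPrep_one, ← Complex.normSq_eq_norm_sq]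
  simp [Complex.normSq_apply]
  norm_num

lemma prime_zero_ne_one_fun (m : ℕ) : (fun _ => 1 : Fin (2 * m + 1) → ZMod p) ≠ 0 := by
  intro h
  exact one_ne_zero (congrFun h 0)

/-- The operator preparing one column of the grid. -/
noncomputable def colOp (p : ℕ) [Fact p.Prime] (m : ℕ) : Op p (Fin (2 * m + 1)) :=
  colPrep p m * zeroReflection p (Fin (2 * m + 1)) * (colPrep p m)ᴴ

lemma sqrt_two_unit : (Real.sqrt 2 / 2) ^ 2 + (Real.sqrt 2 / 2) ^ 2 = 1 := by
  rw [div_pow, Real.sq_sqrt (by norm_num)]; norm_num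

lemma sqrt_two_unit' : (Real.sqrt 2 / 2) ^ 2 + (-(Real.sqrt 2 / 2)) ^ 2 = 1 := by
  rw [neg_sq]; exact sqrt_two_unit

/-- Whatever has a circuit is unitary; a one-member family suffices. -/
lemma locals_unitary {d : ℕ} [NeZero d] {ι : Type} [Fintype ι] [DecidableEq ι]
    {V : ι → Matrix (ZMod d) (ZMod d) ℂ} (hV : ∀ i, (V i)ᴴ * V i = 1) :
    (locals V)ᴴ * locals V = 1 :=
  (Feas.locals (K := Fanin.mod) (J := Unit) (sz := fun _ => Fintype.card ι) (ι := fun _ => ι)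
    (V := fun _ => V) (fun _ => hV) PolyLE.refl).unitary ()

lemma colPrep_unitary (m : ℕ) : (colPrep p m)ᴴ * colPrep p m = 1 := by
  refine unitary_mul (unitary_mul (locals_unitary fun _ => bitReflection_unitary sqrt_two_unit) ?_)
    (locals_unitary fun _ => bitReflection_unitary sqrt_two_unit')
  rw [diagonal_conjTranspose, diagonal_mul_diagonal, ← diagonal_one]
  congr 1
  funext z
  by_cases hz : m < ∑ i, (z i).val <;> simp [hz]

/-- The reflection about the state of `colPrep` keeps the zero string up to a small loss and moves a
little mass to every other string, including the all-one string. -/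
lemma colOp_apply (m : ℕ) (z : Fin (2 * m + 1) → ZMod p) : colOp p m z 0 =
    2 * star (colPrep p m 0 0) * colPrep p m z 0 - if z = 0 then 1 else 0 := by
  have h := congrFun (zeroReflection_conj_mulVec (colPrep_unitary (p := p) m) (Pi.single 0 1)) z
  rw [mulVec_single_one, Matrix.col_apply] at h
  rw [colOp, h]
  simp [Pi.single_apply]

lemma colOp_zero (m : ℕ) : ‖colOp p m 0 0‖ ^ 2 = (1 - 2 * colWeight m) ^ 2 := by
  rw [colOp_apply, mul_assoc, star_mul_self_eq, colPrep_zero_norm, if_pos rfl]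
  have : (2 * (colWeight m : ℂ) - 1) = ((2 * colWeight m - 1 : ℝ) : ℂ) := by push_cast; ring
  rw [this, Complex.norm_real, Real.norm_eq_abs, sq_abs]
  ring

lemma colOp_one (m : ℕ) : ‖colOp p m (fun _ => 1) 0‖ ^ 2 = 2 * colWeight m := by
  rw [colOp_apply, if_neg (prime_zero_ne_one_fun m), sub_zero, norm_mul, norm_mul, mul_pow, mul_pow,
    norm_star, colPrep_zero_norm, colPrep_one_norm, Complex.norm_two]
  ring

/-- The number of columns of the grid. -/
def numCols (m : ℕ) : ℕ := 16 ^ m / (4 * m.centralBinom ^ 2)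

lemma two_mul_centralBinom_le {m : ℕ} (hm : 1 ≤ m) : 2 * m.centralBinom ≤ 4 ^ m := by
  induction m, hm using Nat.le_induction with
  | base => decide
  | succ m hm ih =>
    have h := Nat.succ_mul_centralBinom_succ m
    refine Nat.le_of_mul_le_mul_left ?_ (Nat.succ_pos m)
    rw [mul_left_comm, h, pow_succ]
    nlinarith

/-- Keeps the grid of polynomial size, by the lower bound `4 ^ m / (2 * m)` for the central binomial
coefficient. -/
lemma numCols_le {m : ℕ} (hm : 1 ≤ m) : numCols m ≤ m ^ 2 := by
  have h := Nat.four_pow_le_two_mul_self_mul_centralBinom m hm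
  have hc := Nat.centralBinom_pos m
  refine Nat.div_le_of_le_mul ?_
  calc 16 ^ m = (4 ^ m) ^ 2 := by rw [← pow_mul, mul_comm, pow_mul]; norm_num
    _ ≤ (2 * m * m.centralBinom) ^ 2 := Nat.pow_le_pow_left h 2
    _ = _ := by ring

lemma numCols_mul_le (m : ℕ) : (numCols m : ℝ) * colWeight m ≤ 1 / 8 := by
  have hc : (0 : ℝ) < m.centralBinom := by exact_mod_cast Nat.centralBinom_pos m
  have h : (numCols m : ℝ) ≤ (16 ^ m : ℕ) / (4 * m.centralBinom ^ 2 : ℕ) := Nat.cast_div_le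
  push_cast at h
  rw [le_div_iff₀ (by positivity)] at h
  rw [colWeight, ← mul_div_assoc, div_le_iff₀ (by positivity)]
  linarith

/-- `numCols m` is the integer part of `1 / (8 * colWeight m)`. It is at least 1, so rounding down
loses at most a factor 2. -/
lemma le_numCols_mul {m : ℕ} (hm : 1 ≤ m) : 1 / 16 ≤ (numCols m : ℝ) * colWeight m := by
  have hc : 0 < m.centralBinom := Nat.centralBinom_pos m
  have h16 : 16 ^ m = (4 ^ m) ^ 2 := by rw [← pow_mul, mul_comm, pow_mul]; norm_num
  have h1 : 4 * m.centralBinom ^ 2 ≤ 16 ^ m := by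
    calc 4 * m.centralBinom ^ 2 = (2 * m.centralBinom) ^ 2 := by ring
      _ ≤ (4 ^ m) ^ 2 := Nat.pow_le_pow_left (two_mul_centralBinom_le hm) 2
      _ = 16 ^ m := h16.symm
  have h2 : 1 ≤ numCols m := Nat.div_pos h1 (by positivity)
  have h3 : 16 ^ m ≤ 2 * (numCols m * (4 * m.centralBinom ^ 2)) := by
    have h4 : 4 * m.centralBinom ^ 2 * numCols m + 16 ^ m % (4 * m.centralBinom ^ 2) = 16 ^ m :=
      Nat.div_add_mod _ _
    have h5 : 16 ^ m % (4 * m.centralBinom ^ 2) < 4 * m.centralBinom ^ 2 :=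
      Nat.mod_lt _ (by positivity)
    nlinarith
  have h4 : (16 : ℝ) ^ m ≤ 2 * (numCols m * (4 * m.centralBinom ^ 2)) := by exact_mod_cast h3
  rw [colWeight, ← mul_div_assoc, le_div_iff₀ (by positivity)]
  linarith

lemma colWeight_nonneg (m : ℕ) : 0 ≤ colWeight m := by rw [colWeight]; positivity

lemma half_le_pow {m k : ℕ} (hm : 1 ≤ m) (hk : k ≤ numCols m) :
    1 / 2 ≤ ((1 - 2 * colWeight m) ^ 2) ^ k := by
  have h0 := colWeight_nonneg m
  have h1 := numCols_mul_le m
  have h2 := le_numCols_mul hm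
  have h3 : colWeight m ≤ 1 / 8 := by
    have : (1 : ℝ) ≤ numCols m := by
      have : numCols m ≠ 0 := by
        intro h
        rw [h] at h2
        norm_num at h2
      exact_mod_cast Nat.one_le_iff_ne_zero.mpr this
    nlinarith
  -- Bernoulli's inequality, with `4 * k * colWeight m ≤ 1 / 2`.
  have h4 := one_add_mul_le_pow (a := -(2 * colWeight m)) (by linarith) (2 * k)
  have h5 : (k : ℝ) ≤ numCols m := by exact_mod_cast hk
  rw [← pow_mul]
  have h6 : (1 : ℝ) + -(2 * colWeight m) = 1 - 2 * colWeight m := by ring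
  rw [h6] at h4
  refine le_trans ?_ h4
  push_cast
  nlinarith

end Column

/-! ### Phases and reflections from threshold gates. -/

section ThresholdPhases

variable {p : ℕ} [Fact p.Prime] {J : Type*} {sz : J → ℕ} {ι : J → Type}
  [∀ j, Fintype (ι j)] [∀ j, DecidableEq (ι j)]

lemma isGate_threshold {d : ℕ} [NeZero d] {α : Type} [Fintype α] [DecidableEq α] (k : ℕ) :
    IsGate Fanin.th (insert (Sum.inr ()) (Finset.univ.map Function.Embedding.inl))
      (ctrlLocals fun (a : α → ZMod d) (_ : Unit) => shift (thr k Finset.univ a)) := by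
  have h := IsGate.th (d := d) rfl k (Sum.inr () : α ⊕ Unit)
    (Finset.univ.map Function.Embedding.inl) (by simp)
  simp only [thr, sum_univ_map_inl] at h
  rw [← tgt_eq_ctrlLocals]
  exact h

/-- Compute the threshold into an ancilla, apply a one-qudit phase to it, uncompute. -/
lemma feas_thresholdPhase (k : J → ℕ) (c : ℂ) (hc : ‖c‖ = 1) :
    Feas Fanin.th sz fun j =>
      diagonal fun x : ι j → ZMod p => if k j ≤ ∑ i, (x i).val then c else 1 := by
  have hA : Feas Fanin.th sz fun j =>
      ctrlLocals fun (a : ι j → ZMod p) (_ : Unit) => shift (thr (k j) Finset.univ a) :=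
    Feas.of_gate fun j => isGate_threshold (k j)
  have hψ := Feas.phase (K := Fanin.th) (J := J) (sz := sz) (ι := fun j => ι j ⊕ Unit)
    (v := fun _ (l : ZMod p) => if l = 0 then 1 else c)
    (fun _ l => by split_ifs <;> simp [hc]) (fun j => Sum.inr ())
  refine Feas.diag_conj hA hψ (PolyLE.const _) fun j z x h => ?_
  have h1 := (ctrlLocals_ne_zero h).2 ()
  have h2 : z (Sum.inr ()) = thr (k j) Finset.univ x := by
    by_contra h3
    exact h1 (if_neg (by simpa using h3))
  simp only [h2, thr]
  split_ifs with h3 h4 h4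
  · exact absurd h4 one_ne_zero
  · rfl
  · rfl
  · exact absurd rfl h4

lemma one_le_sum_val {ι : Type} [Fintype ι] (x : ι → ZMod p) :
    1 ≤ ∑ i, (x i).val ↔ x ≠ 0 := by
  rw [Nat.one_le_iff_ne_zero, not_iff_not, Finset.sum_eq_zero_iff]
  constructor
  · intro h
    funext i
    exact (ZMod.val_eq_zero _).mp (h i (Finset.mem_univ i))
  · rintro rfl i _
    simp

lemma feas_zeroReflection : Feas Fanin.th sz fun j => zeroReflection p (ι j) := by
  refine (feas_thresholdPhase (p := p) (sz := sz) (ι := ι) (fun _ => 1) (-1) (by simp)).congr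
    fun j => ?_
  rw [zeroReflection]
  congr 1
  funext x
  by_cases hx : x = 0
  · rw [if_neg, if_pos hx]
    exact fun h => (one_le_sum_val x).mp h hx
  · rw [if_pos ((one_le_sum_val x).mpr hx), if_neg hx]

lemma feas_boost {A S : ∀ j, Op p (ι j)} (hA : Feas Fanin.th sz A) (hS : Feas Fanin.th sz S) :
    Feas Fanin.th sz fun j => boost (A j) (S j) :=
  (((hA.mul feas_zeroReflection).mul hA.conjTranspose).mul hS).mul hA

end ThresholdPhases

/-! ### The grid state and its masses on good outcomes. -/

section Grid

variable {p : ℕ} [Fact p.Prime]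

/-- The cells of the grid: columns and rows. -/
abbrev Cells (m : ℕ) : Type := Σ _ : Fin (numCols m), Fin (2 * m + 1)

/-- The cells, one wire for every row, and one extra wire. -/
abbrev GridWires (m : ℕ) : Type := (Cells m ⊕ Fin (2 * m + 1)) ⊕ Unit

/-- Whether a row contains a nonzero cell. -/
noncomputable def rowOr {m : ℕ} (x : Cells m → ZMod p) (i : Fin (2 * m + 1)) : ZMod p :=
  if 1 ≤ ∑ c, (x ⟨c, i⟩).val then 1 else 0

/-- Adds, for every row, the disjunction of the cells to the wire of the row. -/
noncomputable def rowsOp (p : ℕ) [Fact p.Prime] (m : ℕ) : Op p (Cells m ⊕ Fin (2 * m + 1)) :=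
  ctrlLocals fun x i => shift (rowOr x i)

/-- Rotates the extra wire by one of two reflections, selected by the wire of the first row. -/
noncomputable def rotOp (m : ℕ) (V W : Matrix (ZMod p) (ZMod p) ℂ) : Op p (GridWires m) :=
  ctrlLocals fun w _ => (W * V) ^ (w (Sum.inr 0)).val * V

/-- The preparation of the grid state. -/
noncomputable def gridPrep (m : ℕ) (V W : Matrix (ZMod p) (ZMod p) ℂ) : Op p (GridWires m) :=
  rotOp m V W * lift Function.Embedding.inl
    (rowsOp p m * lift Function.Embedding.inl (tensor fun _ : Fin (numCols m) => colOp p m))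

lemma ctrlLocals_mul_lift_col {d : ℕ} [NeZero d] {α β : Type} [Fintype α] [DecidableEq α]
    [Fintype β] [DecidableEq β] (V : (α → ZMod d) → β → Matrix (ZMod d) (ZMod d) ℂ)
    (S : Op d α) (z : α ⊕ β → ZMod d) :
    (ctrlLocals V * lift Function.Embedding.inl S : Op d (α ⊕ β)) z 0 =
      S (z ∘ Sum.inl) 0 * ∏ k, V (z ∘ Sum.inl) k (z (Sum.inr k)) 0 := by
  classical
  rw [Matrix.mul_apply, Finset.sum_eq_single (Sum.elim (z ∘ Sum.inl) 0)]
  · have h1 : lift Function.Embedding.inl S (Sum.elim (z ∘ Sum.inl) 0) (0 : α ⊕ β → ZMod d) =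
        S (z ∘ Sum.inl) 0 := by
      rw [lift, if_pos]
      · rfl
      · rintro (j | j) hj
        · exact absurd ⟨j, rfl⟩ hj
        · rfl
    rw [h1, ctrlLocals, if_pos (by rw [Sum.elim_comp_inl]), mul_comm]
    rfl
  · intro w _ hw
    by_contra h
    have h1 := (ctrlLocals_ne_zero (left_ne_zero_of_mul h)).1
    have h2 := (lift_ne_zero (right_ne_zero_of_mul h)).1
    refine hw (funext fun j => ?_)
    cases j with
    | inl j => exact (congrFun h1 j).symm
    | inr j => exact h2 _ (by simp)
  · simp

lemma gridPrep_apply (m : ℕ) (V W : Matrix (ZMod p) (ZMod p) ℂ) (z : GridWires m → ZMod p) :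
    gridPrep m V W z 0 = (∏ c, colOp p m (fun i => z (Sum.inl (Sum.inl ⟨c, i⟩))) 0) *
      (∏ i, shift (rowOr (fun c => z (Sum.inl (Sum.inl c))) i) (z (Sum.inl (Sum.inr i))) 0) *
      ((W * V) ^ (z (Sum.inl (Sum.inr 0))).val * V) (z (Sum.inr ())) 0 := by
  rw [gridPrep, rotOp, ctrlLocals_mul_lift_col, rowsOp, ctrlLocals_mul_lift_col,
    Fintype.prod_unique (ι := Unit)]
  rfl

lemma rowOr_eq (m : ℕ) (x : Cells m → ZMod p) (i : Fin (2 * m + 1)) :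
    rowOr x i = 0 ∨ rowOr x i = 1 := by
  rw [rowOr]; split_ifs <;> simp

lemma rowOr_eq_zero {m : ℕ} {x : Cells m → ZMod p} {i : Fin (2 * m + 1)}
    (h : rowOr x i = 0) (c : Fin (numCols m)) : x ⟨c, i⟩ = 0 := by
  rw [rowOr] at h
  split_ifs at h with h1
  · exact absurd h one_ne_zero
  · have := (one_le_sum_val fun c => x ⟨c, i⟩).not.mp h1
    exact congrFun (not_not.mp this) c

/-- The number of ones on the row wires and the extra wire. -/
def gridWeight {m : ℕ} (z : GridWires m → ZMod p) : ℕ :=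
  ∑ i : Fin (2 * m + 1) ⊕ Unit, (z (Sum.map Sum.inr id i)).val

/-- All the row wires and the extra wire agree, if they carry bits. -/
def GridGood {m : ℕ} (z : GridWires m → ZMod p) : Prop :=
  gridWeight z < 1 ∨ 2 * m + 1 + 1 ≤ gridWeight z

instance {m : ℕ} : DecidablePred (GridGood (p := p) (m := m)) :=
  fun _ => inferInstanceAs (Decidable (_ ∨ _))

/-- The hypothesis `hV` says that `rotOp` applies `V` when the first row carries 0 and `W` when it
carries 1. -/
lemma gridPrep_ne_zero {m : ℕ} {V W : Matrix (ZMod p) (ZMod p) ℂ} (hV : W * V * V = W)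
    (hV0 : ∀ l, l ≠ 0 → l ≠ 1 → V l 0 = 0) (hW0 : ∀ l, l ≠ 0 → l ≠ 1 → W l 0 = 0)
    {z : GridWires m → ZMod p} (h : gridPrep m V W z 0 ≠ 0) :
    (∀ i, z (Sum.inl (Sum.inr i)) = rowOr (fun c => z (Sum.inl (Sum.inl c))) i) ∧
      (z (Sum.inr ()) = 0 ∨ z (Sum.inr ()) = 1) := by
  rw [gridPrep_apply] at h
  have h1 : ∀ i, z (Sum.inl (Sum.inr i)) = rowOr (fun c => z (Sum.inl (Sum.inl c))) i := by
    intro i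
    have := Finset.prod_ne_zero_iff.mp (right_ne_zero_of_mul (left_ne_zero_of_mul h)) i
      (Finset.mem_univ i)
    by_contra h2
    exact this (if_neg (by simpa using h2))
  refine ⟨h1, ?_⟩
  have h2 := right_ne_zero_of_mul h
  by_contra! h3
  refine h2 ?_
  rcases rowOr_eq m (fun c => z (Sum.inl (Sum.inl c))) 0 with h4 | h4
  · rw [h1, h4, ZMod.val_zero, pow_zero, Matrix.one_mul]
    exact hV0 _ h3.1 h3.2
  · rw [h1, h4, val_one_prime, pow_one, hV]
    exact hW0 _ h3.1 h3.2

lemma gridWeight_eq {m : ℕ} (z : GridWires m → ZMod p) :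
    gridWeight z = ∑ i, (z (Sum.inl (Sum.inr i))).val + (z (Sum.inr ())).val := by
  rw [gridWeight, Fintype.sum_sum_type]
  simp

lemma gridGood_iff {m : ℕ} {z : GridWires m → ZMod p}
    (h : ∀ i, z (Sum.inl (Sum.inr i)) = 0 ∨ z (Sum.inl (Sum.inr i)) = 1)
    (h' : z (Sum.inr ()) = 0 ∨ z (Sum.inr ()) = 1) :
    GridGood z ↔ ((∀ i, z (Sum.inl (Sum.inr i)) = 0) ∧ z (Sum.inr ()) = 0) ∨
      ((∀ i, z (Sum.inl (Sum.inr i)) = 1) ∧ z (Sum.inr ()) = 1) := by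
  have hv : ∀ i, (z (Sum.inl (Sum.inr i))).val ≤ 1 := by
    intro i
    rcases h i with h | h <;> simp [h, val_one_prime]
  have hv' : (z (Sum.inr ())).val ≤ 1 := by
    rcases h' with h | h <;> simp [h, val_one_prime]
  have hsum : ∑ i, (z (Sum.inl (Sum.inr i))).val ≤ 2 * m + 1 := by
    have := Finset.sum_le_sum fun i (_ : i ∈ Finset.univ) => hv i
    simpa using this
  rw [GridGood, gridWeight_eq]
  constructor
  · rintro (h1 | h1)
    · left
      have h2 : ∑ i, (z (Sum.inl (Sum.inr i))).val = 0 := by omega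
      rw [Finset.sum_eq_zero_iff] at h2
      exact ⟨fun i => (ZMod.val_eq_zero _).mp (h2 i (Finset.mem_univ i)),
        (ZMod.val_eq_zero _).mp (by omega)⟩
    · right
      have h2 : (z (Sum.inr ())).val = 1 := by omega
      have h3 : ∑ i, (z (Sum.inl (Sum.inr i))).val = 2 * m + 1 := by omega
      refine ⟨fun i => ?_, ?_⟩
      · rcases h i with h4 | h4
        · exfalso
          have : ∑ i, (z (Sum.inl (Sum.inr i))).val < ∑ _i : Fin (2 * m + 1), 1 :=
            Finset.sum_lt_sum (fun i _ => hv i) ⟨i, Finset.mem_univ i, by simp [h4]⟩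
          simp at this
          omega
        · exact h4
      · rcases h' with h4 | h4
        · rw [h4] at h2; simp at h2
        · exact h4
  · rintro (⟨h1, h2⟩ | ⟨h1, h2⟩)
    · left; simp [h1, h2]
    · right; simp [h1, h2, val_one_prime]

/-- The probability that all rows contain a nonzero cell. -/
noncomputable def fullMass (p : ℕ) [Fact p.Prime] (m : ℕ) : ℝ :=
  ∑ x : Cells m → ZMod p, if ∀ i, rowOr x i = 1 then
    ∏ c, ‖colOp p m (fun i => x ⟨c, i⟩) 0‖ ^ 2 else 0

/-- The probability that all cells are zero. -/
noncomputable def emptyMass (m : ℕ) : ℝ := ((1 - 2 * colWeight m) ^ 2) ^ numCols m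

lemma half_le_emptyMass {m : ℕ} (hm : 1 ≤ m) : 1 / 2 ≤ emptyMass m := half_le_pow hm le_rfl

/-- It suffices to count the grids with exactly one all-one column and zeros elsewhere; each has
mass at least `colWeight m`. -/
lemma le_fullMass {m : ℕ} (hm : 1 ≤ m) : 1 / 16 ≤ fullMass p m := by
  classical
  let f : Fin (numCols m) → (Cells m → ZMod p) := fun c x => if x.1 = c then 1 else 0
  have hf : Function.Injective f := by
    intro c c' h
    have := congrFun h ⟨c, 0⟩
    by_contra hne
    simp [f, hne] at this
  have hor : ∀ c i, rowOr (f c) i = 1 := by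
    intro c i
    rw [rowOr, if_pos]
    refine (one_le_sum_val _).mpr fun h => ?_
    have := congrFun h c
    simp [f] at this
  have hterm : ∀ c, 1 / 2 * (2 * colWeight m) ≤
      ∏ c', ‖colOp p m (fun i => f c ⟨c', i⟩) 0‖ ^ 2 := by
    intro c
    have h1 : ∀ c', ‖colOp p m (fun i => f c ⟨c', i⟩) 0‖ ^ 2 =
        if c' = c then 2 * colWeight m else (1 - 2 * colWeight m) ^ 2 := by
      intro c'
      by_cases h : c' = c
      · rw [if_pos h, ← colOp_one (p := p)]
        simp [f, h]
      · rw [if_neg h, ← colOp_zero (p := p)]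
        simp only [f, h, if_false]
        rfl
    simp only [h1]
    rw [← Finset.mul_prod_erase _ _ (Finset.mem_univ c), if_pos rfl]
    have h2 : ∏ x ∈ Finset.univ.erase c, (if x = c then 2 * colWeight m
        else (1 - 2 * colWeight m) ^ 2) = ((1 - 2 * colWeight m) ^ 2) ^ (numCols m - 1) := by
      rw [Finset.prod_congr rfl fun x hx => if_neg (Finset.ne_of_mem_erase hx), Finset.prod_const,
        Finset.card_erase_of_mem (Finset.mem_univ c), Finset.card_univ, Fintype.card_fin]
    rw [h2, mul_comm]
    exact mul_le_mul_of_nonneg_left (half_le_pow hm (Nat.sub_le _ _))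
      (mul_nonneg zero_le_two (colWeight_nonneg m))
  calc (1 : ℝ) / 16 ≤ numCols m * colWeight m := le_numCols_mul hm
    _ = ∑ _c : Fin (numCols m), 1 / 2 * (2 * colWeight m) := by
      simp
    _ ≤ ∑ c : Fin (numCols m), ∏ c', ‖colOp p m (fun i => f c ⟨c', i⟩) 0‖ ^ 2 :=
      Finset.sum_le_sum fun c _ => hterm c
    _ = ∑ x ∈ Finset.univ.image f, (if ∀ i, rowOr x i = 1 then
          ∏ c, ‖colOp p m (fun i => x ⟨c, i⟩) 0‖ ^ 2 else 0) := by
      rw [Finset.sum_image fun _ _ _ _ h => hf h]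
      exact Finset.sum_congr rfl fun c _ => (if_pos (hor c)).symm
    _ ≤ fullMass p m :=
      Finset.sum_le_sum_of_subset_of_nonneg (Finset.subset_univ _) fun x _ _ => by
        split_ifs
        · positivity
        · exact le_rfl

lemma shift_apply_zero {d : ℕ} (s l : ZMod d) : shift s l 0 = if l = s then (1 : ℂ) else 0 := by
  rw [shift, zero_add]

/-- Zero disjunctions force zero cells, so a single basis state contributes. -/
lemma gridMass_zero {m : ℕ} {V W : Matrix (ZMod p) (ZMod p) ℂ} (hV : W * V * V = W)
    (hV0 : ∀ l, l ≠ 0 → l ≠ 1 → V l 0 = 0) (hW0 : ∀ l, l ≠ 0 → l ≠ 1 → W l 0 = 0) :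
    ∑ z, (if GridGood z ∧ z (Sum.inl (Sum.inr 0)) = 0 then ‖gridPrep m V W z 0‖ ^ 2 else 0) =
      emptyMass m * ‖V 0 0‖ ^ 2 := by
  rw [Finset.sum_eq_single 0]
  · have h1 : GridGood (0 : GridWires m → ZMod p) :=
      (gridGood_iff (fun _ => Or.inl rfl) (Or.inl rfl)).mpr (Or.inl ⟨fun _ => rfl, rfl⟩)
    rw [if_pos ⟨h1, rfl⟩, gridPrep_apply]
    have h2 : ∀ i, rowOr (fun _ : Cells m => (0 : ZMod p)) i = 0 := by
      intro i
      rw [rowOr, if_neg (by simp)]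
    simp only [Pi.zero_apply, ZMod.val_zero, pow_zero, Matrix.one_mul, shift_apply_zero, h2,
      if_true, Finset.prod_const_one, mul_one, Finset.prod_const, Finset.card_univ,
      Fintype.card_fin, norm_mul, norm_pow, mul_pow, emptyMass]
    rw [pow_right_comm]
    have := colOp_zero (p := p) m
    rw [← this]
    rfl
  · intro z _ hz
    split_ifs with h
    · by_contra h0
      have h1 : gridPrep m V W z 0 ≠ 0 := by
        intro h1
        rw [h1] at h0
        simp at h0
      obtain ⟨h2, h3⟩ := gridPrep_ne_zero hV hV0 hW0 h1
      rcases (gridGood_iff (fun i => by rw [h2]; exact rowOr_eq m _ i) h3).mp h.1 with h4 | h4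
      · refine hz (funext fun j => ?_)
        rcases j with (⟨c, i⟩ | i) | u
        · exact rowOr_eq_zero (x := fun c => z (Sum.inl (Sum.inl c)))
            (by rw [← h2, h4.1]) c
        · exact h4.1 i
        · exact h4.2
      · rw [h4.1] at h
        exact one_ne_zero h.2
    · rfl
  · simp

lemma gridMass_one {m : ℕ} {V W : Matrix (ZMod p) (ZMod p) ℂ} (hV : W * V * V = W)
    (hV0 : ∀ l, l ≠ 0 → l ≠ 1 → V l 0 = 0) (hW0 : ∀ l, l ≠ 0 → l ≠ 1 → W l 0 = 0) :
    ∑ z, (if GridGood z ∧ ¬ z (Sum.inl (Sum.inr 0)) = 0 then ‖gridPrep m V W z 0‖ ^ 2 else 0) =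
      fullMass p m * ‖W 1 0‖ ^ 2 := by
  rw [fullMass, Finset.sum_mul]
  -- The good states whose rows are 1 are parametrized by their cells, the other wires being forced.
  let e : (Cells m → ZMod p) → (GridWires m → ZMod p) :=
    fun x => Sum.elim (Sum.elim x fun _ => 1) fun _ => 1
  symm
  refine Fintype.sum_of_injective e ?_ _ _ ?_ ?_
  · intro x y h
    funext c
    exact congrFun h (Sum.inl (Sum.inl c))
  · intro z hz
    split_ifs with h
    · by_contra h0
      have h1 : gridPrep m V W z 0 ≠ 0 := by
        intro h1
        rw [h1] at h0
        simp at h0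
      obtain ⟨h2, h3⟩ := gridPrep_ne_zero hV hV0 hW0 h1
      rcases (gridGood_iff (fun i => by rw [h2]; exact rowOr_eq m _ i) h3).mp h.1 with h4 | h4
      · exact h.2 (h4.1 0)
      · refine hz ⟨fun c => z (Sum.inl (Sum.inl c)), funext fun j => ?_⟩
        rcases j with (c | i) | u
        · rfl
        · exact (h4.1 i).symm
        · exact h4.2.symm
    · rfl
  · intro x
    have h1 : GridGood (e x) :=
      (gridGood_iff (fun _ => Or.inr rfl) (Or.inr rfl)).mpr (Or.inr ⟨fun _ => rfl, rfl⟩)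
    have h0 : ¬ e x (Sum.inl (Sum.inr 0)) = 0 := one_ne_zero
    have h4 : (if GridGood (e x) ∧ ¬ e x (Sum.inl (Sum.inr 0)) = 0 then
        ‖gridPrep m V W (e x) 0‖ ^ 2 else 0) = ‖gridPrep m V W (e x) 0‖ ^ 2 := if_pos ⟨h1, h0⟩
    rw [h4, gridPrep_apply]
    simp only [e, Sum.elim_inl, Sum.elim_inr, val_one_prime, pow_one, hV, shift_apply_zero]
    split_ifs with h2
    · rw [Finset.prod_eq_one fun i _ => if_pos (h2 i).symm, mul_one, norm_mul, norm_prod, mul_pow,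
        Finset.prod_pow]
    · push Not at h2
      obtain ⟨i, hi⟩ := h2
      have h3 : ∏ i, (if (1 : ZMod p) = rowOr (fun c => x c) i then (1 : ℂ) else 0) = 0 :=
        Finset.prod_eq_zero (Finset.mem_univ i) (if_neg fun h => hi h.symm)
      rw [h3]
      simp

end Grid

/-! ### Circuits for the grid state and the amplified cat state. -/

section GridCircuits

variable {p : ℕ} [Fact p.Prime] {J : Type*} {sz m : J → ℕ}

lemma feas_colPrep (hm : PolyLE sz m) : Feas Fanin.th sz fun j => colPrep p (m j) := by
  have hc : PolyLE sz fun j => Fintype.card (Fin (2 * m j + 1)) :=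
    (((PolyLE.const 2).mul hm).add (PolyLE.const 1)).mono fun j => by simp
  have h1 := Feas.locals (K := Fanin.th) (sz := sz) (ι := fun j => Fin (2 * m j + 1))
    (V := fun _ _ => bitReflection p (Real.sqrt 2 / 2) (Real.sqrt 2 / 2))
    (fun _ _ => bitReflection_unitary sqrt_two_unit) hc
  have h2 := Feas.locals (K := Fanin.th) (sz := sz) (ι := fun j => Fin (2 * m j + 1))
    (V := fun _ _ => bitReflection p (Real.sqrt 2 / 2) (-(Real.sqrt 2 / 2)))
    (fun _ _ => bitReflection_unitary sqrt_two_unit') hc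
  have h3 := feas_thresholdPhase (p := p) (sz := sz) (ι := fun j => Fin (2 * m j + 1))
    (fun j => m j + 1) Complex.I (by simp)
  exact (h1.mul h3).mul h2

lemma feas_colOp (hm : PolyLE sz m) : Feas Fanin.th sz fun j => colOp p (m j) :=
  ((feas_colPrep hm).mul feas_zeroReflection).mul (feas_colPrep hm).conjTranspose

lemma feas_rowsOp (hm : PolyLE sz m) : Feas Fanin.th sz fun j => rowsOp p (m j) := by
  let e : ∀ j, (Σ _ : Fin (2 * m j + 1), Fin (numCols (m j)) ⊕ Unit) ≃
      Cells (m j) ⊕ Fin (2 * m j + 1) := fun j =>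
    { toFun := fun x => Sum.elim (fun c => Sum.inl ⟨c, x.1⟩) (fun _ => Sum.inr x.1) x.2
      invFun := Sum.elim (fun x => ⟨x.2, Sum.inl x.1⟩) (fun i => ⟨i, Sum.inr ()⟩)
      left_inv := by rintro ⟨i, (c | u)⟩ <;> rfl
      right_inv := by rintro (⟨c, i⟩ | i) <;> rfl }
  have h1 : Feas Fanin.th (J := Σ j, Fin (2 * m j + 1)) (fun j => sz j.1)
      (ι := fun j => Fin (numCols (m j.1)) ⊕ Unit) fun j =>
      ctrlLocals fun (a : Fin (numCols (m j.1)) → ZMod p) (_ : Unit) =>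
        shift (thr 1 Finset.univ a) :=
    Feas.of_gate fun j => isGate_threshold 1
  have h2 := (Feas.tensor (B := fun j => Fin (2 * m j + 1))
    (ι := fun j _ => Fin (numCols (m j)) ⊕ Unit)
    (U := fun j _ => ctrlLocals fun (a : Fin (numCols (m j)) → ZMod p) (_ : Unit) =>
      shift (thr 1 Finset.univ a)) h1
    ((((PolyLE.const 2).mul hm).add (PolyLE.const 1)).mono fun j => by simp)).lift
    fun j => (e j).toEmbedding
  refine h2.congr fun j => ?_
  ext z x
  rw [lift_equiv_apply, rowsOp, ctrlLocals, tensor]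
  split_ifs with h
  · refine Finset.prod_congr rfl fun i _ => ?_
    rw [ctrlLocals, if_pos, Fintype.prod_unique (ι := Unit)]
    · rfl
    · funext c
      exact congrFun h ⟨c, i⟩
  · obtain ⟨⟨c, i⟩, hc⟩ := Function.ne_iff.mp h
    refine Finset.prod_eq_zero (Finset.mem_univ i) (if_neg fun h' => hc ?_)
    exact congrFun h' c

lemma feas_rotOp {V W : J → Matrix (ZMod p) (ZMod p) ℂ} (hV : ∀ j, (V j)ᴴ * V j = 1)
    (hW : ∀ j, (W j)ᴴ * W j = 1) : Feas Fanin.th sz fun j => rotOp (m j) (V j) (W j) := by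
  have h1 : Feas Fanin.th sz fun j => ctrlLocals
      fun (w : Cells (m j) ⊕ Fin (2 * m j + 1) → ZMod p) (_ : Unit) =>
        (W j * V j) ^ (w (Sum.inr 0)).val := by
    refine Feas.of_gate (S := fun j => {Sum.inl (Sum.inr 0), Sum.inr ()}) fun j => ?_
    rw [← tgt_eq_ctrlLocals]
    have hWV : W j * V j ∈ Matrix.unitaryGroup (ZMod p) ℂ :=
      mul_mem (Matrix.mem_unitaryGroup_iff'.mpr (hW j)) (Matrix.mem_unitaryGroup_iff'.mpr (hV j))
    exact IsGate.ctrl (Sum.inl (Sum.inr 0)) (Sum.inr ()) (by simp) ⟨_, hWV⟩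
  have h2 := (Feas.locals (K := Fanin.th) (sz := sz) (ι := fun _ : J => Unit)
    (V := fun j _ => V j) (fun j _ => hV j) (PolyLE.const 1)).lift
    (κ := fun j => GridWires (m j)) fun j => Function.Embedding.inr
  refine (h1.mul h2).congr fun j => ?_
  rw [lift_inr_locals, ctrlLocals_mul, rotOp]

lemma feas_gridPrep {V W : J → Matrix (ZMod p) (ZMod p) ℂ} (hm : PolyLE sz m)
    (hm1 : ∀ j, 1 ≤ m j) (hV : ∀ j, (V j)ᴴ * V j = 1) (hW : ∀ j, (W j)ᴴ * W j = 1) :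
    Feas Fanin.th sz fun j => gridPrep (m j) (V j) (W j) := by
  have h1 : Feas Fanin.th (J := Σ j, Fin (numCols (m j))) (fun j => sz j.1)
      (ι := fun j => Fin (2 * m j.1 + 1)) fun j => colOp p (m j.1) :=
    feas_colOp hm.sigma
  have h2 := Feas.tensor (B := fun j => Fin (numCols (m j))) (ι := fun j _ => Fin (2 * m j + 1))
    (U := fun j _ => colOp p (m j)) h1
    ((hm.mul hm).mono fun j => by simpa [sq] using numCols_le (hm1 j))
  exact (feas_rotOp hV hW).mul
    (((feas_rowsOp hm).mul (h2.lift fun _ => Function.Embedding.inl)).lift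
      fun _ => Function.Embedding.inl)

/-- Signs at the thresholds 1 and `2 * m + 2` multiply to `-1` exactly for weights strictly between
the two extremes. -/
lemma feas_gridGood : Feas Fanin.th sz fun j =>
    diagonal fun z : GridWires (m j) → ZMod p => if GridGood z then (1 : ℂ) else -1 := by
  have h := fun k : J → ℕ => Feas.diag_lift (feas_thresholdPhase (p := p) (sz := sz)
    (ι := fun j => Fin (2 * m j + 1) ⊕ Unit) k (-1) (by simp)) (κ := fun j => GridWires (m j))
    fun j => Function.Embedding.sumMap Function.Embedding.inr (Function.Embedding.refl Unit)
  refine (Feas.diag_mul (h fun _ => 1) (h fun j => 2 * m j + 1 + 1)).congr fun j => ?_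
  congr 1
  funext z
  change (if 1 ≤ gridWeight z then (-1 : ℂ) else 1) *
    (if 2 * m j + 1 + 1 ≤ gridWeight z then -1 else 1) = _
  by_cases h1 : 1 ≤ gridWeight z <;> by_cases h2 : 2 * m j + 1 + 1 ≤ gridWeight z
  · rw [if_pos h1, if_pos h2, if_pos (show GridGood z from Or.inr h2)]; ring
  · rw [if_pos h1, if_neg h2, if_neg fun h => h.elim (by omega) h2]; ring
  · omega
  · rw [if_neg h1, if_neg h2, if_pos (show GridGood z from Or.inl (by omega))]; ring

/-- The target mass of each branch lies below the available mass, so the extra wire can trim it. -/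
lemma sin_sq_le : Real.sin (Real.pi / 18) ^ 2 / 2 ≤ 1 / 16 := by
  have h0 := Real.pi_pos
  have h1 : Real.sin (Real.pi / 18) ≤ Real.pi / 18 := Real.sin_le (by positivity)
  have h2 : 0 ≤ Real.sin (Real.pi / 18) :=
    Real.sin_nonneg_of_nonneg_of_le_pi (by positivity) (by linarith)
  have h3 := Real.pi_le_four
  nlinarith

lemma bitReflection_sq {a b : ℝ} (h : a ^ 2 + b ^ 2 = 1) :
    bitReflection p a b * bitReflection p a b = 1 := by
  have := bitReflection_unitary (p := p) h
  rwa [bitReflection_conjTranspose] at this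

lemma bitReflection_col_zero (a b : ℝ) (l : ZMod p) (h0 : l ≠ 0) (h1 : l ≠ 1) :
    bitReflection p a b l 0 = 0 := by
  rw [bitReflection, if_neg h0, if_neg h1, if_neg h0]

/-- With threshold gates one can prepare states that are superpositions, of equal weights, of
states in which certain qudits are all zero and states in which they are all one. -/
lemma exists_feas_cat (p : ℕ) [Fact p.Prime] : ∃ N : ∀ n : ℕ, Op p (GridWires (n + 1)),
    Feas Fanin.th (fun n => n) N ∧
    (∀ n z, N n z 0 ≠ 0 → (∀ i, z (Sum.inl (Sum.inr i)) = 0) ∨ ∀ i, z (Sum.inl (Sum.inr i)) = 1) ∧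
    ∀ n, ∑ z, (if z (Sum.inl (Sum.inr 0)) = 0 then ‖N n z 0‖ ^ 2 else 0) = 1 / 2 := by
  set s := Real.sin (Real.pi / 18) ^ 2 with hs
  have hs0 : 0 ≤ s := sq_nonneg _
  have hs1 : s / 2 ≤ 1 / 16 := sin_sq_le
  -- The fractions of the empty and full branches to be kept, chosen so that each retains mass `s /
  -- 2` and the good mass is exactly `s`.
  let t : ℕ → ℝ := fun n => s / 2 / emptyMass (n + 1)
  let u : ℕ → ℝ := fun n => s / 2 / fullMass p (n + 1)
  have hE : ∀ n, 1 / 16 ≤ emptyMass (n + 1) := fun n =>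
    le_trans (by norm_num) (half_le_emptyMass (Nat.le_add_left 1 n))
  have hF : ∀ n, 1 / 16 ≤ fullMass p (n + 1) := fun n => le_fullMass (Nat.le_add_left 1 n)
  have unit_of : ∀ x : ℝ, 1 / 16 ≤ x → 0 ≤ s / 2 / x ∧ 0 ≤ 1 - s / 2 / x ∧ x * (s / 2 / x) = s / 2 := by
    intro x hx
    have hx0 : 0 < x := by linarith
    refine ⟨by positivity, ?_, mul_div_cancel₀ _ hx0.ne'⟩
    rw [sub_nonneg, div_le_one hx0]
    linarith
  let V : ℕ → Matrix (ZMod p) (ZMod p) ℂ := fun n =>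
    bitReflection p (Real.sqrt (t n)) (Real.sqrt (1 - t n))
  let W : ℕ → Matrix (ZMod p) (ZMod p) ℂ := fun n =>
    bitReflection p (Real.sqrt (1 - u n)) (Real.sqrt (u n))
  have hVn : ∀ n, Real.sqrt (t n) ^ 2 + Real.sqrt (1 - t n) ^ 2 = 1 := fun n => by
    rw [Real.sq_sqrt (unit_of _ (hE n)).1, Real.sq_sqrt (unit_of _ (hE n)).2.1]; ring
  have hWn : ∀ n, Real.sqrt (1 - u n) ^ 2 + Real.sqrt (u n) ^ 2 = 1 := fun n => by
    rw [Real.sq_sqrt (unit_of _ (hF n)).1, Real.sq_sqrt (unit_of _ (hF n)).2.1]; ring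
  have hV00 : ∀ n, ‖V n 0 0‖ ^ 2 = t n := by
    intro n
    simp only [V, bitReflection, if_true]
    rw [Complex.norm_real, Real.norm_eq_abs, sq_abs, Real.sq_sqrt (unit_of _ (hE n)).1]
  have hW10 : ∀ n, ‖W n 1 0‖ ^ 2 = u n := by
    intro n
    simp only [W, bitReflection, if_true, one_ne_zero, if_false]
    rw [Complex.norm_real, Real.norm_eq_abs, sq_abs, Real.sq_sqrt (unit_of _ (hF n)).1]
  have hWVV : ∀ n, W n * V n * V n = W n := fun n => by
    rw [Matrix.mul_assoc, bitReflection_sq (hVn n), Matrix.mul_one]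
  have hV0 : ∀ n l, l ≠ 0 → l ≠ 1 → V n l 0 = 0 := fun n => bitReflection_col_zero _ _
  have hW0 : ∀ n l, l ≠ 0 → l ≠ 1 → W n l 0 = 0 := fun n => bitReflection_col_zero _ _
  let A : ∀ n : ℕ, Op p (GridWires (n + 1)) := fun n => gridPrep (n + 1) (V n) (W n)
  let S : ∀ n : ℕ, Op p (GridWires (n + 1)) := fun n =>
    diagonal fun z => if GridGood z then 1 else -1
  have hA : Feas Fanin.th (fun n : ℕ => n) A :=
    feas_gridPrep (m := fun n => n + 1) (PolyLE.refl.add (PolyLE.const 1))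
      (fun n => Nat.le_add_left 1 n) (fun n => bitReflection_unitary (hVn n))
      (fun n => bitReflection_unitary (hWn n))
  have hS : Feas Fanin.th (fun n : ℕ => n) S := feas_gridGood (m := fun n => n + 1)
  have h0 : ∀ n, ∑ z, (if GridGood z ∧ z (Sum.inl (Sum.inr 0)) = 0 then ‖A n z 0‖ ^ 2 else 0) =
      s / 2 := fun n => by
    rw [gridMass_zero (hWVV n) (hV0 n) (hW0 n), hV00]
    exact (unit_of _ (hE n)).2.2
  have h1 : ∀ n, ∑ z, (if GridGood z ∧ ¬ z (Sum.inl (Sum.inr 0)) = 0 then ‖A n z 0‖ ^ 2 else 0) =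
      s / 2 := fun n => by
    rw [gridMass_one (hWVV n) (hV0 n) (hW0 n), hW10]
    exact (unit_of _ (hF n)).2.2
  have hgood : ∀ n, ∑ z, (if GridGood z then ‖A n z 0‖ ^ 2 else 0) = s := by
    intro n
    rw [← add_halves s]
    nth_rewrite 1 [← h0 n]
    rw [← h1 n, ← Finset.sum_add_distrib]
    refine Finset.sum_congr rfl fun z _ => ?_
    by_cases hg : GridGood z <;> by_cases hz : z (Sum.inl (Sum.inr 0)) = 0 <;> simp [hg, hz]
  have hboost := fun n => boost_boost_col (hA.unitary n) GridGood (S := S n) rfl (hgood n)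
  refine ⟨fun n => boost (boost (A n) (S n)) (S n), feas_boost (feas_boost hA hS) hS,
    fun n z hz => ?_, fun n => ?_⟩
  · obtain ⟨c, -, hc⟩ := hboost n
    simp only [hc] at hz
    split_ifs at hz with hg
    · obtain ⟨h2, h3⟩ := gridPrep_ne_zero (hWVV n) (hV0 n) (hW0 n) (right_ne_zero_of_mul hz)
      rcases (gridGood_iff (fun i => by rw [h2]; exact rowOr_eq _ _ i) h3).mp hg with h4 | h4
      · exact Or.inl h4.1
      · exact Or.inr h4.1
    · exact absurd rfl hz
  · obtain ⟨c, hc1, hc⟩ := hboost n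
    rw [← hs] at hc1
    have : ∑ z, (if z (Sum.inl (Sum.inr 0)) = 0 then ‖boost (boost (A n) (S n)) (S n) z 0‖ ^ 2
        else 0) = ‖c‖ ^ 2 * ∑ z, (if GridGood z ∧ z (Sum.inl (Sum.inr 0)) = 0 then
          ‖A n z 0‖ ^ 2 else 0) := by
      rw [Finset.mul_sum]
      refine Finset.sum_congr rfl fun z _ => ?_
      rw [hc]
      by_cases hg : GridGood z <;> by_cases hz : z (Sum.inl (Sum.inr 0)) = 0 <;>
        simp [hg, hz, mul_pow]
    rw [this, h0]
    linarith

end GridCircuits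

/-! ### Parity by phase kickback on the cat state. -/

section Parity

variable {p : ℕ} [Fact p.Prime]

lemma feas_pair_phases {K : Fanin} {J : Type*} {sz : J → ℕ} {B κ : J → Type}
    [∀ j, Fintype (B j)] [∀ j, DecidableEq (B j)] [∀ j, Fintype (κ j)] [∀ j, DecidableEq (κ j)]
    {v : ZMod p → ℂ} (hv : ∀ l, ‖v l‖ = 1) (e : ∀ j, (Σ _ : B j, Bool) ↪ κ j)
    (hB : PolyLE sz fun j => Fintype.card (B j)) :
    Feas K sz fun j => diagonal fun z : κ j → ZMod p =>
      ∏ b, v (z (e j ⟨b, true⟩)) ^ (z (e j ⟨b, false⟩)).val := by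
  have h1 := Feas.ctrl_phase (K := K) (J := Σ j, B j) (sz := fun j => sz j.1) (ι := fun _ => Bool)
    (v := fun _ => v) (fun _ => hv) (fun _ => false) (fun _ => true) (fun _ => Bool.false_ne_true)
  have h2 := (Feas.tensor (B := B) (ι := fun _ _ => Bool)
    (U := fun j _ => diagonal fun z : Bool → ZMod p => v (z true) ^ (z false).val) h1 hB).lift e
  refine h2.congr fun j => ?_
  rw [tensor_diagonal, lift_diagonal]
  rfl

lemma lift_inr_conj_apply {d : ℕ} [NeZero d] {α β : Type} [Fintype α] [DecidableEq α] [Fintype β]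
    [DecidableEq β] (N : Op d β) (φ : (α ⊕ β → ZMod d) → ℂ) (z x : α ⊕ β → ZMod d) :
    ((lift Function.Embedding.inr N)ᴴ * diagonal φ * lift Function.Embedding.inr N :
      Op d (α ⊕ β)) z x =
      if z ∘ Sum.inl = x ∘ Sum.inl then
        ∑ b, star (N b (z ∘ Sum.inr)) * φ (Sum.elim (x ∘ Sum.inl) b) * N b (x ∘ Sum.inr)
      else 0 := by
  have hl : ∀ w y : α ⊕ β → ZMod d, w ∘ Sum.inl = y ∘ Sum.inl →
      lift (Function.Embedding.inr : β ↪ α ⊕ β) N w y = N (w ∘ Sum.inr) (y ∘ Sum.inr) := by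
    intro w y h
    refine if_pos ?_
    rintro (j | j) hj
    · exact congrFun h j
    · simp at hj
  have hl0 : ∀ w y : α ⊕ β → ZMod d, w ∘ Sum.inl ≠ y ∘ Sum.inl →
      lift (Function.Embedding.inr : β ↪ α ⊕ β) N w y = 0 := fun w y h =>
    if_neg fun h' => h (funext fun a => h' _ (by simp))
  rw [Matrix.mul_apply, ← (Equiv.sumArrowEquivProdArrow α β (ZMod d)).symm.sum_comp,
    Fintype.sum_prod_type, Finset.sum_eq_single (x ∘ Sum.inl)]
  · have he : ∀ b, (Equiv.sumArrowEquivProdArrow α β (ZMod d)).symm (x ∘ Sum.inl, b) =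
        Sum.elim (x ∘ Sum.inl) b := fun _ => rfl
    simp only [he, mul_diagonal, conjTranspose_apply]
    split_ifs with h
    · refine Finset.sum_congr rfl fun b _ => ?_
      rw [hl _ z (by rw [h, Sum.elim_comp_inl]), hl _ x (by rw [Sum.elim_comp_inl]),
        Sum.elim_comp_inr]
    · refine Finset.sum_eq_zero fun b _ => ?_
      rw [hl0 _ z (by rw [Sum.elim_comp_inl]; exact Ne.symm h), star_zero, zero_mul, zero_mul]
  · intro a _ ha
    refine Finset.sum_eq_zero fun b _ => ?_
    exact mul_eq_zero_of_right _ (hl0 _ x ha)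
  · simp

/-- The sign `(-1) ^ l`. -/
def sign (l : ZMod p) : ℂ := (-1) ^ l.val

lemma norm_sign (l : ZMod p) : ‖sign l‖ = 1 := by simp [sign]

/-- With threshold gates one can move clean ancillas away from their initial state exactly when
the sum of the inputs is odd. -/
lemma exists_feas_parity (p : ℕ) [Fact p.Prime] :
    ∃ G : ∀ n : ℕ, Op p (Fin n ⊕ GridWires (n + 1)), Feas Fanin.th (fun n => n) G ∧
      ∀ n z x, x ∘ Sum.inr = 0 → G n z x ≠ 0 → z ∘ Sum.inl = x ∘ Sum.inl ∧
        (z ∘ Sum.inr = 0 ↔ Even (∑ i, (x (Sum.inl i)).val)) := by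
  obtain ⟨N, hN, hcat, hmass⟩ := exists_feas_cat p
  -- The grid for `m = n + 1` has `2 * n + 3` rows; the first `n` are paired with the inputs.
  let row : ∀ n, Fin n → GridWires (n + 1) := fun n i => Sum.inl (Sum.inr (i.castLE (by omega)))
  let φ : ∀ n, (Fin n ⊕ GridWires (n + 1) → ZMod p) → ℂ := fun n z =>
    ∏ i : Fin n, sign (z (Sum.inr (row n i))) ^ (z (Sum.inl i)).val
  have hφ : Feas Fanin.th (fun n : ℕ => n) fun n => diagonal (φ n) :=
    feas_pair_phases (B := fun n : ℕ => Fin n) (κ := fun n => Fin n ⊕ GridWires (n + 1))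
      norm_sign (fun n => ⟨fun b => if b.2 then Sum.inr (row n b.1) else Sum.inl b.1, by
        rintro ⟨i, (b | b)⟩ ⟨j, (c | c)⟩ h <;> simp_all [row]⟩) (PolyLE.of_le fun n => by simp)
  have hL := hN.lift (κ := fun n => Fin n ⊕ GridWires (n + 1)) fun _ => Function.Embedding.inr
  refine ⟨_, (hL.conjTranspose.mul hφ).mul hL, fun n z x hx hz => ?_⟩
  rw [lift_inr_conj_apply, hx] at hz
  split_ifs at hz with h
  swap
  · exact absurd rfl hz
  refine ⟨h, ?_⟩
  set s := ∑ i, (x (Sum.inl i)).val with hs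
  have hφ0 : ∀ b : GridWires (n + 1) → ZMod p, (∀ i, b (Sum.inl (Sum.inr i)) = 0) →
      φ n (Sum.elim (x ∘ Sum.inl) b) = 1 := by
    intro b hb
    refine Finset.prod_eq_one fun i _ => ?_
    simp [row, hb, sign]
  have hφ1 : ∀ b : GridWires (n + 1) → ZMod p, (∀ i, b (Sum.inl (Sum.inr i)) = 1) →
      φ n (Sum.elim (x ∘ Sum.inl) b) = (-1) ^ s := by
    intro b hb
    simp only [φ, row, Sum.elim_inr, hb, sign, val_one_prime, pow_one, Sum.elim_inl]
    rw [Finset.prod_pow_eq_pow_sum]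
    rfl
  by_cases hev : Even s
  · simp only [hev, iff_true]
    -- For an even sum both branches acquire phase 1, so `N` is undone completely.
    have h1 : ∀ b, star (N n b (z ∘ Sum.inr)) * φ n (Sum.elim (x ∘ Sum.inl) b) * N n b 0 =
        star (N n b (z ∘ Sum.inr)) * N n b 0 := by
      intro b
      by_cases hb : N n b 0 = 0
      · simp [hb]
      · rcases hcat n b hb with h2 | h2
        · rw [hφ0 b h2, mul_one]
        · rw [hφ1 b h2, hev.neg_one_pow, mul_one]
    simp only [h1] at hz
    have h2 : ((N n)ᴴ * N n) (z ∘ Sum.inr) 0 ≠ 0 := hz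
    rw [hN.unitary n] at h2
    by_contra h3
    exact h2 (Matrix.one_apply_ne h3)
  · simp only [hev, iff_false]
    intro h0
    rw [h0] at hz
    refine hz ?_
    -- For an odd sum the branches of mass one half enter the amplitude of the zero state with
    -- opposite signs and cancel.
    have h1 : ∀ b, star (N n b 0) * φ n (Sum.elim (x ∘ Sum.inl) b) * N n b 0 =
        ((2 * (if b (Sum.inl (Sum.inr 0)) = 0 then ‖N n b 0‖ ^ 2 else 0) - ‖N n b 0‖ ^ 2 : ℝ) :
          ℂ) := by
      intro b
      by_cases hb : N n b 0 = 0
      · simp [hb]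
      · rw [mul_right_comm, star_mul_self_eq]
        rcases hcat n b hb with h2 | h2
        · rw [hφ0 b h2, if_pos (h2 0)]; push_cast; ring
        · rw [hφ1 b h2, (Nat.not_even_iff_odd.mp hev).neg_one_pow,
            if_neg (by rw [h2]; exact one_ne_zero)]
          push_cast; ring
    simp only [h1]
    rw [← Complex.ofReal_sum, Finset.sum_sub_distrib, ← Finset.mul_sum, hmass,
      sum_norm_sq_col (hN.unitary n)]
    norm_num

lemma feas_ctrl_ne_zero {J : Type*} {sz : J → ℕ} {ι : J → Type} [∀ j, Fintype (ι j)]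
    [∀ j, DecidableEq (ι j)] : Feas Fanin.th sz fun j =>
      diagonal fun z : Unit ⊕ ι j → ZMod p =>
        if z ∘ Sum.inr = 0 then 1 else sign (z (Sum.inl ())) := by
  have hA : Feas Fanin.th sz fun j =>
      ctrlLocals fun (a : ι j → ZMod p) (_ : Unit) => shift (thr 1 Finset.univ a) :=
    Feas.of_gate fun j => isGate_threshold 1
  have hL := hA.lift (κ := fun j => (Unit ⊕ ι j) ⊕ Unit) fun j =>
    Function.Embedding.sumMap Function.Embedding.inr (Function.Embedding.refl Unit)
  have hψ := Feas.ctrl_phase (K := Fanin.th) (J := J) (sz := sz)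
    (ι := fun j => (Unit ⊕ ι j) ⊕ Unit) (v := fun _ (l : ZMod p) => sign l)
    (fun _ => norm_sign) (fun _ => Sum.inr ()) (fun _ => Sum.inl (Sum.inl ())) (by simp)
  refine Feas.diag_conj hL hψ (PolyLE.const 1) fun j z x h => ?_
  obtain ⟨h1, h2⟩ := lift_ne_zero h
  obtain ⟨-, h3⟩ := ctrlLocals_ne_zero h2
  have h4 : z (Sum.inl (Sum.inl ())) = x (Sum.inl ()) := h1 _ (by simp)
  have h5 : z (Sum.inr ()) = thr 1 Finset.univ (x ∘ Sum.inr) := by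
    by_contra h6
    refine h3 () (if_neg fun h7 => h6 ?_)
    exact h7.trans (zero_add _)
  have h6 := one_le_sum_val (x ∘ Sum.inr)
  rw [h4, h5, thr]
  by_cases h7 : x ∘ Sum.inr = 0
  · rw [if_pos h7, if_neg fun h => h6.mp h h7, ZMod.val_zero, pow_zero]
  · rw [if_neg h7, if_pos (h6.mpr h7), val_one_prime, pow_one]

/-- Whether the ancillas have left the zero state encodes the parity of the sum. A sign conditioned
on this and on the distinguished qudit is applied, and the parity is uncomputed. -/
lemma feas_sign_star : Feas Fanin.th (fun n : ℕ => n) fun n =>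
    diagonal fun z : Unit ⊕ Fin n → ZMod p =>
      ∏ i, sign (z (Sum.inl ())) ^ (z (Sum.inr i)).val := by
  obtain ⟨G, hG, hspec⟩ := exists_feas_parity p
  have hL := hG.lift (κ := fun n => (Unit ⊕ Fin n) ⊕ GridWires (n + 1)) fun n =>
    Function.Embedding.sumMap Function.Embedding.inr (Function.Embedding.refl _)
  have hψ := Feas.diag_lift (feas_ctrl_ne_zero (p := p) (sz := fun n : ℕ => n)
    (ι := fun n => GridWires (n + 1))) (κ := fun n => (Unit ⊕ Fin n) ⊕ GridWires (n + 1))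
    fun n => Function.Embedding.sumMap Function.Embedding.inl (Function.Embedding.refl _)
  refine Feas.diag_conj hL hψ ?_ fun n z x h => ?_
  · refine (((((PolyLE.refl.add (PolyLE.const 1)).mul (PolyLE.refl.add (PolyLE.const 1))).mul
      ((PolyLE.const 2).mul (PolyLE.refl.add (PolyLE.const 2)))).add
      ((PolyLE.const 2).mul (PolyLE.refl.add (PolyLE.const 2)))).add (PolyLE.const 1)).mono
      fun n => ?_
    have h1 := numCols_le (Nat.le_add_left 1 n)
    simp only [Fintype.card_sum, Fintype.card_sigma, Fintype.card_fin, Finset.sum_const,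
      Finset.card_univ, smul_eq_mul, Fintype.card_unit]
    have h2 : 2 * (n + 1) + 1 ≤ 2 * (n + 2) := by omega
    rw [sq] at h1
    exact Nat.add_le_add_right (Nat.add_le_add (Nat.mul_le_mul h1 h2) h2) 1
  · obtain ⟨h1, h2⟩ := lift_ne_zero h
    have h3 : z (Sum.inl (Sum.inl ())) = x (Sum.inl ()) := h1 _ (by simp)
    obtain ⟨-, h4⟩ := hspec n _ _ (by rfl) h2
    have h5 : z ∘ Sum.inr = 0 ↔ Even (∑ i, (x (Sum.inr i)).val) := h4
    rw [Finset.prod_pow_eq_pow_sum]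
    change (if z ∘ Sum.inr = 0 then (1 : ℂ) else sign (z (Sum.inl (Sum.inl ())))) = _
    rw [h3, sign, ← pow_mul]
    by_cases h6 : Even (∑ i, (x (Sum.inr i)).val)
    · rw [if_pos (h5.mpr h6), (h6.mul_left _).neg_one_pow]
    · rw [if_neg fun h => h6 (h5.mp h), mul_comm, pow_mul, (Nat.not_even_iff_odd.mp h6).neg_one_pow]

end Parity

/-! ### Fan-out of bits, and `starOp` from threshold gates. -/

section BitCopies

variable {p : ℕ} [Fact p.Prime]

/-- The operator with which a bit is copied. -/
noncomputable def bitCopy (p : ℕ) [Fact p.Prime] (y : ZMod p) : Matrix (ZMod p) (ZMod p) ℂ :=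
  (bitReflection p (Real.sqrt 2 / 2) (Real.sqrt 2 / 2))ᴴ *
    diagonal (fun l => sign y ^ l.val) * bitReflection p (Real.sqrt 2 / 2) (Real.sqrt 2 / 2)

/-- On the span of the basis states 0 and 1 the reflection acts as a Hadamard gate, which conjugates
the sign into a flip. Nothing is claimed for `y` other than a bit. -/
lemma bitCopy_ne_zero {y z : ZMod p} (hy : y = 0 ∨ y = 1) (h : bitCopy p y z 0 ≠ 0) : z = y := by
  rcases hy with rfl | rfl
  · rw [bitCopy] at h
    have h1 : (fun l : ZMod p => sign (0 : ZMod p) ^ l.val) = fun _ => 1 := by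
      funext l; simp [sign]
    rw [h1, diagonal_one, Matrix.mul_one, bitReflection_unitary sqrt_two_unit] at h
    by_contra h2
    exact h (Matrix.one_apply_ne h2)
  · have h1 : bitCopy p 1 z 0 = (bitCopy p 1 *ᵥ Pi.single 0 1) z := by
      rw [mulVec_single_one]; rfl
    rw [h1, bitCopy, bitReflection_conjTranspose, ← mulVec_mulVec, ← mulVec_mulVec,
      bitReflection_mulVec] at h
    by_contra h2
    refine h ?_
    simp only [mulVec_diagonal, bitReflection_mulVec]
    by_cases h0 : z = 0
    · subst h0
      simp [sign, val_one_prime]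
    · rw [if_neg h0, if_neg h2, if_neg h0, if_neg h2]
      simp [h0]

lemma feas_bitCopies : Feas Fanin.th (fun n : ℕ => n) fun n =>
    ctrlLocals fun (a : Unit → ZMod p) (_ : Fin n) => bitCopy p (a ()) :=
  Feas.ctrlLocals (ι := fun _ => Unit) (β := fun n => Fin n)
    (φ := fun _ (a : Unit → ZMod p) _ l => sign (a ()) ^ l.val) feas_sign_star
    (bitReflection_unitary sqrt_two_unit) (PolyLE.of_le fun n => by simp)

/-- The comparison with `k` is a bit, so it can be copied `n` times; each copy then controls the
phase on one of the other qudits. -/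
lemma feas_threshold_star (k : ℕ) {v : ZMod p → ℂ} (hv : ∀ l, ‖v l‖ = 1) :
    Feas Fanin.th (fun n : ℕ => n) fun n => diagonal fun z : Unit ⊕ Fin n → ZMod p =>
      if k ≤ (z (Sum.inl ())).val then ∏ i, v (z (Sum.inr i)) else 1 := by
  have hT : Feas Fanin.th (fun n : ℕ => n) fun _ =>
      ctrlLocals fun (a : Unit → ZMod p) (_ : Unit) => shift (thr k Finset.univ a) :=
    Feas.of_gate fun _ => isGate_threshold k
  have hT' := hT.lift (κ := fun n => (Unit ⊕ Fin n) ⊕ (Unit ⊕ Fin n)) fun n =>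
    Function.Embedding.sumMap Function.Embedding.inl Function.Embedding.inl
  have hC := feas_bitCopies (p := p).lift (κ := fun n => (Unit ⊕ Fin n) ⊕ (Unit ⊕ Fin n)) fun n =>
    Function.Embedding.inr
  have hψ : Feas Fanin.th (fun n : ℕ => n) fun n =>
      diagonal fun z : (Unit ⊕ Fin n) ⊕ (Unit ⊕ Fin n) → ZMod p =>
        ∏ i, v (z (Sum.inl (Sum.inr i))) ^ (z (Sum.inr (Sum.inr i))).val :=
    feas_pair_phases (B := fun n : ℕ => Fin n) (κ := fun n => (Unit ⊕ Fin n) ⊕ (Unit ⊕ Fin n)) hv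
      (fun n => ⟨fun b => if b.2 then Sum.inl (Sum.inr b.1) else Sum.inr (Sum.inr b.1), by
        rintro ⟨i, (b | b)⟩ ⟨j, (c | c)⟩ h <;> simp_all⟩) (PolyLE.of_le fun n => by simp)
  refine Feas.diag_conj (hC.mul hT') hψ
    (((PolyLE.const 1).add PolyLE.refl).mono fun n => by simp) fun n z x h => ?_
  obtain ⟨w, hz, hw⟩ := mul_ne_zero_exists h
  obtain ⟨h1, h2⟩ := lift_ne_zero hz
  obtain ⟨h3, h4⟩ := lift_ne_zero hw
  obtain ⟨-, h5⟩ := ctrlLocals_ne_zero h4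
  obtain ⟨-, h6⟩ := ctrlLocals_ne_zero h2
  have hx : ∀ i, z (Sum.inl (Sum.inr i)) = x (Sum.inr i) := fun i =>
    (h1 _ (by simp)).trans (h3 _ (by simp))
  have hflag : w (Sum.inr (Sum.inl ())) = if k ≤ (x (Sum.inl ())).val then 1 else 0 := by
    by_contra h7
    refine h5 () (if_neg fun h8 => h7 ?_)
    refine (h8.trans (zero_add _)).trans ?_
    rw [thr, Fintype.sum_unique]
    rfl
  have hcopies : ∀ i, z (Sum.inr (Sum.inr i)) = w (Sum.inr (Sum.inl ())) := by
    intro i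
    have h7 : w (Sum.inr (Sum.inr i)) = 0 := h3 _ (by simp)
    have h8 := h6 i
    simp only [Function.comp_apply, Function.Embedding.inr_apply, h7] at h8
    refine bitCopy_ne_zero ?_ h8
    rw [hflag]
    split_ifs <;> simp
  simp only [hx, hcopies, hflag]
  split_ifs
  · simp [val_one_prime]
  · simp

open ZMod (stdAddChar)

theorem feas_starOp_th : Feas Fanin.th (fun n : ℕ => n) (starOp p) := by
  -- A value `c < p` is the number of `k < p` with `k + 1 ≤ c`, so its phase is a product of `p`
  -- bit-controlled phases. The number of factors does not depend on `n`, so they may be applied one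
  -- after another.
  have key : ∀ q : ℕ, Feas Fanin.th (fun n : ℕ => n) fun n =>
      diagonal fun z : Unit ⊕ Fin n → ZMod p =>
        ∏ k ∈ Finset.range q, if k + 1 ≤ (z (Sum.inl ())).val then
          ∏ i, stdAddChar (z (Sum.inr i)) else 1 := by
    intro q
    induction q with
    | zero => exact Feas.one.congr fun n => by simp
    | succ q ih =>
      refine (Feas.diag_mul ih (feas_threshold_star (q + 1) norm_stdAddChar)).congr fun n => ?_
      simp only [Finset.prod_range_succ]
  refine (key p).congr fun n => ?_
  rw [starOp]
  congr 1
  funext z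
  have h : (Finset.range p).filter (fun k => k + 1 ≤ (z (Sum.inl ())).val) =
      Finset.range (z (Sum.inl ())).val := by
    ext k
    have := ZMod.val_lt (z (Sum.inl ()))
    simp only [Finset.mem_filter, Finset.mem_range]
    omega
  rw [← Finset.prod_filter, h, Finset.prod_const, Finset.card_range, ← Finset.prod_pow]
  refine Finset.prod_congr rfl fun i _ => ?_
  rw [stdAddChar_mul_pow, mul_comm]

end BitCopies

/-! ### Gate-by-gate translation between the two gate sets. -/

section Translation

variable {d : ℕ} [NeZero d] {K K' : Fanin}

/-- The wires of an unbounded fan-in gate: its controls and its target. -/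
noncomputable def controlsTarget {N : ℕ} (t : Fin N) (S : Finset (Fin N)) (h : t ∉ S) :
    Fin S.card ⊕ Unit ↪ Fin N :=
  ⟨Sum.elim (fun i => (S.equivFin.symm i : Fin N)) fun _ => t, by
    rintro (i | i) (j | j) hij
    · simpa [Subtype.ext_iff] using hij
    · simp only [Sum.elim_inl, Sum.elim_inr] at hij
      exact absurd (hij ▸ (S.equivFin.symm i).2) h
    · simp only [Sum.elim_inl, Sum.elim_inr] at hij
      exact absurd (hij ▸ (S.equivFin.symm j).2) h
    · rfl⟩

lemma map_controlsTarget {N : ℕ} (t : Fin N) (S : Finset (Fin N)) (h : t ∉ S) :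
    Finset.univ.map (controlsTarget t S h) ⊆ insert t S := by
  intro j hj
  obtain ⟨i | i, _, rfl⟩ := Finset.mem_map.mp hj
  · exact Finset.mem_insert_of_mem (S.equivFin.symm i).2
  · exact Finset.mem_insert_self _ _

lemma sum_controlsTarget {N : ℕ} {M : Type*} [AddCommMonoid M] (t : Fin N) (S : Finset (Fin N))
    (h : t ∉ S) (f : Fin N → M) :
    ∑ i, f (controlsTarget t S h (Sum.inl i)) = ∑ j ∈ S, f j := by
  rw [← Finset.sum_coe_sort S, ← S.equivFin.symm.sum_comp]
  rfl

lemma qMOD_op {N : ℕ} (t : Fin N) (S : Finset (Fin N)) (h : t ∉ S) :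
    (Gate.qMOD (d := d) t S h).op = lift (controlsTarget t S h) (modOp d S.card) := by
  rw [modOp, ← tgt_eq_ctrlLocals (fun a => shift (∑ i, a i)), lift_tgt, Gate.op,
    ← tgt_eq_onTarget]
  congr 1
  funext y
  rw [← sum_controlsTarget t S h y]
  rfl

lemma qTH_op {N : ℕ} (k : ℕ) (t : Fin N) (S : Finset (Fin N)) (h : t ∉ S) :
    (Gate.qTH (d := d) k t S h).op = lift (controlsTarget t S h) (thOp d S.card k) := by
  rw [thOp, ← tgt_eq_ctrlLocals (fun a => shift (thr k Finset.univ a)), lift_tgt, Gate.op,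
    ← tgt_eq_onTarget]
  congr 1
  funext y
  rw [threshold, thr, ← sum_controlsTarget t S h fun j => (y j).val]
  rfl

/-- All gates of the first kind are uniformly implementable with gates of the second kind. -/
def Translates (d : ℕ) [NeZero d] (K K' : Fanin) : Prop :=
  ∃ (D : ℕ) (P : Polynomial ℕ), ∀ N, ∀ G ∈ gateSet d K N,
    ImplOn K' G.support D (P.eval N) G.op

lemma translates_th (h : Feas K' (J := ℕ × ℕ) (fun j => j.1) (ι := fun j => Fin j.1 ⊕ Unit)
    fun j => thOp d j.1 j.2) : Translates d Fanin.th K' := by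
  obtain ⟨D, P, hP⟩ := h
  -- The added 1 makes room for base gates, which are kept as they are.
  refine ⟨D + 1, P + 1, fun N G hG => ?_⟩
  rcases hG with hG | ⟨k, t, S, hS, rfl⟩
  · exact (ImplOn.gate (isGate_base hG)).mono le_rfl (Nat.le_add_left _ _) (by simp)
  · rw [qTH_op]
    refine ((hP (S.card, k)).lift (controlsTarget t S hS)).mono (map_controlsTarget t S hS)
      (Nat.le_add_right _ _) ?_
    simp only [Polynomial.eval_add, Polynomial.eval_one]
    exact (polynomial_eval_mono P (by simpa using S.card_le_univ)).trans (Nat.le_add_right _ _)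

lemma translates_mod (h : Feas K' (fun n : ℕ => n) (modOp d)) :
    Translates d Fanin.mod K' := by
  obtain ⟨D, P, hP⟩ := h
  refine ⟨D + 1, P + 1, fun N G hG => ?_⟩
  rcases hG with hG | ⟨t, S, hS, rfl⟩
  · exact (ImplOn.gate (isGate_base hG)).mono le_rfl (Nat.le_add_left _ _) (by simp)
  · rw [qMOD_op]
    refine ((hP S.card).lift (controlsTarget t S hS)).mono (map_controlsTarget t S hS)
      (Nat.le_add_right _ _) ?_
    simp only [Polynomial.eval_add, Polynomial.eval_one]
    exact (polynomial_eval_mono P (by simpa using S.card_le_univ)).trans (Nat.le_add_right _ _)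

lemma Translates.constantDepthClass_subset (h : Translates d K K') :
    constantDepthClass (gateSet d K) ⊆ constantDepthClass (gateSet d K') := by
  obtain ⟨D, P, hP⟩ := h
  rintro F ⟨E, Q, hQ⟩
  -- The summands bound the width, the original ancillas, and the number of gates times the cost of
  -- replacing one gate on at most `Q` wires.
  refine ⟨E * D, Q + (Q + Q * P.comp Q), fun n => ?_⟩
  have h1 := (hQ n).implOn (K := K') (D' := D) (s' := P.eval (Q.eval n)) fun N hN G hG =>
    (hP N G hG).mono le_rfl le_rfl (polynomial_eval_mono P hN)
  have h2 := h1.implementableIn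
  have hw : F.width n ≤ Q.eval n := by
    obtain ⟨a, C, _, _, _, h4, _⟩ := hQ n
    omega
  obtain ⟨a, C, c1, c2, c3, c4, c5⟩ := h2
  simp only [Polynomial.eval_add, Polynomial.eval_mul, Polynomial.eval_comp]
  exact ⟨a, C, c1, c2, c3, c4.trans (Nat.add_le_add_right hw _),
    c5.trans (Nat.add_le_add_right hw _)⟩

lemma Translates.implementableIn (h : Translates d K K')
    {G : ∀ n : ℕ, ℕ → Gate d (n + 1)} (hG : ∀ n k, G n k ∈ gateSet d K (n + 1)) :
    ∃ (D : ℕ) (P : Polynomial ℕ), ∀ n k : ℕ,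
      ImplementableIn (gateSet d K') (G n k).op D (P.eval n) := by
  obtain ⟨D, P, hP⟩ := h
  refine ⟨D, (Polynomial.X + 1) + P.comp (Polynomial.X + 1), fun n k => ?_⟩
  have := ((hP (n + 1) (G n k) (hG n k)).mono (Finset.subset_univ _) le_rfl le_rfl).implementableIn
  simpa [Polynomial.eval_comp] using this

end Translation

end Qudit

theorem theorem3p7 (p : ℕ) [Fact p.Prime] :
    (∃ (D : ℕ) (P : Polynomial ℕ), ∀ n k : ℕ,
      Qudit.ImplementableIn (Qudit.modGates p) (Qudit.qTHGate p n k).op D (P.eval n)) ∧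
    Qudit.iQNCMod p = Qudit.iQTC p := by
  have h1 : Qudit.Translates p Qudit.Fanin.th Qudit.Fanin.mod :=
    Qudit.translates_th Qudit.feas_thOp_mod
  have h2 : Qudit.Translates p Qudit.Fanin.mod Qudit.Fanin.th :=
    Qudit.translates_mod (Qudit.feas_modOp_of_starOp Qudit.feas_starOp_th)
  refine ⟨h1.implementableIn (G := fun n k => Qudit.qTHGate p n k) fun n k => ?_,
    Set.Subset.antisymm h2.constantDepthClass_subset h1.constantDepthClass_subset⟩
  exact Or.inr ⟨k, 0, _, _, rfl⟩
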